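/- The computational model is the deterministic random access machine with integer registers and memory, unit-cost operations ($+,-,\cdot$, integer division, indirect load and store, conditional jump) and logarithmic word size: on inputs of size $m$, all numbers occurring in a computation have absolute value polynomial in $m$. For a function $f$, $\tilde O(f(m))$ means $O(f(m)\cdot m^{o(1)})$. The 3SUM problem is: given three lists $A,B,C$ of $n$ integers from $\{-n^4,\dots,n^4\}$, decide whether there are $a\in A$, $b\in B$, $c\in C$ with $a+b=c$. The 3SUM Hypothesis states that, for every $\varepsilon>0$, no algorithm solves it in time $\tilde O(n^{2-\varepsilon})$. A join query is $q(X)\,\text{:-}\,R_1(X_1),\dots,R_\ell(X_\ell)$ with $\ell\ge 1$ and $X=X_1\cup\dots\cup X_\ell$, where each atom lists the variables in $X_i$ without repetition. It is self-join free if the relation symbols $R_i$ are pairwise different. It is acyclic if its hypergraph $(X,\{X_1,\dots,X_\ell\})$ can be reduced to one without vertices and without non-empty edges by repeatedly deleting a vertex contained in at most one edge or an edge that is a subset of another edge. The size $m$ of a database $D$ is its overall number of tuples; its domain elements are the elements occurring in its tuples, represented as $0,\dots,n-1$. Given an integer weight $w(e)$ for every domain element $e$ (polynomially bounded in $m$),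 the weight of an answer in $q(D)$ is the sum over all variables $x\in X$ of the weight of the value of $x$. A direct access algorithm for $q$ in sum order first preprocesses $D$ and $w$; afterwards, for any sequence of requested positions $i\ge 1$ (polynomially bounded in $m$), it returns the $i$-th entry of a fixed array that lists $q(D)$ without repetition by non-decreasing weight (ties being broken arbitrarily), or an error if there are fewer than $i$ answers. The access time is the time needed per request. The query is fixed, so constants may depend on it. **Theorem.** Assume the 3SUM Hypothesis. Let $q$ be an acyclic self-join free join query. Then there is a direct access algorithm for $q$ in sum order with preprocessing time $\tilde O(m)$ and access time $\tilde O(1)$ on databases of size $m$ if and only if some atom of $q$ contains all variables of $q$. -/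

import Mathlib

open Filter Topology Asymptotics

namespace SumDirectAccess

/-! ### Random access machines with logarithmic word size and unit-cost operations -/

/-- Instructions of a random access machine. Letters `r s t` name registers; the memory is
accessed only through addresses held in registers. -/
inductive Instr : Type
  | const (r : ℕ) (z : ℤ)      -- `r := z`
  | add (r s t : ℕ)            -- `r := s + t`
  | sub (r s t : ℕ)            -- `r := s - t`
  | mul (r s t : ℕ)            -- `r := s * t`
  | div (r s t : ℕ)            -- `r := s / t` (integer division, with `s / 0 = 0`)
  | load (r s : ℕ)             -- `r := memory[s]`
  | store (r s : ℕ)            -- `memory[r] := s`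
  | jumpPos (r : ℕ) (l : ℕ)    -- if `r > 0` go to line `l`

/-- A program is a finite list of instructions, with lines numbered from `0`. -/
abbrev Program : Type := List Instr

/-- A machine configuration: program counter, registers and memory. A program mentions only
finitely many registers. -/
structure Config where
  pc : ℕ
  reg : ℕ → ℤ
  mem : ℕ → ℤ

/-- Effect of one instruction. A negative address is read as the address `0`. -/
def Instr.exec : Instr → Config → Config
  | .const r z, c => ⟨c.pc + 1, Function.update c.reg r z, c.mem⟩
  | .add r s t, c => ⟨c.pc + 1, Function.update c.reg r (c.reg s + c.reg t), c.mem⟩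
  | .sub r s t, c => ⟨c.pc + 1, Function.update c.reg r (c.reg s - c.reg t), c.mem⟩
  | .mul r s t, c => ⟨c.pc + 1, Function.update c.reg r (c.reg s * c.reg t), c.mem⟩
  | .div r s t, c => ⟨c.pc + 1, Function.update c.reg r (c.reg s / c.reg t), c.mem⟩
  | .load r s, c => ⟨c.pc + 1, Function.update c.reg r (c.mem (c.reg s).toNat), c.mem⟩
  | .store r s, c => ⟨c.pc + 1, c.reg, Function.update c.mem (c.reg r).toNat (c.reg s)⟩
  | .jumpPos r l, c => ⟨if 0 < c.reg r then l else c.pc + 1, c.reg, c.mem⟩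

/-- The machine has halted when the program counter has left the program. -/
def Halted (P : Program) (c : Config) : Prop := P.length ≤ c.pc

/-- One step (one time unit); a halted configuration does not change. -/
def step (P : Program) (c : Config) : Config :=
  match P[c.pc]? with
  | some I => I.exec c
  | none => c

/-- All registers and all memory cells hold integers of absolute value at most `W`. -/
def Config.Fits (W : ℕ) (c : Config) : Prop :=
  (∀ r, |c.reg r| ≤ (W : ℤ)) ∧ ∀ a, |c.mem a| ≤ (W : ℤ)

/-- Started in `c`, program `P` halts in configuration `c'` after at most `T` steps, and all numbers
occurring on the way are at most `W` in absolute value. -/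
def RunsTo (P : Program) (T W : ℕ) (c c' : Config) : Prop :=
  ∃ t ≤ T, (step P)^[t] c = c' ∧ Halted P c' ∧ ∀ u ≤ t, ((step P)^[u] c).Fits W

/-- The start configuration for an input given as a list of integers: the list is written to the
memory from address `0` on; everything else is `0`. -/
def inputConfig (l : List ℤ) : Config := ⟨0, fun _ => 0, fun a => l.getD a 0⟩

/-- The start configuration with memory contents `M` and the argument `i` in register `0`. -/
def requestConfig (M : ℕ → ℤ) (i : ℕ) : Config := ⟨0, fun r => if r = 0 then (i : ℤ) else 0, M⟩

/-- `T` is in `Õ(f)`: it is in `O(f(n) · n^{o(1)})`. -/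
def IsSoftO (T : ℕ → ℕ) (f : ℕ → ℝ) : Prop :=
  ∃ h : ℕ → ℝ, Tendsto h atTop (𝓝 0) ∧
    (fun n => (T n : ℝ)) =O[atTop] fun n => f n * (n : ℝ) ^ h n

/-! ### The 3SUM problem -/

/-- There are `a ∈ A`, `b ∈ B`, `c ∈ C` with `a + b = c`. -/
def ThreeSum {n : ℕ} (A B C : Fin n → ℤ) : Prop := ∃ i j k, A i + B j = C k

open Classical in
/-- `P` solves 3SUM on three lists of length `n` with entries in `{-n^4, …, n^4}` in time `T n`, with
words of `O(log n)` bits; the answer (`1` for yes, `0` for no) is left in register `0`. -/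
def SolvesThreeSum (P : Program) (T : ℕ → ℕ) : Prop :=
  ∃ k : ℕ, ∀ (n : ℕ) (A B C : Fin n → ℤ),
    (∀ i, |A i| ≤ (n : ℤ) ^ 4) → (∀ i, |B i| ≤ (n : ℤ) ^ 4) → (∀ i, |C i| ≤ (n : ℤ) ^ 4) →
    ∃ c' : Config,
      RunsTo P (T n) ((n + k) ^ k)
        (inputConfig ((n : ℤ) :: (List.ofFn A ++ List.ofFn B ++ List.ofFn C))) c' ∧
      c'.reg 0 = if ThreeSum A B C then 1 else 0

/-- The 3SUM Hypothesis: no algorithm solves 3SUM in time `Õ(n^{2-ε})` for any `ε > 0`. -/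
def ThreeSumHypothesis : Prop :=
  ¬ ∃ ε : ℝ, 0 < ε ∧ ∃ (P : Program) (T : ℕ → ℕ),
    IsSoftO T (fun n => (n : ℝ) ^ (2 - ε)) ∧ SolvesThreeSum P T

/-! ### Acyclic hypergraphs -/

/-- One reduction step from `H` to `H'`: delete a vertex that is contained in at most one edge, or delete
an edge that is a subset of another edge. -/
inductive HypergraphReduces {V : Type} (H H' : Hypergraph V) : Prop
  | vertex (v : V) (hv : v ∈ H.vertexSet)
      (honce : ∀ e ∈ H.edgeSet, ∀ f ∈ H.edgeSet, v ∈ e → v ∈ f → e = f)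
      (hV : H'.vertexSet = H.vertexSet \ {v})
      (hE : H'.edgeSet = (fun e => e \ {v}) '' H.edgeSet)
  | edge (e f : Set V) (he : e ∈ H.edgeSet) (hf : f ∈ H.edgeSet) (hne : e ≠ f) (hef : e ⊆ f)
      (hV : H'.vertexSet = H.vertexSet)
      (hE : H'.edgeSet = H.edgeSet \ {e})

/-- A (finite) hypergraph is acyclic if it can be reduced until no vertex is left, and hence no edge
other than the empty one. -/
def HypergraphAcyclic {V : Type} (H : Hypergraph V) : Prop :=
  ∃ H' : Hypergraph V, Relation.ReflTransGen HypergraphReduces H H' ∧ H'.vertexSet = ∅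

/-! ### Join queries and databases -/

/-- A join query `q(x_0, …, x_{r-1}) :- R_1(X_1), …, R_ℓ(X_ℓ)` with `ℓ ≥ 1`, whose variables are
exactly those of its atoms. The symbols are exactly those occurring in `q`, and no variable is repeated
inside an atom. -/
structure JoinQuery where
  numVars : ℕ
  numSyms : ℕ
  numAtoms : ℕ
  numAtoms_pos : 0 < numAtoms
  arity : Fin numSyms → ℕ
  /-- the relation symbol of an atom -/
  sym : Fin numAtoms → Fin numSyms
  sym_surjective : Function.Surjective sym
  /-- the variables of an atom, in the order in which the atom lists them -/
  args : (i : Fin numAtoms) → Fin (arity (sym i)) → Fin numVars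
  args_injective : ∀ i, Function.Injective (args i)
  var_occurs : ∀ x, ∃ i j, args i j = x

namespace JoinQuery

/-- The set of variables in the scope of the `i`-th atom. -/
def scope (q : JoinQuery) (i : Fin q.numAtoms) : Set (Fin q.numVars) :=
  Set.range (q.args i)

/-- All relation symbols of the atoms are different. -/
def SelfJoinFree (q : JoinQuery) : Prop := Function.Injective q.sym

/-- The vertices are the variables, the edges are the scopes of the atoms. -/
def hypergraph (q : JoinQuery) : Hypergraph (Fin q.numVars) :=
  ⟨Set.univ, Set.range q.scope, fun _ _ => Set.subset_univ _⟩

def Acyclic (q : JoinQuery) : Prop := HypergraphAcyclic q.hypergraph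

end JoinQuery

/-- A database for `q`: the domain elements are `0, …, domSize - 1`, every one of them occurs in some
tuple, and every relation is given by a duplicate-free list of tuples, in any order. -/
structure Database (q : JoinQuery) where
  domSize : ℕ
  rel : (R : Fin q.numSyms) → List (Fin (q.arity R) → Fin domSize)
  rel_nodup : ∀ R, (rel R).Nodup
  dom_active : ∀ a : Fin domSize, ∃ R, ∃ t ∈ rel R, ∃ j, t j = a

namespace Database

variable {q : JoinQuery}

/-- The size `m` of a database: its overall number of tuples. -/
def size (D : Database q) : ℕ := ∑ R, (D.rel R).length

/-- The query result `q(D)`; an answer assigns a domain element to each variable. -/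
def answers (D : Database q) : Set (Fin q.numVars → Fin D.domSize) :=
  {s | ∀ i, (fun j => s (q.args i j)) ∈ D.rel (q.sym i)}

/-- The weight of a tuple: the sum of the weights of its entries. -/
def weight (D : Database q) (w : Fin D.domSize → ℤ) (s : Fin q.numVars → Fin D.domSize) : ℤ :=
  ∑ x, w (s x)

/-- `L` lists the query result without repetition in sum order, i.e. by non-decreasing weight. -/
def IsSumOrdered (D : Database q) (w : Fin D.domSize → ℤ)
    (L : List (Fin q.numVars → Fin D.domSize)) : Prop :=
  L.Nodup ∧ (∀ s, s ∈ L ↔ s ∈ D.answers) ∧ L.Pairwise fun s t => D.weight w s ≤ D.weight w t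

/-- The input to the algorithm: the domain size, the table of weights, and for each relation its number
of tuples followed by these tuples. -/
def encode (D : Database q) (w : Fin D.domSize → ℤ) : List ℤ :=
  (D.domSize : ℤ) :: (List.ofFn w ++
    (List.ofFn fun R => ((D.rel R).length : ℤ) ::
      (D.rel R).flatMap fun t => List.ofFn fun j => ((t j : ℕ) : ℤ)).flatten)

end Database

/-- The registers of a halted access phase hold the reply `o`: register `0` holds `0` to report an
error, and otherwise `1`, with the tuple in the registers `1, …, numVars`. -/
def IsReply {r n : ℕ} (c : Config) : Option (Fin r → Fin n) → Prop
  | none => c.reg 0 = 0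
  | some s => c.reg 0 = 1 ∧ ∀ x : Fin r, c.reg (x + 1) = ((s x : ℕ) : ℤ)

/-- There is a direct access algorithm for `q` in sum order, on databases of size `m`, with
preprocessing time `Õ(p(m))` and access time `Õ(a(m))`.

The algorithm consists of a preprocessing program `pre` and an access program `acc`. They are run with
words of `O(log m)` bits, on weights and positions of `O(log m)` bits, i.e. bounded by `(m + d)^d` for an
arbitrary constant `d`. After preprocessing, any sequence of positions can be requested: `Inv` is a
property of the memory that holds after preprocessing and is maintained by each access. For a position
`i ≥ 1`, the reply is the `i`-th entry of a fixed array `L` listing the query result in sum order, or an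
error if there is no such entry. -/
def AdmitsSumDirectAccess (q : JoinQuery) (p a : ℕ → ℝ) : Prop :=
  ∃ pre acc : Program, ∀ d : ℕ, ∃ (k : ℕ) (Tp Ta : ℕ → ℕ), IsSoftO Tp p ∧ IsSoftO Ta a ∧
    ∀ (D : Database q) (w : Fin D.domSize → ℤ),
      (∀ e, |w e| ≤ (((D.size + d) ^ d : ℕ) : ℤ)) →
      ∃ L : List (Fin q.numVars → Fin D.domSize), D.IsSumOrdered w L ∧
      ∃ Inv : (ℕ → ℤ) → Prop,
        (∃ c : Config,
          RunsTo pre (Tp D.size) ((D.size + k) ^ k) (inputConfig (D.encode w)) c ∧ Inv c.mem) ∧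
        ∀ M : ℕ → ℤ, Inv M → ∀ i : ℕ, 1 ≤ i → i ≤ (D.size + d) ^ d →
          ∃ c : Config,
            RunsTo acc (Ta D.size) ((D.size + k) ^ k) (requestConfig M i) c ∧
            IsReply c L[i - 1]? ∧ Inv c.mem

end SumDirectAccess

open SumDirectAccess

/-!
Suppose first that some atom `i₀` contains all variables. Then every answer is given by a tuple of the
relation of `i₀`, so there are at most `m` answers, and all of them can be listed and sorted in advance. The
preprocessing program enters the tuples of all relations into a table that is indexed by codes of tuples;
it has polynomial size, but is blank at the start and need not be initialised. With the table it filters the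
tuples of `i₀` that satisfy the other atoms. Each answer becomes a single number, its weight (made
non-negative) followed by the index of its tuple as last digit, and these keys are sorted by radix sort, in
`O(log m)` passes since they are polynomially bounded. An access reads one cell of the sorted array. This is
`admitsSumDirectAccess_of_full_atom`; the correctness of the programs rests on `exec_preprocess` and
`exec_access`.

Conversely, suppose that no atom contains all variables. Acyclic hypergraphs are conformal
(`HypergraphAcyclic.exists_edge_eq_vertexSet`), so there are two variables `x` and `y` without a common atom.
For two lists `A` and `B` of length `n`, there is a database of size `O(n)` in which `x` and `y` range
independently over `n` elements each, with the entries of `A` and `B` as weights, while all other variables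
are constant: its answers in sum order are the `n ^ 2` pairwise sums in sorted order, up to a constant
(`Database.IsSumOrdered.pairSums`). This uses that the query is self-join free: the relations of the atoms
can be chosen separately. Direct access then allows one to look for each `c ∈ C` by binary search among the
sums. The program that does so (`threeSumSolver`) runs the two given programs as subroutines, on registers and
memory cells set apart for them (`exec_simulate`). It takes time `Õ(n)` for the preprocessing and `n` times
`O(log n)` accesses of time `n ^ o(1)`, which is `O(n ^ (3 / 2))` and contradicts the 3SUM Hypothesis
(`AdmitsSumDirectAccess.exists_solvesThreeSum`).

Programs are composed from code fragments whose jump targets depend on the line where the fragment is placed.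
They are verified with the total correctness triples `Exec`, which bound the running time and the numbers
that occur along with the final state.
-/

namespace SumDirectAccess

/-! ### A program logic for random access machines -/

/-- A piece of code, as a function of the line at which it is placed: the targets of its jumps are
absolute line numbers. -/
abbrev Fragment : Type := ℕ → List Instr

/-- A property of the registers and the memory. -/
abbrev Assertion : Type := (ℕ → ℤ) → (ℕ → ℤ) → Prop

/-- The lines of `P` from `p` on are `l`. -/
def Placed (P : Program) (p : ℕ) (l : List Instr) : Prop := ∀ j < l.length, P[p + j]? = l[j]?

/-- From `c`, within `T` steps and with all numbers bounded by `W`, program `P` reaches a configuration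
with property `Q`, which need not be a halted one. -/
def Reaches (P : Program) (W T : ℕ) (c : Config) (Q : Config → Prop) : Prop :=
  ∃ t ≤ T, (∀ u ≤ t, ((step P)^[u] c).Fits W) ∧ Q ((step P)^[t] c)

/-- The total correctness triple: wherever the fragment `F` is placed in a program, when it is entered
with registers `ρ` and memory `μ`, control reaches the line after it within `T` steps, with all numbers
bounded by `W`, and registers and memory then satisfy `Q`. -/
def Exec (W T : ℕ) (F : Fragment) (Q : Assertion) (ρ μ : ℕ → ℤ) : Prop :=
  Config.Fits W ⟨0, ρ, μ⟩ → ∀ P p, Placed P p (F p) →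
    Reaches P W T ⟨p, ρ, μ⟩ fun c => c.pc = p + (F p).length ∧ Q c.reg c.mem

theorem Placed.append_left {P : Program} {p : ℕ} {l l' : List Instr} (h : Placed P p (l ++ l')) :
    Placed P p l := by
  intro j hj
  rw [h j (by simp; omega), List.getElem?_append_left hj]

theorem Placed.append_right {P : Program} {p : ℕ} {l l' : List Instr} (h : Placed P p (l ++ l')) :
    Placed P (p + l.length) l' := by
  intro j hj
  rw [add_assoc, h _ (by simp; omega), List.getElem?_append_right (by omega)]
  simp

theorem Placed.head {P : Program} {p : ℕ} {I : Instr} {l : List Instr} (h : Placed P p (I :: l)) :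
    P[p]? = some I := by
  simpa using h 0 (by simp)

theorem Placed.tail {P : Program} {p : ℕ} {I : Instr} {l : List Instr} (h : Placed P p (I :: l)) :
    Placed P (p + 1) l := by
  have := Placed.append_right (l := [I]) h
  simpa using this

theorem Reaches.refl {P : Program} {W T : ℕ} {c : Config} {Q : Config → Prop} (hc : c.Fits W)
    (hQ : Q c) : Reaches P W T c Q :=
  ⟨0, Nat.zero_le _, fun u hu => by obtain rfl : u = 0 := by omega
                                    exact hc, hQ⟩

theorem Reaches.trans {P : Program} {W T₁ T₂ : ℕ} {c : Config} {Q R : Config → Prop}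
    (h : Reaches P W T₁ c Q) (h' : ∀ c', c'.Fits W → Q c' → Reaches P W T₂ c' R) :
    Reaches P W (T₁ + T₂) c R := by
  obtain ⟨t, ht, hf, hQ⟩ := h
  obtain ⟨t', ht', hf', hR⟩ := h' _ (hf t le_rfl) hQ
  refine ⟨t' + t, by omega, fun u hu => ?_, by rwa [Function.iterate_add_apply]⟩
  rcases le_total u t with h | h
  · exact hf u h
  · obtain ⟨v, rfl⟩ := Nat.exists_eq_add_of_le' h
    rw [Function.iterate_add_apply]
    exact hf' v (by omega)

theorem Reaches.mono {P : Program} {W T T' : ℕ} {c : Config} {Q R : Config → Prop}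
    (h : Reaches P W T c Q) (hT : T ≤ T') (hQ : ∀ c', Q c' → R c') : Reaches P W T' c R := by
  obtain ⟨t, ht, hf, h⟩ := h
  exact ⟨t, ht.trans hT, hf, hQ _ h⟩

theorem Reaches.step {P : Program} {W T : ℕ} {c : Config} {Q : Config → Prop} (hc : c.Fits W)
    (h : Reaches P W T (step P c) Q) : Reaches P W (T + 1) c Q := by
  obtain ⟨t, ht, hf, hQ⟩ := h
  refine ⟨t + 1, by omega, fun u hu => ?_, hQ⟩
  cases u with
  | zero => exact hc
  | succ u => exact hf u (by omega)

theorem Exec.mono {W T T' : ℕ} {F : Fragment} {Q R : Assertion} {ρ μ : ℕ → ℤ}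
    (h : Exec W T F Q ρ μ) (hT : T ≤ T') (hQ : ∀ ρ μ, Q ρ μ → R ρ μ) : Exec W T' F R ρ μ :=
  fun hf P p hp => (h hf P p hp).mono hT fun _ hc => ⟨hc.1, hQ _ _ hc.2⟩

/-- A fragment that runs from line `0` as a program of its own. -/
theorem Exec.runsTo {W T : ℕ} {F : Fragment} {Q : Assertion} {ρ μ : ℕ → ℤ}
    (h : Exec W T F Q ρ μ) (hf : Config.Fits W ⟨0, ρ, μ⟩) :
    ∃ c, RunsTo (F 0) T W ⟨0, ρ, μ⟩ c ∧ Q c.reg c.mem := by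
  obtain ⟨t, ht, hu, hpc, hQ⟩ := h hf (F 0) 0 fun j _ => by simp
  exact ⟨_, ⟨t, ht, rfl, by simp [Halted, hpc], hu⟩, hQ⟩

/-- Sequential composition. -/
def seq (F G : Fragment) : Fragment := fun p => F p ++ G (p + (F p).length)

infixr:60 " ;; " => seq

/-- Skip `F` if register `r` is positive. -/
def skipIf (r : ℕ) (F : Fragment) : Fragment := fun p =>
  .jumpPos r (p + 1 + (F (p + 1)).length) :: F (p + 1)

/-- Run `F` once, and again as long as register `r` is positive afterwards. -/
def doWhile (F : Fragment) (r : ℕ) : Fragment := fun p => F p ++ [.jumpPos r p]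

/-- A straight-line piece of code. -/
def ops (l : List Instr) : Fragment := fun _ => l

theorem Exec.seq {W T₁ T₂ : ℕ} {F G : Fragment} {Q : Assertion} {ρ μ : ℕ → ℤ}
    (h : Exec W T₁ F (fun ρ' μ' => Exec W T₂ G Q ρ' μ') ρ μ) : Exec W (T₁ + T₂) (F ;; G) Q ρ μ := by
  intro hf P p hp
  refine (h hf P p hp.append_left).trans fun c hc hQ => ?_
  obtain ⟨pc, ρ', μ'⟩ := c
  obtain ⟨rfl, hQ⟩ := hQ
  refine (hQ hc P _ hp.append_right).mono le_rfl fun c hc => ⟨?_, hc.2⟩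
  simp [SumDirectAccess.seq, hc.1, add_assoc]

/-- The rule for conditionals: the two hypotheses are the cases in which `F` is run and skipped. -/
theorem Exec.skipIf {W T r : ℕ} {F : Fragment} {Q : Assertion} {ρ μ : ℕ → ℤ}
    (h : ρ r ≤ 0 → Exec W T F Q ρ μ) (h' : 0 < ρ r → Q ρ μ) : Exec W (T + 1) (skipIf r F) Q ρ μ := by
  intro hf P p hp
  refine Reaches.step hf ?_
  have hs : step P ⟨p, ρ, μ⟩ = ⟨if 0 < ρ r then p + 1 + (F (p + 1)).length else p + 1, ρ, μ⟩ := by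
    rw [step, hp.head]; rfl
  rw [hs]
  split_ifs with hr
  · refine Reaches.refl hf ⟨?_, h' hr⟩
    simp [SumDirectAccess.skipIf]; omega
  · refine (h (not_lt.1 hr) hf P _ hp.tail).mono le_rfl fun c hc => ⟨?_, hc.2⟩
    simp [SumDirectAccess.skipIf, hc.1]; omega

/-- The rule for loops: `I k` is an invariant that holds whenever the loop body is entered and allows for
at most `k` further iterations. -/
theorem Exec.doWhile {W T r : ℕ} {F : Fragment} {Q : Assertion} (I : ℕ → Assertion)
    (h : ∀ k ρ μ, I (k + 1) ρ μ →
      Exec W T F (fun ρ' μ' => (0 < ρ' r → 0 < k ∧ I k ρ' μ') ∧ (ρ' r ≤ 0 → Q ρ' μ')) ρ μ)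
    (n : ℕ) {ρ μ : ℕ → ℤ} (hI : I n ρ μ) (hn : 0 < n) :
    Exec W (n * (T + 1)) (doWhile F r) Q ρ μ := by
  obtain ⟨n, rfl⟩ : ∃ k, n = k + 1 := ⟨n - 1, by omega⟩
  clear hn
  induction n generalizing ρ μ with
  | zero =>
    intro hf P p hp
    refine ((h 0 ρ μ hI hf P p hp.append_left).trans (T₂ := 1) fun c hc hQ => ?_).mono
      (by omega) fun _ h => h
    obtain ⟨pc, ρ', μ'⟩ := c
    obtain ⟨rfl, h1, h2⟩ := hQ
    have hr : ¬ 0 < ρ' r := fun hr => absurd (h1 hr).1 (lt_irrefl _)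
    refine Reaches.step hc ?_
    have hs : step P ⟨p + (F p).length, ρ', μ'⟩ = ⟨p + (F p).length + 1, ρ', μ'⟩ := by
      rw [step, hp.append_right.head]; simp [Instr.exec, hr]
    rw [hs]
    exact Reaches.refl hc ⟨by simp [SumDirectAccess.doWhile, add_assoc], h2 (not_lt.1 hr)⟩
  | succ n ih =>
    intro hf P p hp
    refine ((h _ ρ μ hI hf P p hp.append_left).trans (T₂ := (n + 1) * (T + 1) + 1)
      fun c hc hQ => ?_).mono (by ring_nf; omega) fun _ h => h
    obtain ⟨pc, ρ', μ'⟩ := c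
    obtain ⟨rfl, h1, h2⟩ := hQ
    refine Reaches.step hc ?_
    have hs : step P ⟨p + (F p).length, ρ', μ'⟩ =
        ⟨if 0 < ρ' r then p else p + (F p).length + 1, ρ', μ'⟩ := by
      rw [step, hp.append_right.head]; rfl
    rw [hs]
    split_ifs with hr
    · exact ih (h1 hr).2 hc P p hp
    · exact Reaches.refl hc ⟨by simp [SumDirectAccess.doWhile, add_assoc], h2 (not_lt.1 hr)⟩

/-- The weakest precondition of a straight-line piece of code: all values that it computes are bounded
by `W`, and the final registers and memory satisfy `Q`. -/
def OpsPre (W : ℕ) : List Instr → Assertion → Assertion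
  | [], Q, ρ, μ => Q ρ μ
  | .const r z :: l, Q, ρ, μ => |z| ≤ W ∧ OpsPre W l Q (Function.update ρ r z) μ
  | .add r s t :: l, Q, ρ, μ =>
    |ρ s + ρ t| ≤ W ∧ OpsPre W l Q (Function.update ρ r (ρ s + ρ t)) μ
  | .sub r s t :: l, Q, ρ, μ =>
    |ρ s - ρ t| ≤ W ∧ OpsPre W l Q (Function.update ρ r (ρ s - ρ t)) μ
  | .mul r s t :: l, Q, ρ, μ =>
    |ρ s * ρ t| ≤ W ∧ OpsPre W l Q (Function.update ρ r (ρ s * ρ t)) μ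
  | .div r s t :: l, Q, ρ, μ =>
    |ρ s / ρ t| ≤ W ∧ OpsPre W l Q (Function.update ρ r (ρ s / ρ t)) μ
  | .load r s :: l, Q, ρ, μ => OpsPre W l Q (Function.update ρ r (μ (ρ s).toNat)) μ
  | .store r s :: l, Q, ρ, μ => OpsPre W l Q ρ (Function.update μ (ρ r).toNat (ρ s))
  | .jumpPos _ _ :: _, _, _, _ => False

theorem fits_update_reg {W p r : ℕ} {ρ μ : ℕ → ℤ} {z : ℤ} (h : Config.Fits W ⟨p, ρ, μ⟩)
    (hz : |z| ≤ W) (p' : ℕ) : Config.Fits W ⟨p', Function.update ρ r z, μ⟩ :=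
  ⟨fun x => by
    by_cases hx : x = r
    · subst hx; simpa using hz
    · simpa [Function.update_of_ne hx] using h.1 x, h.2⟩

theorem fits_update_mem {W p a : ℕ} {ρ μ : ℕ → ℤ} {z : ℤ} (h : Config.Fits W ⟨p, ρ, μ⟩)
    (hz : |z| ≤ W) (p' : ℕ) : Config.Fits W ⟨p', ρ, Function.update μ a z⟩ :=
  ⟨h.1, fun x => by
    by_cases hx : x = a
    · subst hx; simpa using hz
    · simpa [Function.update_of_ne hx] using h.2 x⟩

theorem Exec.ops {W : ℕ} {l : List Instr} {Q : Assertion} {ρ μ : ℕ → ℤ} (h : OpsPre W l Q ρ μ) :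
    Exec W l.length (ops l) Q ρ μ := by
  induction l generalizing ρ μ with
  | nil => exact fun hf P p hp => Reaches.refl hf ⟨rfl, h⟩
  | cons I l ih =>
    intro hf P p hp
    refine Reaches.step hf ?_
    have hs : step P ⟨p, ρ, μ⟩ = I.exec ⟨p, ρ, μ⟩ := by rw [step, hp.head]
    rw [hs]
    have key : ∀ ρ' μ', Config.Fits W ⟨0, ρ', μ'⟩ → OpsPre W l Q ρ' μ' →
        Reaches P W l.length ⟨p + 1, ρ', μ'⟩
          (fun c => c.pc = p + (I :: l).length ∧ Q c.reg c.mem) := fun ρ' μ' hf' h' =>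
      (ih h' hf' P _ hp.tail).mono le_rfl fun c hc =>
        ⟨by simp only [hc.1, SumDirectAccess.ops, List.length_cons]; omega, hc.2⟩
    cases I with
    | jumpPos r l => exact h.elim
    | load r s => exact key _ _ (fits_update_reg hf (hf.2 _) 0) h
    | store r s => exact key _ _ (fits_update_mem hf (hf.1 _) 0) h
    | _ => exact key _ _ (fits_update_reg hf h.1 0) h.2

theorem Exec.block {W T : ℕ} {l : List Instr} {Q : Assertion} {ρ μ : ℕ → ℤ} (hT : l.length ≤ T)
    (h : OpsPre W l Q ρ μ) : Exec W T (SumDirectAccess.ops l) Q ρ μ :=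
  (Exec.ops h).mono hT fun _ _ h => h

/-- Straight-line code, with a time bound and a continuation. -/
theorem Exec.ops_seq {W T : ℕ} {l : List Instr} {F : Fragment} {Q : Assertion} {ρ μ : ℕ → ℤ}
    (h : OpsPre W l (fun ρ' μ' => Exec W T F Q ρ' μ') ρ μ) :
    Exec W (l.length + T) (SumDirectAccess.ops l ;; F) Q ρ μ := (Exec.ops h).seq

/-- The fragments `F 0, …, F (n - 1)` one after the other. -/
def seqN (F : ℕ → Fragment) : ℕ → Fragment
  | 0 => ops []
  | n + 1 => seqN F n ;; F n

/-- The rule for sequences of fixed length, with an invariant `I`. -/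
theorem Exec.seqN {W T : ℕ} {F : ℕ → Fragment} {n : ℕ} (I : ℕ → Assertion)
    (h : ∀ k < n, ∀ ρ μ, I k ρ μ → Exec W T (F k) (I (k + 1)) ρ μ) {ρ μ : ℕ → ℤ} (h0 : I 0 ρ μ) :
    Exec W (n * T) (seqN F n) (I n) ρ μ := by
  induction n with
  | zero => exact (Exec.ops (l := []) h0).mono (by simp) fun _ _ h => h
  | succ n ih =>
    refine (Exec.seq (T₂ := T) ((ih fun k hk => h k (by omega)).mono le_rfl
      fun ρ' μ' hI => h n (by omega) ρ' μ' hI)).mono (by ring_nf; omega) fun _ _ h => h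

/-- `for i = 0, …, n - 1 do F`, where the bound is in register `n`; register `t` is auxiliary. -/
def forLoop (i n t : ℕ) (F : Fragment) : Fragment :=
  ops [.const i 0, .const t 1, .sub t t n] ;;
    skipIf t (doWhile (F ;; ops [.const t 1, .add i i t, .sub t n i]) t)

/-- The rule for counting loops: `I k` holds before the iteration with index `k`, and it does not depend
on the registers of the loop itself. -/
theorem Exec.forLoop {W T i n t : ℕ} {F : Fragment} {Q : Assertion} {ρ μ : ℕ → ℤ} (N : ℕ)
    (I : ℕ → Assertion) (hin : i ≠ n) (hit : i ≠ t) (hnt : n ≠ t) (hW : N + 1 ≤ W)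
    (hn : ρ n = N)
    (hstable : ∀ k ρ μ x y, I k ρ μ → I k (Function.update (Function.update ρ i x) t y) μ)
    (h0 : I 0 ρ μ)
    (hbody : ∀ k < N, ∀ ρ μ, I k ρ μ → ρ i = k → ρ n = N →
      Exec W T F (fun ρ' μ' => ρ' i = k ∧ ρ' n = N ∧ I (k + 1) ρ' μ') ρ μ)
    (hQ : ∀ ρ μ, I N ρ μ → ρ n = N → Q ρ μ) :
    Exec W (4 + N * (T + 4)) (forLoop i n t F) Q ρ μ := by
  have hti := hit.symm
  have hni := hin.symm
  have htn := hnt.symm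
  have hupd : ∀ (ρ : ℕ → ℤ) (x y z : ℤ), Function.update (Function.update (Function.update ρ i x) t y) t z
      = Function.update (Function.update ρ i x) t z := fun ρ x y z => by simp
  have hupd' : ∀ (ρ : ℕ → ℤ) (x y z : ℤ),
      Function.update (Function.update (Function.update ρ t x) i y) t z
      = Function.update (Function.update ρ i y) t z := fun ρ x y z => by
    rw [Function.update_comm hti, Function.update_idem]
  have hinit : OpsPre W [.const i 0, .const t 1, .sub t t n] (fun ρ' μ' =>
      Exec W (N * (T + 4) + 1) (SumDirectAccess.skipIf t (SumDirectAccess.doWhile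
        (F ;; SumDirectAccess.ops [.const t 1, .add i i t, .sub t n i]) t)) Q ρ' μ') ρ μ := by
    simp only [OpsPre, Function.update_self,
      Function.update_of_ne hnt, Function.update_of_ne hni, hn, hupd]
    refine ⟨by simp, by simp; omega, by rw [abs_le]; omega, Exec.skipIf (fun hr => ?_) fun hr => ?_⟩
    · simp only [Function.update_self] at hr
      refine Exec.doWhile (T := T + 3) (fun m ρ μ => ∃ k, k + m = N ∧ ρ i = k ∧ ρ n = N ∧ I k ρ μ) ?_ N
        ⟨0, by simp [hit, hni, hnt, hn, hstable _ _ _ _ _ h0]⟩ (by omega)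
      rintro m ρ μ ⟨k, hk, hi, hn, hI⟩
      refine (Exec.seq (T₂ := 3) ((hbody k (by omega) ρ μ hI hi hn).mono le_rfl ?_))
      rintro ρ' μ' ⟨hi', hn', hI'⟩
      refine Exec.ops (l := [.const t 1, .add i i t, .sub t n i]) ?_
      simp only [OpsPre, Function.update_self,
        Function.update_of_ne hnt, Function.update_of_ne hni, Function.update_of_ne hit,
        hi', hn', hupd']
      refine ⟨by simp; omega, by rw [abs_le]; omega, by rw [abs_le]; omega, fun hr => ?_, fun hr => ?_⟩
      · exact ⟨by omega, k + 1, by omega, by push_cast; rfl, trivial, hstable _ _ _ _ _ hI'⟩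
      · obtain rfl : k + 1 = N := by omega
        refine hQ _ _ (hstable _ _ _ _ _ hI') ?_
        simp [Function.update_of_ne hnt, Function.update_of_ne hni, hn']
    · simp only [Function.update_self] at hr
      obtain rfl : N = 0 := by omega
      exact hQ _ _ (hstable _ _ _ _ _ h0) (by simp [Function.update_of_ne hnt, Function.update_of_ne hni, hn])
  exact (Exec.ops_seq hinit).mono (by simp; omega) fun _ _ h => h

/-! ### Sorting an array of integers -/

/-- The memory contains the list `l` from address `b` on. -/
def Holds (μ : ℕ → ℤ) (b : ℕ) (l : List ℤ) : Prop := ∀ j (h : j < l.length), μ (b + j) = l[j]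

theorem holds_nil (μ : ℕ → ℤ) (b : ℕ) : Holds μ b [] := fun _ h => absurd h (Nat.not_lt_zero _)

theorem holds_append {μ : ℕ → ℤ} {b : ℕ} {l l' : List ℤ} :
    Holds μ b (l ++ l') ↔ Holds μ b l ∧ Holds μ (b + l.length) l' := by
  constructor
  · refine fun h => ⟨fun j hj => ?_, fun j hj => ?_⟩
    · rw [h j (by simp; omega), List.getElem_append_left hj]
    · rw [add_assoc, h _ (by simp; omega), List.getElem_append_right (by omega)]
      simp
  · rintro ⟨h, h'⟩ j hj
    by_cases hl : j < l.length
    · rw [List.getElem_append_left hl, h]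
    · rw [List.getElem_append_right (by omega), ← h' (j - l.length) (by simp at hj; omega)]
      congr 1; omega

theorem holds_singleton {μ : ℕ → ℤ} {b : ℕ} {z : ℤ} : Holds μ b [z] ↔ μ b = z := by
  refine ⟨fun h => by simpa using h 0 (by simp), fun h j hj => ?_⟩
  obtain rfl : j = 0 := by simpa using hj
  simpa using h

theorem holds_cons {μ : ℕ → ℤ} {b : ℕ} {z : ℤ} {l : List ℤ} :
    Holds μ b (z :: l) ↔ μ b = z ∧ Holds μ (b + 1) l := by
  rw [← List.singleton_append, holds_append, holds_singleton]; rfl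

theorem Holds.congr {μ μ' : ℕ → ℤ} {b : ℕ} {l : List ℤ} (h : Holds μ b l)
    (h' : ∀ a, b ≤ a → a < b + l.length → μ' a = μ a) : Holds μ' b l := fun j hj => by
  rw [h' _ (by omega) (by omega), h j hj]

theorem Holds.update {μ : ℕ → ℤ} {b a : ℕ} {l : List ℤ} {v : ℤ} (h : Holds μ b l)
    (ha : a < b ∨ b + l.length ≤ a) : Holds (Function.update μ a v) b l :=
  h.congr fun x _ _ => Function.update_of_ne (by omega) _ _

theorem Holds.concat {μ : ℕ → ℤ} {b a : ℕ} {l : List ℤ} {v : ℤ} (h : Holds μ b l)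
    (ha : a = b + l.length) : Holds (Function.update μ a v) b (l ++ [v]) :=
  holds_append.2 ⟨h.update (.inr ha.ge), holds_singleton.2 (by simp [ha])⟩

/-- Stable partition of the array at the address in register 7, whose length is in register 10, by the
binary digit with the weight in register 12. The entries with digit 0 are moved within the array, the
others are collected at the address in register 8 and copied back. Each entry is written to both places,
and only the cursor of the right one is moved: at the other place it is overwritten later or was just read. -/
def partitionPass : Fragment :=
  ops [.const 15 0, .const 16 0] ;;
  forLoop 13 10 14 (ops [.add 19 7 13, .load 17 19, .div 18 17 12, .const 19 2, .div 20 18 19,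
    .mul 20 20 19, .sub 18 18 20, .add 19 7 15, .store 19 17, .add 19 8 16, .store 19 17,
    .add 16 16 18, .add 15 15 1, .sub 15 15 18]) ;;
  forLoop 13 16 14 (ops [.add 19 8 13, .load 17 19, .add 19 7 15, .store 19 17, .add 15 15 1])

/-- The list with the elements of even quotient by `p` moved to the front. -/
def partitionBy (p : ℤ) (l : List ℤ) : List ℤ :=
  l.filter (fun v => v / p % 2 = 0) ++ l.filter (fun v => !decide (v / p % 2 = 0))

/-- The two cursors are the lengths of the parts of the list processed so far, so the first loop copies
the entries with digit 0 to cells that have already been read. -/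
theorem exec_partitionPass {W bA bB p K : ℕ} {xs : List ℤ} {ρ₀ μ₀ : ℕ → ℤ}
    (h1 : ρ₀ 1 = 1) (h7 : ρ₀ 7 = bA) (h8 : ρ₀ 8 = bB) (h10 : ρ₀ 10 = xs.length) (h12 : ρ₀ 12 = p)
    (hp : 0 < p) (hA : Holds μ₀ bA xs) (hAB : bA + xs.length ≤ bB) (hx : ∀ v ∈ xs, 0 ≤ v ∧ v < K)
    (hK : K + 2 ≤ W) (hW : bB + xs.length + 2 ≤ W) :
    Exec W (xs.length * 27 + 10) partitionPass (fun ρ μ => (∀ r ≤ 12, ρ r = ρ₀ r) ∧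
      (∀ a < bA, μ a = μ₀ a) ∧ Holds μ bA (partitionBy p xs)) ρ₀ μ₀ := by
  set f0 : ℤ → Bool := fun v => v / p % 2 = 0 with hf0
  have hf : ∀ v, f0 v = true ↔ v / p % 2 = 0 := fun v => decide_eq_true_iff
  have hP : partitionBy p xs = xs.filter f0 ++ xs.filter fun v => !f0 v := rfl
  rw [hP]
  clear_value f0
  set f1 : ℤ → Bool := fun v => !f0 v with hf1
  have hlen : ∀ l : List ℤ, (l.filter f0).length + (l.filter f1).length = l.length := fun l =>
    List.length_eq_length_filter_add _ |>.symm
  have hlenk : ∀ k, k ≤ xs.length → ((xs.take k).filter f0).length + ((xs.take k).filter f1).length = k :=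
    fun k hk => by rw [hlen]; simpa using hk
  refine (Exec.ops_seq (T := (4 + xs.length * (14 + 4)) + (4 + xs.length * (5 + 4))) ?_).mono
    (by simp; omega) fun _ _ h => h
  simp only [OpsPre]
  refine ⟨by simp, by simp, ?_⟩
  refine Exec.seq ?_
  refine Exec.forLoop xs.length (fun k ρ μ => (∀ r ≤ 12, ρ r = ρ₀ r) ∧ (∀ a < bA, μ a = μ₀ a) ∧
    ρ 15 = ((xs.take k).filter f0).length ∧ ρ 16 = ((xs.take k).filter f1).length ∧
    Holds μ bA ((xs.take k).filter f0) ∧ Holds μ bB ((xs.take k).filter f1) ∧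
    ∀ j (h : j < xs.length), k ≤ j → μ (bA + j) = xs[j]) (by decide) (by decide) (by decide) (by omega)
    (by simpa using h10) ?_ ?_ ?_ ?_
  · rintro k ρ μ x y ⟨hr, h⟩
    refine ⟨fun r hr' => ?_, ?_⟩
    · rw [Function.update_of_ne (by omega), Function.update_of_ne (by omega), hr r hr']
    · simpa using h
  · refine ⟨fun r hr => ?_, fun _ _ => rfl, by simp, by simp, by simp [holds_nil], by simp [holds_nil],
      fun j hj _ => hA j hj⟩
    rw [Function.update_of_ne (by omega), Function.update_of_ne (by omega)]
  · rintro k hk ρ μ ⟨hr, hm, h15, h16, hH0, hH1, hrest⟩ h13 hn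
    have g1 : ρ 1 = 1 := by rw [hr 1 (by norm_num), h1]
    have g7 : ρ 7 = bA := by rw [hr 7 (by norm_num), h7]
    have g8 : ρ 8 = bB := by rw [hr 8 (by norm_num), h8]
    have g12 : ρ 12 = p := by rw [hr 12 (by norm_num), h12]
    have hl := hlenk k hk.le
    have hv := hx xs[k] (List.getElem_mem hk)
    have hd0 : 0 ≤ xs[k] / (p : ℤ) := Int.ediv_nonneg hv.1 (by positivity)
    have hd1 : xs[k] / (p : ℤ) ≤ xs[k] := Int.ediv_le_self _ hv.1
    have hload : μ ((bA : ℤ) + k).toNat = xs[k] := by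
      rw [← hrest k hk le_rfl]; congr 1
    have hbit : xs[k] / (p : ℤ) - xs[k] / (p : ℤ) / 2 * 2 = xs[k] / (p : ℤ) % 2 := by omega
    refine Exec.block (by simp) ?_
    simp only [OpsPre, Function.update_apply, Nat.reduceEqDiff, if_true, if_false, g1, g7, g8, g12, h13, h15,
      h16, hload, hbit]
    have htake : xs.take (k + 1) = xs.take k ++ [xs[k]] := by simp
    have hz : ((bA : ℤ) + ((xs.take k).filter f0).length).toNat = bA + ((xs.take k).filter f0).length := by
      omega
    have ho : ((bB : ℤ) + ((xs.take k).filter f1).length).toNat = bB + ((xs.take k).filter f1).length := by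
      omega
    rw [hz, ho]
    set z := ((xs.take k).filter f0).length with hzdef
    set o := ((xs.take k).filter f1).length with hodef
    simp only [abs_le]
    refine ⟨by omega, by omega, by omega, by omega, by omega, by omega, by omega, by omega, by omega,
      by omega, by omega, ?_⟩
    refine ⟨trivial, by simpa using hn, fun r hr' => ?_, fun a ha => ?_, ?_, ?_, ?_, ?_, ?_⟩
    · have : r ≠ 15 ∧ r ≠ 16 ∧ r ≠ 17 ∧ r ≠ 18 ∧ r ≠ 19 ∧ r ≠ 20 := by omega
      simp [this, hr r hr']
    · rw [if_neg (by omega), if_neg (by omega), hm a ha]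
    all_goals rcases hb : f0 xs[k] with _ | _
    all_goals
      have hb' := hf xs[k]
      rw [hb] at hb'
      have h1b : f1 xs[k] = !f0 xs[k] := rfl
      rw [hb] at h1b
    · have : xs[k] / (p : ℤ) % 2 = 1 := by simp at hb'; omega
      simp only [htake, List.filter_append, List.filter_cons, List.filter_nil, hb, this]
      simp [← hzdef]
    · have : xs[k] / (p : ℤ) % 2 = 0 := by simpa using hb'
      simp only [htake, List.filter_append, List.filter_cons, List.filter_nil, hb, this]
      simp [← hzdef]
    · have : xs[k] / (p : ℤ) % 2 = 1 := by simp at hb'; omega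
      simp only [htake, List.filter_append, List.filter_cons, List.filter_nil, h1b, this]
      simp [← hodef]
    · have : xs[k] / (p : ℤ) % 2 = 0 := by simpa using hb'
      simp only [htake, List.filter_append, List.filter_cons, List.filter_nil, h1b, this]
      simp [← hodef]
    · simp only [htake, List.filter_append, List.filter_cons, List.filter_nil, hb]
      simpa using (hH0.update (by omega)).update (by omega)
    · simp only [htake, List.filter_append, List.filter_cons, List.filter_nil, hb]
      exact (hH0.concat rfl).update (by simp; omega)
    · simp only [htake, List.filter_append, List.filter_cons, List.filter_nil, h1b]
      exact (hH1.update (by omega)).concat rfl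
    · simp only [htake, List.filter_append, List.filter_cons, List.filter_nil, h1b]
      simpa using (hH1.update (by omega)).update (by omega)
    all_goals
      intro j hj hkj
      rw [if_neg (by omega), if_neg (by omega), hrest j hj (by omega)]
  · rintro ρ μ ⟨hr, hm, h15, h16, hH0, hH1, -⟩ hn
    rw [List.take_length] at *
    have hl := hlen xs
    set z := (xs.filter f0).length with hzdef
    set o := (xs.filter f1).length with hodef
    refine (Exec.forLoop (T := 5) (i := 13) (n := 16) (t := 14) o (fun k ρ μ =>
      (∀ r ≤ 12, ρ r = ρ₀ r) ∧ (∀ a < bA, μ a = μ₀ a) ∧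
      ρ 15 = ((z + k : ℕ) : ℤ) ∧ Holds μ bB (xs.filter f1) ∧
      Holds μ bA (xs.filter f0 ++ (xs.filter f1).take k)) (by decide) (by decide) (by decide) (by omega)
      h16 ?_ ?_ ?_ ?_).mono (by gcongr; omega) fun _ _ h => h
    · rintro k ρ μ x y ⟨hr, h⟩
      refine ⟨fun r hr' => ?_, ?_⟩
      · rw [Function.update_of_ne (by omega), Function.update_of_ne (by omega), hr r hr']
      · simpa using h
    · exact ⟨hr, hm, by simpa using h15, hH1, by simpa using hH0⟩
    · rintro k hk ρ μ ⟨hr, hm, h15, hH1, hH⟩ h13 hn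
      have g1 : ρ 1 = 1 := by rw [hr 1 (by norm_num), h1]
      have g7 : ρ 7 = bA := by rw [hr 7 (by norm_num), h7]
      have g8 : ρ 8 = bB := by rw [hr 8 (by norm_num), h8]
      have hload : μ ((bB : ℤ) + k).toNat = (xs.filter f1)[k] := by
        rw [← hH1 k hk]; congr 1
      refine Exec.block (by simp) ?_
      simp only [OpsPre, Function.update_apply, Nat.reduceEqDiff, if_true, if_false, g1, g7, g8, h13, h15,
        hload]
      have hz : ((bA : ℤ) + ((z + k : ℕ) : ℤ)).toNat = bA + (z + k) := by omega
      rw [hz]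
      simp only [abs_le]
      refine ⟨by omega, by omega, by omega, trivial, by simpa using hn, fun r hr' => ?_, fun a ha => ?_,
        by push_cast; ring, hH1.update (by omega), ?_⟩
      · have : r ≠ 15 ∧ r ≠ 17 ∧ r ≠ 19 := by omega
        simp [this, hr r hr']
      · rw [if_neg (by omega), hm a ha]
      · have htake : (xs.filter f1).take (k + 1) = (xs.filter f1).take k ++ [(xs.filter f1)[k]] := by simp
        rw [htake, ← List.append_assoc]
        exact hH.concat (by simp [← hzdef, ← hodef]; omega)
    · rintro ρ μ ⟨hr, hm, -, -, hH⟩ -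
      rw [hodef, List.take_length] at hH
      exact ⟨hr, hm, hH⟩

theorem partitionBy_perm (p : ℤ) (l : List ℤ) : (partitionBy p l).Perm l :=
  List.filter_append_perm _ _

theorem emod_mul_two (v : ℤ) {p : ℤ} (hp : 0 < p) : v % (p * 2) = v % p + p * (v / p % 2) := by
  have h1 := Int.emod_add_mul_ediv v p
  have h2 := Int.emod_add_mul_ediv (v / p) 2
  have h3 := Int.emod_nonneg v hp.ne'
  have h4 := Int.emod_lt_of_pos v hp
  have h5 : v / p % 2 = 0 ∨ v / p % 2 = 1 := by omega
  refine ((Int.ediv_emod_unique (q := v / p / 2) (by positivity : 0 < p * 2)).2 ⟨?_, ?_, ?_⟩).2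
  · conv_rhs => rw [← h1]
    conv_rhs => rw [← h2]
    rcases h5 with h | h <;> rw [h] <;> ring
  · rcases h5 with h | h <;> rw [h] <;> omega
  · rcases h5 with h | h <;> rw [h] <;> omega

/-- One round of radix sort: a list that is sorted by the remainders modulo `p` becomes sorted by the
remainders modulo `2 p`, because the partition is stable. -/
theorem pairwise_partitionBy {p : ℤ} (hp : 0 < p) {l : List ℤ}
    (h : l.Pairwise fun u v => u % p ≤ v % p) :
    (partitionBy p l).Pairwise fun u v => u % (p * 2) ≤ v % (p * 2) := by
  rw [partitionBy, List.pairwise_append]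
  simp only [emod_mul_two _ hp]
  refine ⟨?_, ?_, fun u hu v hv => ?_⟩
  · refine (h.filter _).imp_of_mem fun {u v} hu hv huv => ?_
    have hu := (List.mem_filter.1 hu).2
    have hv := (List.mem_filter.1 hv).2
    simp only [decide_eq_true_eq] at hu hv
    rw [hu, hv]; omega
  · refine (h.filter _).imp_of_mem fun {u v} hu hv huv => ?_
    have hu := (List.mem_filter.1 hu).2
    have hv := (List.mem_filter.1 hv).2
    simp only [Bool.not_eq_true', decide_eq_false_iff_not] at hu hv
    rw [show u / p % 2 = 1 by omega, show v / p % 2 = 1 by omega]; omega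
  · have hu := (List.mem_filter.1 hu).2
    have hv := (List.mem_filter.1 hv).2
    simp only [Bool.not_eq_true', decide_eq_false_iff_not, decide_eq_true_eq] at hu hv
    rw [hu, show v / p % 2 = 1 by omega]
    have := Int.emod_lt_of_pos u hp
    have := Int.emod_nonneg v hp.ne'
    omega

/-- Radix sort of the array at the address in register 7, of the length in register 10, whose entries are
non-negative and less than register 11. Register 8 has the address of a buffer. -/
def radixSort : Fragment :=
  ops [.const 12 1] ;; doWhile (partitionPass ;; ops [.add 12 12 12, .sub 14 11 12]) 14

/-- Radix sort takes one pass for each binary digit: `J` passes for keys below `2 ^ J`. -/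
theorem exec_radixSort {W bA bB K J : ℕ} {xs : List ℤ} {ρ₀ μ₀ : ℕ → ℤ}
    (h1 : ρ₀ 1 = 1) (h7 : ρ₀ 7 = bA) (h8 : ρ₀ 8 = bB) (h10 : ρ₀ 10 = xs.length) (h11 : ρ₀ 11 = K)
    (hA : Holds μ₀ bA xs) (hAB : bA + xs.length ≤ bB) (hx : ∀ v ∈ xs, 0 ≤ v ∧ v < K)
    (hK : 2 * K + 2 ≤ W) (hW : bB + xs.length + 2 ≤ W) (hJ : K ≤ 2 ^ J) (hJ0 : 0 < J) :
    Exec W (J * (xs.length * 27 + 13) + 1) radixSort (fun ρ μ => (∀ r ≤ 11, ρ r = ρ₀ r) ∧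
      (∀ a < bA, μ a = μ₀ a) ∧ ∃ ys : List ℤ, ys.Perm xs ∧ ys.Pairwise (· ≤ ·) ∧ Holds μ bA ys)
      ρ₀ μ₀ := by
  refine (Exec.ops_seq (T := J * (xs.length * 27 + 12 + 1)) ?_).mono
    (by simp only [List.length_cons, List.length_nil]; ring_nf; omega) fun _ _ h => h
  simp only [OpsPre]
  refine ⟨by simp; omega, Exec.doWhile (T := xs.length * 27 + 12) (fun m ρ μ => m ≤ J ∧ (∀ r ≤ 11, ρ r = ρ₀ r) ∧
    (∀ a < bA, μ a = μ₀ a) ∧ ρ 12 = ((2 ^ (J - m) : ℕ) : ℤ) ∧ (2 ^ (J - m) ≤ K ∨ 2 ^ (J - m) = 1) ∧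
    ∃ ys : List ℤ, ys.Perm xs ∧ (ys.Pairwise fun u v => u % ((2 ^ (J - m) : ℕ) : ℤ) ≤
      v % ((2 ^ (J - m) : ℕ) : ℤ)) ∧ Holds μ bA ys) ?_ J ?_ hJ0⟩
  · rintro m ρ μ ⟨hm, hr, hμ, h12, hp, ys, hperm, hsort, hH⟩
    set p := 2 ^ (J - (m + 1)) with hpdef
    have hp0 : 0 < p := by positivity
    have hpm : 2 ^ (J - m) = p * 2 := by rw [← pow_succ]; congr 1; omega
    have g1 : ρ 1 = 1 := by rw [hr 1 (by norm_num), h1]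
    have g7 : ρ 7 = bA := by rw [hr 7 (by norm_num), h7]
    have g8 : ρ 8 = bB := by rw [hr 8 (by norm_num), h8]
    have g10 : ρ 10 = ys.length := by rw [hr 10 (by norm_num), h10, hperm.length_eq]
    refine (Exec.seq (T₁ := xs.length * 27 + 10) (T₂ := 2) ?_)
    refine (exec_partitionPass (K := K) g1 g7 g8 g10 h12 hp0 hH (by rw [hperm.length_eq]; exact hAB)
      (fun v hv => hx v (hperm.mem_iff.1 hv)) (by omega) (by rw [hperm.length_eq]; exact hW)).mono
      (by rw [hperm.length_eq]) ?_
    rintro ρ' μ' ⟨hr', hμ', hH'⟩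
    have k12 : ρ' 12 = p := by rw [hr' 12 (by norm_num), h12]
    have k11 : ρ' 11 = K := by rw [hr' 11 (by norm_num), hr 11 (by norm_num), h11]
    refine Exec.block (by simp) ?_
    simp only [OpsPre, Function.update_apply, Nat.reduceEqDiff, if_true, if_false, k12, k11, abs_le]
    have hperm' : (partitionBy p ys).Perm xs := (partitionBy_perm _ _).trans hperm
    have hsort' := pairwise_partitionBy (by exact_mod_cast hp0) hsort
    refine ⟨by omega, by omega, fun h => ⟨?_, by omega, fun r hr1 => ?_, fun a ha => ?_, ?_, ?_, ?_⟩,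
      fun h => ⟨fun r hr1 => ?_, fun a ha => ?_, ?_⟩⟩
    · by_contra h0
      obtain rfl : m = 0 := by omega
      simp only [Nat.sub_zero] at hpm
      rw [hpm] at hJ
      omega
    · have : r ≠ 12 ∧ r ≠ 14 := by omega
      simp [this, hr' r (by omega), hr r hr1]
    · rw [hμ' a ha, hμ a ha]
    · rw [hpm]; push_cast; ring
    · left; rw [hpm]; omega
    · refine ⟨_, hperm', ?_, hH'⟩
      rw [hpm]; exact_mod_cast hsort'
    · have : r ≠ 12 ∧ r ≠ 14 := by omega
      simp [this, hr' r (by omega), hr r hr1]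
    · rw [hμ' a ha, hμ a ha]
    · refine ⟨_, hperm', hsort'.imp_of_mem fun {u v} hu hv huv => ?_, hH'⟩
      have hu := hx u (hperm'.mem_iff.1 hu)
      have hv := hx v (hperm'.mem_iff.1 hv)
      rwa [Int.emod_eq_of_lt hu.1 (by omega), Int.emod_eq_of_lt hv.1 (by omega)] at huv
  · refine ⟨le_rfl, fun r hr => Function.update_of_ne (by omega) _ _, fun _ _ => rfl, by simp, by simp,
      xs, List.Perm.refl _, ?_, hA⟩
    simpa using List.pairwise_of_forall (l := xs) fun _ _ => trivial

/-! ### The memory layout of the input and the numbering of tuples -/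

/-- The blocks of a concatenation are found at the addresses given by `addr`. -/
theorem Holds.of_flatten_ofFn {μ : ℕ → ℤ} {n : ℕ} {g : Fin n → List ℤ} {addr : ℕ → ℕ}
    (haddr : ∀ k : Fin n, addr (k + 1) = addr k + (g k).length)
    (h : Holds μ (addr 0) (List.ofFn g).flatten) (k : Fin n) : Holds μ (addr k) (g k) := by
  induction n generalizing addr with
  | zero => exact k.elim0
  | succ n ih =>
    rw [List.ofFn_succ, List.flatten_cons, holds_append] at h
    refine Fin.cases h.1 (fun k => ?_) k
    have h0 := haddr 0
    simp only [Fin.val_zero, zero_add] at h0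
    have := ih (g := fun i => g i.succ) (addr := fun k => addr (k + 1)) (fun k => haddr k.succ)
      (by simpa [h0] using h.2) k
    simpa using this

theorem length_flatten_ofFn {n : ℕ} {g : Fin n → List ℤ} {addr : ℕ → ℕ}
    (haddr : ∀ k : Fin n, addr (k + 1) = addr k + (g k).length) :
    addr 0 + (List.ofFn g).flatten.length = addr n := by
  induction n generalizing addr with
  | zero => simp
  | succ n ih =>
    have h0 := haddr 0
    simp only [Fin.val_zero, zero_add] at h0
    have := ih (g := fun i => g i.succ) (addr := fun k => addr (k + 1)) fun k => haddr k.succ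
    rw [List.ofFn_succ, List.flatten_cons, List.length_append, ← add_assoc, ← h0]
    exact this

/-- Blocks of the same length `a` are found at the multiples of `a`. -/
theorem Holds.of_flatMap {α : Type} {μ : ℕ → ℤ} {a b : ℕ} {f : α → List ℤ} (hf : ∀ t, (f t).length = a)
    {ts : List α} (h : Holds μ b (ts.flatMap f)) (j : ℕ) (hj : j < ts.length) :
    Holds μ (b + j * a) (f ts[j]) := by
  induction ts generalizing b j with
  | nil => simp at hj
  | cons t ts ih =>
    rw [List.flatMap_cons, holds_append, hf] at h
    cases j with
    | zero => simpa using h.1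
    | succ j =>
      have := ih h.2 j (by simpa using hj)
      rw [List.getElem_cons_succ]
      convert this using 1
      ring

namespace JoinQuery

/-- The arity of the `k`-th relation symbol. -/
def arityAt (q : JoinQuery) (k : ℕ) : ℕ := if h : k < q.numSyms then q.arity ⟨k, h⟩ else 0

theorem arityAt_val {q : JoinQuery} (R : Fin q.numSyms) : q.arityAt R = q.arity R := by
  simp [arityAt]

end JoinQuery

namespace Database

variable {q : JoinQuery}

/-- The number of tuples of the `k`-th relation. -/
def lenAt (D : Database q) (k : ℕ) : ℕ := if h : k < q.numSyms then (D.rel ⟨k, h⟩).length else 0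

theorem lenAt_val (D : Database q) (R : Fin q.numSyms) : D.lenAt R = (D.rel R).length := by
  simp [lenAt]

/-- The address of the part of the input for the `k`-th relation. -/
def blockAddr (D : Database q) : ℕ → ℕ
  | 0 => 1 + D.domSize
  | k + 1 => D.blockAddr k + 1 + D.lenAt k * q.arityAt k

theorem blockAddr_pos (D : Database q) (k : ℕ) : 1 + D.domSize ≤ D.blockAddr k := by
  induction k with
  | zero => exact le_rfl
  | succ k ih => rw [blockAddr]; omega

theorem blockAddr_mono (D : Database q) : Monotone D.blockAddr :=
  monotone_nat_of_le_succ fun k => by rw [blockAddr]; omega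

/-- The memory contains the database and the weights in the input format. -/
structure Layout (D : Database q) (w : Fin D.domSize → ℤ) (μ : ℕ → ℤ) : Prop where
  dom : μ 0 = D.domSize
  weight : ∀ e : Fin D.domSize, μ (1 + e) = w e
  len : ∀ R : Fin q.numSyms, μ (D.blockAddr R) = (D.rel R).length
  tuple : ∀ (R : Fin q.numSyms) (j : ℕ) (hj : j < (D.rel R).length) (x : Fin (q.arity R)),
    μ (D.blockAddr R + 1 + j * q.arity R + x) = (((D.rel R)[j] x : ℕ) : ℤ)

theorem length_block (D : Database q) (R : Fin q.numSyms) :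
    (((D.rel R).length : ℤ) ::
      (D.rel R).flatMap fun t => List.ofFn fun j => ((t j : ℕ) : ℤ)).length =
    1 + (D.rel R).length * q.arity R := by
  simp [List.length_flatMap, add_comm]

theorem blockAddr_succ (D : Database q) (R : Fin q.numSyms) :
    D.blockAddr (R + 1) = D.blockAddr R + (((D.rel R).length : ℤ) ::
      (D.rel R).flatMap fun t => List.ofFn fun j => ((t j : ℕ) : ℤ)).length := by
  rw [length_block, blockAddr, lenAt_val, JoinQuery.arityAt_val, add_assoc]

theorem length_encode (D : Database q) (w : Fin D.domSize → ℤ) :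
    (D.encode w).length = D.blockAddr q.numSyms := by
  rw [← length_flatten_ofFn D.blockAddr_succ, encode, blockAddr]
  simp only [List.length_cons, List.length_append, List.length_ofFn]
  omega

theorem layout_of_holds {D : Database q} {w : Fin D.domSize → ℤ} {μ : ℕ → ℤ}
    (h : Holds μ 0 (D.encode w)) : D.Layout w μ := by
  rw [encode, holds_cons, holds_append] at h
  obtain ⟨h0, hw, hr⟩ := h
  have hb : ∀ R : Fin q.numSyms, _ :=
    Holds.of_flatten_ofFn D.blockAddr_succ (by simpa [blockAddr] using hr)
  refine ⟨h0, fun e => ?_, fun R => (holds_cons.1 (hb R)).1, fun R j hj x => ?_⟩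
  · have := hw e (by simp)
    simpa using this
  · have := (holds_cons.1 (hb R)).2.of_flatMap (a := q.arity R) (by simp) j hj x (by simp)
    simpa using this

theorem holds_inputConfig (l : List ℤ) : Holds (inputConfig l).mem 0 l := fun j hj => by
  simp [inputConfig, List.getD_eq_getElem?_getD, hj]

/-- The layout concerns only the cells in front of the end of the input. -/
theorem Layout.congr {D : Database q} {w : Fin D.domSize → ℤ} {μ μ' : ℕ → ℤ} (h : D.Layout w μ)
    (h' : ∀ a < D.blockAddr q.numSyms, μ' a = μ a) : D.Layout w μ' := by
  have hb := D.blockAddr_pos q.numSyms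
  have hs : ∀ R : Fin q.numSyms, D.blockAddr R + 1 + (D.rel R).length * q.arity R ≤
      D.blockAddr q.numSyms := fun R => by
    have := D.blockAddr_mono (show (R : ℕ) + 1 ≤ q.numSyms by omega)
    rw [blockAddr, lenAt_val, JoinQuery.arityAt_val] at this
    exact this
  refine ⟨?_, fun e => ?_, fun R => ?_, fun R j hj x => ?_⟩
  · rw [h' _ (by omega), h.dom]
  · rw [h' _ (by omega), h.weight]
  · rw [h' _ (by have := hs R; omega), h.len]
  · rw [h' _ ?_, h.tuple]
    have h1 := hs R
    have h2 : (j + 1) * q.arity R ≤ (D.rel R).length * q.arity R := Nat.mul_le_mul_right _ hj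
    have := x.2
    rw [add_mul] at h2
    omega

end Database

/-- The number with the digits `v 0, …, v (k - 1)` to base `n`, the first digit being the leading one. -/
def digitsCode (n : ℕ) (v : ℕ → ℕ) : ℕ → ℕ
  | 0 => 0
  | k + 1 => digitsCode n v k * n + v k

theorem digitsCode_lt {n : ℕ} {v : ℕ → ℕ} {k : ℕ} (h : ∀ j < k, v j < n) : digitsCode n v k < n ^ k := by
  induction k with
  | zero => simp [digitsCode]
  | succ k ih =>
    have h1 := ih fun j hj => h j (by omega)
    have h2 := h k (by omega)
    rw [digitsCode, pow_succ]
    have : (digitsCode n v k + 1) * n ≤ n ^ k * n := Nat.mul_le_mul_right _ h1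
    rw [add_mul] at this
    omega

theorem digitsCode_inj {n : ℕ} {v v' : ℕ → ℕ} {k : ℕ} (h : ∀ j < k, v j < n) (h' : ∀ j < k, v' j < n)
    (he : digitsCode n v k = digitsCode n v' k) : ∀ j < k, v j = v' j := by
  induction k with
  | zero => intro j hj; omega
  | succ k ih =>
    rw [digitsCode, digitsCode] at he
    have h1 := h k (by omega)
    have h2 := h' k (by omega)
    have e1 : v k = v' k := by
      have := congrArg (· % n) he
      simpa [Nat.add_mod, Nat.mod_eq_of_lt h1, Nat.mod_eq_of_lt h2] using this
    have e2 : digitsCode n v k = digitsCode n v' k :=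
      Nat.eq_of_mul_eq_mul_right (by omega : 0 < n) (by omega)
    intro j hj
    rcases Nat.lt_succ_iff_lt_or_eq.1 hj with hj | rfl
    · exact ih (fun j hj => h j (by omega)) (fun j hj => h' j (by omega)) e2 j hj
    · exact e1

/-- The entries of a tuple as natural numbers, continued by `0`. -/
def entry {a n : ℕ} (t : Fin a → Fin n) (k : ℕ) : ℕ := if h : k < a then t ⟨k, h⟩ else 0

theorem entry_val {a n : ℕ} (t : Fin a → Fin n) (j : Fin a) : entry t j = t j := by simp [entry]

theorem entry_lt {a n : ℕ} (t : Fin a → Fin n) {k : ℕ} (h : k < a) : entry t k < n := by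
  simp [entry, h]

/-- A number that identifies the tuple `t` of the relation `R`, among the tuples of all relations. -/
def tupleKey {q : JoinQuery} {n : ℕ} (R : Fin q.numSyms) (t : Fin (q.arity R) → Fin n) : ℕ :=
  digitsCode n (entry t) (q.arity R) * q.numSyms + R

theorem tupleKey_inj {q : JoinQuery} {n : ℕ} {R R' : Fin q.numSyms} {t : Fin (q.arity R) → Fin n}
    {t' : Fin (q.arity R') → Fin n} (h : tupleKey R t = tupleKey R' t') : R = R' ∧ HEq t t' := by
  rw [tupleKey, tupleKey] at h
  have h1 : (R : ℕ) = R' := by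
    have := congrArg (· % q.numSyms) h
    simpa [Nat.add_mod, Nat.mod_eq_of_lt R.2, Nat.mod_eq_of_lt R'.2] using this
  obtain rfl : R = R' := Fin.ext h1
  have h2 : digitsCode n (entry t) (q.arity R) = digitsCode n (entry t') (q.arity R) :=
    Nat.eq_of_mul_eq_mul_right R.pos (by omega)
  refine ⟨rfl, heq_of_eq (funext fun j => Fin.ext ?_)⟩
  have := digitsCode_inj (fun j hj => entry_lt t hj) (fun j hj => entry_lt t' hj) h2 j j.2
  rwa [entry_val, entry_val] at this

/-! ### Preprocessing: scanning the input -/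

section

variable {q : JoinQuery}

/-- A bound for the absolute values of the weights: the sum of their squares, which is computed without
case distinctions. -/
def weightBound {n : ℕ} (w : Fin n → ℤ) : ℕ := ∑ e, (w e).natAbs ^ 2

theorem abs_le_weightBound {n : ℕ} (w : Fin n → ℤ) (e : Fin n) : |w e| ≤ weightBound w := by
  have h : (w e).natAbs ^ 2 ≤ weightBound w :=
    Finset.single_le_sum (f := fun e => (w e).natAbs ^ 2) (fun _ _ => Nat.zero_le _) (Finset.mem_univ e)
  have h2 := Nat.le_self_pow (n := 2) (by norm_num) (w e).natAbs
  have : ((w e).natAbs : ℤ) ≤ weightBound w := by exact_mod_cast h2.trans h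
  rwa [Int.natCast_natAbs] at this

/-- Put `1` into register 1, the domain size into register 2, and a bound for the absolute values of the
weights of all answers into register 3. -/
def setup (q : JoinQuery) : Fragment :=
  ops [.load 2 0, .const 1 1, .const 3 0] ;;
  forLoop 13 2 14 (ops [.add 15 13 1, .load 15 15, .mul 15 15 15, .add 3 3 15]) ;;
  ops [.const 15 q.numVars, .mul 3 3 15]

theorem exec_setup {W : ℕ} {D : Database q} {w : Fin D.domSize → ℤ} {μ₀ : ℕ → ℤ}
    (hL : D.Layout w μ₀) (hn : D.domSize + 2 ≤ W) (hS : weightBound w ≤ W)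
    (hrS : q.numVars * weightBound w ≤ W) (hr : q.numVars ≤ W) :
    Exec W (D.domSize * 8 + 9) (setup q) (fun ρ μ => ρ 1 = 1 ∧ ρ 2 = D.domSize ∧
      ρ 3 = ((q.numVars * weightBound w : ℕ) : ℤ) ∧ μ = μ₀) (fun _ => 0) μ₀ := by
  have hsum : ∑ e ∈ Finset.range D.domSize, μ₀ (1 + e) ^ 2 = weightBound w := by
    rw [← Fin.sum_univ_eq_sum_range (fun e => μ₀ (1 + e) ^ 2), weightBound]
    push_cast
    exact Finset.sum_congr rfl fun e _ => by rw [hL.weight, sq_abs]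
  have hpart : ∀ k ≤ D.domSize, ∑ e ∈ Finset.range k, μ₀ (1 + e) ^ 2 ≤ W := fun k hk => by
    have h1 : ∑ e ∈ Finset.range k, μ₀ (1 + e) ^ 2 ≤ ∑ e ∈ Finset.range D.domSize, μ₀ (1 + e) ^ 2 :=
      Finset.sum_le_sum_of_subset_of_nonneg (Finset.range_mono hk) fun _ _ _ => sq_nonneg _
    rw [hsum] at h1
    exact h1.trans (by exact_mod_cast hS)
  have hpos : ∀ k, 0 ≤ ∑ e ∈ Finset.range k, μ₀ (1 + e) ^ 2 := fun k =>
    Finset.sum_nonneg fun _ _ => sq_nonneg _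
  refine (Exec.ops_seq (T := (4 + D.domSize * (4 + 4)) + 2) ?_).mono (by simp; omega) fun _ _ h => h
  simp only [OpsPre, Int.toNat_zero, hL.dom]
  refine ⟨by simp; omega, by simp, Exec.seq ?_⟩
  refine Exec.forLoop D.domSize (fun k ρ μ => ρ 1 = 1 ∧ ρ 2 = D.domSize ∧
    ρ 3 = ∑ e ∈ Finset.range k, μ₀ (1 + e) ^ 2 ∧ μ = μ₀) (by decide) (by decide) (by decide)
    (by omega) (by simp) ?_ ?_ ?_ ?_
  · rintro k ρ μ x y h
    simpa using h
  · simp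
  · rintro k hk ρ μ ⟨h1, h2, h3, rfl⟩ h13 -
    have hload : μ ((k : ℤ) + 1).toNat = μ (1 + k) := by congr 1; omega
    have hk1 := hpart (k + 1) hk
    rw [Finset.sum_range_succ] at hk1
    have h0 := hpos k
    have h0' := sq_nonneg (μ (1 + k))
    refine Exec.block (by simp) ?_
    simp only [OpsPre, Function.update_apply, Nat.reduceEqDiff, if_true, if_false, h1, h2, h3, h13, hload,
      abs_le]
    refine ⟨by omega, by constructor <;> nlinarith, by constructor <;> nlinarith, trivial, trivial,
      trivial, trivial, ?_, trivial⟩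
    rw [Finset.sum_range_succ, sq]
  · rintro ρ μ ⟨h1, h2, h3, rfl⟩ -
    rw [hsum] at h3
    refine Exec.block (by simp) ?_
    simp only [OpsPre, Function.update_apply, Nat.reduceEqDiff, if_true, if_false, h1, h2, h3, abs_le]
    have hrS' : (weightBound w : ℤ) * q.numVars ≤ W := by
      rw [mul_comm]; exact_mod_cast hrS
    refine ⟨by omega, ⟨?_, hrS'⟩, trivial, trivial, by push_cast; ring, trivial⟩
    have : (0 : ℤ) ≤ (weightBound w : ℤ) * q.numVars := by positivity
    omega

/-- Move the pointer in register 6 over the part of the input for the `k`-th relation. If `k = s`, put the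
number of tuples into register 4 and the address of the first one into register 5. -/
def scanStep (q : JoinQuery) (s k : ℕ) : Fragment :=
  ops ((if k = s then [.load 4 6, .add 5 6 1] else []) ++
    [.load 15 6, .const 16 (q.arityAt k), .mul 15 15 16, .add 6 6 15, .add 6 6 1])

/-- Locate the tuples of the `s`-th relation and the end of the input, and lay out the working memory
after it: a descriptor of three cells, two arrays with a cell for each tuple of that relation, and an
unbounded table. -/
def scan (q : JoinQuery) (s : ℕ) : Fragment :=
  ops [.add 6 2 1] ;; seqN (scanStep q s) q.numSyms ;;
  ops [.const 15 3, .add 7 6 15, .add 8 7 4, .add 9 8 4]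

/-- The registers that describe the memory layout, with respect to the relation `s`. -/
structure Pointers (D : Database q) (w : Fin D.domSize → ℤ) (s : Fin q.numSyms) (ρ : ℕ → ℤ) : Prop where
  one : ρ 1 = 1
  dom : ρ 2 = D.domSize
  off : ρ 3 = ((q.numVars * weightBound w : ℕ) : ℤ)
  num : ρ 4 = (D.rel s).length
  tup : ρ 5 = ((D.blockAddr s + 1 : ℕ) : ℤ)
  fin : ρ 6 = D.blockAddr q.numSyms
  arr : ρ 7 = ((D.blockAddr q.numSyms + 3 : ℕ) : ℤ)
  buf : ρ 8 = ((D.blockAddr q.numSyms + 3 + (D.rel s).length : ℕ) : ℤ)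
  tab : ρ 9 = ((D.blockAddr q.numSyms + 3 + 2 * (D.rel s).length : ℕ) : ℤ)

theorem Pointers.congr {D : Database q} {w : Fin D.domSize → ℤ} {s : Fin q.numSyms} {ρ ρ' : ℕ → ℤ}
    (h : Pointers D w s ρ) (h' : ∀ r ≤ 9, ρ' r = ρ r) : Pointers D w s ρ' :=
  ⟨by rw [h' _ (by norm_num), h.one], by rw [h' _ (by norm_num), h.dom],
    by rw [h' _ (by norm_num), h.off], by rw [h' _ (by norm_num), h.num],
    by rw [h' _ (by norm_num), h.tup], by rw [h' _ (by norm_num), h.fin],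
    by rw [h' _ (by norm_num), h.arr], by rw [h' _ (by norm_num), h.buf],
    by rw [h' _ (by norm_num), h.tab]⟩

theorem exec_scan {W : ℕ} {D : Database q} {w : Fin D.domSize → ℤ} {μ₀ : ℕ → ℤ} (s : Fin q.numSyms)
    (hL : D.Layout w μ₀) (hW : D.blockAddr q.numSyms + 3 + 2 * (D.rel s).length ≤ W)
    (ha : ∀ k, q.arityAt k ≤ W) {ρ₀ : ℕ → ℤ} (h1 : ρ₀ 1 = 1) (h2 : ρ₀ 2 = D.domSize)
    (h3 : ρ₀ 3 = ((q.numVars * weightBound w : ℕ) : ℤ)) :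
    Exec W (q.numSyms * 7 + 5) (scan q s) (fun ρ μ => Pointers D w s ρ ∧ μ = μ₀) ρ₀ μ₀ := by
  have hb := D.blockAddr_pos q.numSyms
  refine (Exec.ops_seq (T := q.numSyms * 7 + 4) ?_).mono (by simp; omega) fun _ _ h => h
  simp only [OpsPre, h1, h2, abs_le]
  refine ⟨by omega, Exec.seq ?_⟩
  refine (Exec.seqN (T := 7) (fun k ρ μ => ρ 1 = 1 ∧ ρ 2 = D.domSize ∧
    ρ 3 = ((q.numVars * weightBound w : ℕ) : ℤ) ∧ ρ 6 = D.blockAddr k ∧ (s < k →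
    ρ 4 = (D.rel s).length ∧ ρ 5 = ((D.blockAddr s + 1 : ℕ) : ℤ)) ∧ μ = μ₀) ?_ ?_).mono le_rfl ?_
  · rintro k hk ρ μ ⟨h1, h2, h3, h6, hs, rfl⟩
    have hload : μ (D.blockAddr k) = D.lenAt k := by
      rw [hL.len ⟨k, hk⟩, ← D.lenAt_val]
    have hbk := D.blockAddr_mono (show k + 1 ≤ q.numSyms by omega)
    have hdef : D.blockAddr (k + 1) = D.blockAddr k + 1 + D.lenAt k * q.arityAt k := rfl
    have hak := ha k
    have hmul : ((D.lenAt k * q.arityAt k : ℕ) : ℤ) = (D.lenAt k : ℤ) * q.arityAt k := by push_cast; rfl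
    by_cases hks : k = s
    · have hlen : (D.rel s).length = D.lenAt k := by rw [hks, D.lenAt_val]
      refine Exec.block (by simp [hks]) ?_
      rw [if_pos hks]
      simp only [List.cons_append, List.nil_append, OpsPre, Function.update_apply, Nat.reduceEqDiff, if_true,
        if_false, h1, h2, h3, h6, Int.toNat_natCast, hload, abs_le]
      rw [hdef, ← hmul]
      refine ⟨by omega, by omega, by omega, by omega, by omega, trivial, trivial, trivial, by push_cast; ring,
        fun _ => ⟨by rw [hlen], by rw [hks]; push_cast; ring⟩, trivial⟩
    · refine Exec.block (by simp [hks]) ?_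
      rw [if_neg hks]
      simp only [List.nil_append, OpsPre, Function.update_apply, Nat.reduceEqDiff, if_true,
        if_false, h1, h2, h3, h6, Int.toNat_natCast, hload, abs_le]
      rw [hdef, ← hmul]
      refine ⟨by omega, by omega, by omega, by omega, trivial, trivial, trivial, by push_cast; ring,
        fun h => hs (by omega), trivial⟩
  · simp [h1, h2, h3, Database.blockAddr, add_comm]
  · rintro ρ μ ⟨h1, h2, h3, h6, hs, rfl⟩
    obtain ⟨h4, h5⟩ := hs s.2
    refine Exec.block (by simp) ?_
    simp only [OpsPre, Function.update_apply, Nat.reduceEqDiff, if_true, if_false, h6, h4, abs_le]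
    refine ⟨by omega, by omega, by omega, by omega, ⟨?_, ?_, ?_, ?_, ?_, ?_, ?_, ?_, ?_⟩, trivial⟩ <;>
      simp [h1, h2, h3, h4, h5, h6]
    ring

/-! ### Preprocessing: the membership table -/

/-- Compute in register 15 the table address for the `k`-th relation and the tuple whose `j`-th entry is
at position `f j` of the tuple at the address in register 12. -/
def tableAddr (q : JoinQuery) (k : ℕ) (f : ℕ → ℕ) (a : ℕ) : Fragment :=
  ops [.const 15 0] ;;
  seqN (fun j => ops [.const 16 (f j), .add 16 16 12, .load 16 16, .mul 15 15 2, .add 15 15 16]) a ;;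
  ops [.const 16 q.numSyms, .mul 15 15 16, .const 16 k, .add 15 15 16, .add 15 15 9]

theorem exec_tableAddr {W k a n ta bT Y : ℕ} {f v : ℕ → ℕ} {ρ₀ μ₀ : ℕ → ℤ} (h2 : ρ₀ 2 = n)
    (h12 : ρ₀ 12 = ta) (h9 : ρ₀ 9 = bT) (hk : k < q.numSyms) (hv : ∀ j < a, μ₀ (ta + f j) = v j)
    (hvn : ∀ j < a, v j < n) (hf : ∀ j < a, ta + f j ≤ W) (hY : ∀ j ≤ a, n ^ j ≤ Y)
    (hW : bT + (Y + 1) * q.numSyms ≤ W) :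
    Exec W (a * 5 + 6) (tableAddr q k f a) (fun ρ μ => (∀ r, r ≠ 15 → r ≠ 16 → ρ r = ρ₀ r) ∧
      ρ 15 = ((bT + (digitsCode n v a * q.numSyms + k) : ℕ) : ℤ) ∧ μ = μ₀) ρ₀ μ₀ := by
  have hYW : Y + 1 ≤ (Y + 1) * q.numSyms := Nat.le_mul_of_pos_right _ (by omega)
  have hcode : ∀ j ≤ a, digitsCode n v j < Y := fun j hj =>
    (digitsCode_lt fun i hi => hvn i (by omega)).trans_le (hY j hj)
  refine (Exec.ops_seq (T := a * 5 + 5) ?_).mono (by simp; omega) fun _ _ h => h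
  simp only [OpsPre]
  refine ⟨by simp, Exec.seq ((Exec.seqN (T := 5) (fun j ρ μ => (∀ r, r ≠ 15 → r ≠ 16 → ρ r = ρ₀ r) ∧
    ρ 15 = digitsCode n v j ∧ μ = μ₀) ?_ ?_).mono le_rfl ?_)⟩
  · rintro j hj ρ μ ⟨hr, h15, rfl⟩
    have g2 : ρ 2 = n := by rw [hr 2 (by norm_num) (by norm_num), h2]
    have g12 : ρ 12 = ta := by rw [hr 12 (by norm_num) (by norm_num), h12]
    have hload : μ ((f j : ℤ) + ta).toNat = v j := by rw [← hv j hj]; congr 1; omega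
    have hc := hcode (j + 1) (by omega)
    have hdef : digitsCode n v (j + 1) = digitsCode n v j * n + v j := rfl
    have hmul : (digitsCode n v j : ℤ) * n = ((digitsCode n v j * n : ℕ) : ℤ) := by push_cast; rfl
    have := hf j hj
    refine Exec.block (by simp) ?_
    simp only [OpsPre, Function.update_apply, Nat.reduceEqDiff, if_true, if_false, g2, g12, h15, hload,
      abs_le, hmul]
    refine ⟨by omega, by omega, by omega, by omega, fun r hr1 hr2 => ?_, by rw [hdef]; push_cast; rfl,
      trivial⟩
    simp only [if_neg hr1, if_neg hr2, hr r hr1 hr2]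
  · exact ⟨fun r hr1 _ => Function.update_of_ne hr1 _ _, by simp [digitsCode], rfl⟩
  · rintro ρ μ ⟨hr, h15, rfl⟩
    have g9 : ρ 9 = bT := by rw [hr 9 (by norm_num) (by norm_num), h9]
    have hc := hcode a le_rfl
    have hmul : (digitsCode n v a : ℤ) * q.numSyms = ((digitsCode n v a * q.numSyms : ℕ) : ℤ) := by
      push_cast; rfl
    have hb : (digitsCode n v a + 1) * q.numSyms ≤ Y * q.numSyms := Nat.mul_le_mul_right _ hc
    rw [add_mul] at hb
    have : (Y + 1) * q.numSyms = Y * q.numSyms + 1 * q.numSyms := add_mul _ _ _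
    refine Exec.block (by simp) ?_
    simp only [OpsPre, Function.update_apply, Nat.reduceEqDiff, if_true, if_false, g9, h15, abs_le, hmul]
    refine ⟨by omega, by omega, by omega, by omega, by omega, fun r hr1 hr2 => ?_, by push_cast; ring,
      trivial⟩
    simp only [if_neg hr1, if_neg hr2, hr r hr1 hr2]

/-- Enter all tuples of the `k`-th relation, whose part of the input starts at the address in register 12,
into the table, and move register 12 to the next part. -/
def markRelation (q : JoinQuery) (k : ℕ) : Fragment :=
  ops [.load 11 12, .add 12 12 1] ;;
  forLoop 13 11 14 (tableAddr q k id (q.arityAt k) ;;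
    ops [.store 15 1, .const 16 (q.arityAt k), .add 12 12 16])

/-- Build the table, in which the cells that belong to the tuples of the database contain `1`. -/
def markAll (q : JoinQuery) : Fragment :=
  ops [.add 12 2 1] ;; seqN (markRelation q) q.numSyms

/-- The table at the address `b` decides membership of tuples in the relations. -/
def IsTable (D : Database q) (b : ℕ) (μ : ℕ → ℤ) : Prop :=
  ∀ (R : Fin q.numSyms) (t : Fin (q.arity R) → Fin D.domSize),
    μ (b + tupleKey R t) = if t ∈ D.rel R then 1 else 0

open Classical in
/-- The table is not cleared before it is filled: the cells behind the input contain `0` at the start, so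
its size, which is polynomial, does not enter the running time. -/
theorem exec_markAll {W Y m am : ℕ} {D : Database q} {w : Fin D.domSize → ℤ} {μ₀ ρ₀ : ℕ → ℤ}
    {s : Fin q.numSyms} (hP : Pointers D w s ρ₀) (hL : D.Layout w μ₀)
    (hzero : ∀ a ≥ D.blockAddr q.numSyms, μ₀ a = 0)
    (hY : ∀ R : Fin q.numSyms, ∀ j ≤ q.arity R, D.domSize ^ j ≤ Y)
    (ha : ∀ R, q.arity R ≤ am) (haW : am ≤ W) (hlen : ∀ R, (D.rel R).length ≤ m) (hm : m + 1 ≤ W)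
    (hW : D.blockAddr q.numSyms + 3 + 2 * (D.rel s).length + (Y + 1) * q.numSyms ≤ W) :
    Exec W (q.numSyms * (m * (am * 5 + 13) + 6) + 1) (markAll q)
      (fun ρ μ => Pointers D w s ρ ∧
        (∀ a < D.blockAddr q.numSyms + 3 + 2 * (D.rel s).length, μ a = μ₀ a) ∧
        IsTable D (D.blockAddr q.numSyms + 3 + 2 * (D.rel s).length) μ) ρ₀ μ₀ := by
  set bT := D.blockAddr q.numSyms + 3 + 2 * (D.rel s).length with hbT
  have hb := D.blockAddr_pos q.numSyms
  -- `M k` are the cells to be marked for the first `k` relations, and `mk M` is the memory in which the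
  -- cells of `M` are marked
  set M : ℕ → Set ℕ := fun k => {a | ∃ R : Fin q.numSyms, (R : ℕ) < k ∧ ∃ t ∈ D.rel R, a = bT + tupleKey R t}
    with hM
  set mk : Set ℕ → ℕ → ℤ := fun M a => if a ∈ M then 1 else μ₀ a with hmk
  have hmk1 : ∀ {M : Set ℕ} {a : ℕ}, a ∈ M → mk M a = 1 := fun h => if_pos h
  have hmk0 : ∀ {M : Set ℕ} {a : ℕ}, a ∉ M → mk M a = μ₀ a := fun h => if_neg h
  clear_value mk
  refine (Exec.ops_seq (T := q.numSyms * (m * (am * 5 + 13) + 6)) ?_).mono (by simp; omega)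
    fun _ _ h => h
  simp only [OpsPre, hP.one, hP.dom, abs_le]
  refine ⟨by omega, (Exec.seqN (fun k ρ μ => Pointers D w s ρ ∧ ρ 12 = D.blockAddr k ∧
    ∀ a, μ a = mk (M k) a) ?_ ?_).mono le_rfl ?_⟩
  · rintro k hk ρ μ ⟨hP, h12, hμ⟩
    obtain ⟨R, rfl⟩ : ∃ R : Fin q.numSyms, (R : ℕ) = k := ⟨⟨k, hk⟩, rfl⟩
    have hsucc := D.blockAddr_mono (show (R : ℕ) + 1 ≤ q.numSyms by omega)
    rw [Database.blockAddr, D.lenAt_val, JoinQuery.arityAt_val] at hsucc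
    have hlow : ∀ μ' : ℕ → ℤ, ∀ M' : Set ℕ, (∀ a ∈ M', bT ≤ a) →
        (∀ a, μ' a = mk M' a) → D.Layout w μ' := fun μ' M' hM' hμ' =>
      hL.congr fun a ha => by
        rw [hμ', hmk0]
        intro h
        have := hM' a h
        omega
    have hload : μ (D.blockAddr R) = (D.rel R).length :=
      (hlow μ (M R) (fun a ⟨_, _, _, _, h⟩ => by omega) hμ).len R
    refine (Exec.ops_seq (T := 4 + (D.rel R).length * ((q.arity R * 5 + 6 + 3) + 4)) ?_).mono ?_
      fun _ _ h => h
    swap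
    · have : (D.rel R).length * (q.arity R * 5 + 6 + 3 + 4) ≤ m * (am * 5 + 13) :=
        Nat.mul_le_mul (hlen R) (by have := ha R; omega)
      simp; omega
    have hlR := hlen R
    simp only [OpsPre, Function.update_apply, Nat.reduceEqDiff, if_false, hP.one, h12,
      Int.toNat_natCast, hload, abs_le]
    refine ⟨by omega, ?_⟩
    -- the cells that are marked after the first `i` tuples of the relation `R`
    set MR : ℕ → Set ℕ := fun i => M R ∪ {a | ∃ t ∈ (D.rel R).take i, a = bT + tupleKey R t} with hMR
    have hMRb : ∀ i, ∀ a ∈ MR i, bT ≤ a := fun i a h => by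
      rcases h with ⟨_, _, _, _, h⟩ | ⟨_, _, h⟩ <;> omega
    refine Exec.forLoop (D.rel R).length (fun i ρ μ => Pointers D w s ρ ∧
      ρ 12 = ((D.blockAddr R + 1 + i * q.arity R : ℕ) : ℤ) ∧
      ∀ a, μ a = mk (MR i) a) (by decide) (by decide) (by decide)
      (by omega) (by simp) ?_ ?_ ?_ ?_
    · rintro k ρ μ x y ⟨hP, h12, hμ⟩
      refine ⟨hP.congr fun r hr => ?_, by simpa using h12, hμ⟩
      rw [Function.update_of_ne (by omega), Function.update_of_ne (by omega)]
    · refine ⟨hP.congr fun r hr => ?_, by simp, fun a => ?_⟩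
      · rw [Function.update_of_ne (by omega), Function.update_of_ne (by omega)]
      · simp [hμ, hMR]
    · rintro i hi ρ μ ⟨hP, h12, hμ⟩ h13 h11
      have hLay := hlow μ (MR i) (hMRb i) hμ
      have hmul : (i + 1) * q.arity R ≤ (D.rel R).length * q.arity R := Nat.mul_le_mul_right _ hi
      have hmul' : (i + 1) * q.arity R = i * q.arity R + q.arity R := by ring
      refine Exec.seq (T₁ := q.arity R * 5 + 6) (T₂ := 3) ((exec_tableAddr (v := entry (D.rel R)[i])
        (Y := Y) hP.dom h12 hP.tab R.2 ?_ ?_ ?_ ?_ hW).mono (by rw [JoinQuery.arityAt_val]) ?_)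
      · rw [JoinQuery.arityAt_val]
        intro j hj
        have := hLay.tuple R i hi ⟨j, hj⟩
        rw [entry, dif_pos hj]
        exact this
      · rw [JoinQuery.arityAt_val]
        exact fun j hj => entry_lt _ hj
      · rw [JoinQuery.arityAt_val]
        intro j hj
        simp only [id]
        omega
      · rw [JoinQuery.arityAt_val]
        exact hY R
      · rintro ρ' μ' ⟨hr, h15, rfl⟩
        rw [JoinQuery.arityAt_val] at h15 ⊢
        have haR := ha R
        have hP' : Pointers D w s ρ' := hP.congr fun r hr' => hr r (by omega) (by omega)
        have k12 := hr 12 (by norm_num) (by norm_num)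
        refine Exec.block (by simp) ?_
        simp only [OpsPre, Function.update_apply, Nat.reduceEqDiff, if_true, if_false, hP'.one, h15, k12, h12,
          Int.toNat_natCast, abs_le, hr 13 (by norm_num) (by norm_num), h13,
          hr 11 (by norm_num) (by norm_num), h11]
        refine ⟨by omega, by omega, trivial, trivial, hP'.congr fun r hr' => ?_, ?_, fun a => ?_⟩
        · rw [Function.update_of_ne (by omega), Function.update_of_ne (by omega)]
        · rw [hmul']; push_cast; ring
        · have htake : (D.rel R).take (i + 1) = (D.rel R).take i ++ [(D.rel R)[i]] := by simp
          have hmem : a ∈ MR (i + 1) ↔ a ∈ MR i ∨ a = bT + tupleKey R (D.rel R)[i] := by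
            simp only [hMR, htake, Set.mem_union, Set.mem_ofPred_eq, List.mem_append, List.mem_singleton,
              or_assoc, or_and_right, exists_or, exists_eq_left]
          change (if a = bT + tupleKey R (D.rel R)[i] then 1 else μ' a) = _
          rw [hμ]
          by_cases h1 : a = bT + tupleKey R (D.rel R)[i]
          · rw [if_pos h1, hmk1 (hmem.2 (.inr h1))]
          · rw [if_neg h1]
            by_cases h2 : a ∈ MR i
            · rw [hmk1 h2, hmk1 (hmem.2 (.inl h2))]
            · rw [hmk0 h2, hmk0 (fun h => (hmem.1 h).elim h2 h1)]
    · rintro ρ μ ⟨hP, h12, hμ⟩ -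
      refine ⟨hP, ?_, fun a => ?_⟩
      · rw [h12, Database.blockAddr, D.lenAt_val, JoinQuery.arityAt_val]
      · have hmem : MR (D.rel R).length = M (R + 1) := by
          ext a
          simp only [hMR, hM, List.take_length, Set.mem_union, Set.mem_ofPred_eq]
          constructor
          · rintro (⟨R', h, h'⟩ | h)
            · exact ⟨R', by omega, h'⟩
            · exact ⟨R, by omega, h⟩
          · rintro ⟨R', h, h'⟩
            rcases Nat.lt_succ_iff_lt_or_eq.1 h with h | h
            · exact .inl ⟨R', h, h'⟩
            · obtain rfl := Fin.ext h
              exact .inr h'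
        rw [hμ, hmem]
  · refine ⟨hP.congr fun r hr => ?_, by simp [Database.blockAddr, add_comm], fun a => ?_⟩
    · rw [Function.update_of_ne (by omega)]
    · rw [hmk0 (by simp [hM])]
  · rintro ρ μ ⟨hP, -, hμ⟩
    refine ⟨hP, fun a ha => ?_, fun R t => ?_⟩
    · rw [hμ, hmk0]
      rintro ⟨_, _, _, _, h⟩
      omega
    · by_cases ht : t ∈ D.rel R
      · rw [hμ, hmk1 (show _ ∈ M q.numSyms from ⟨R, R.2, t, ht, rfl⟩), if_pos ht]
      · rw [hμ, hmk0, if_neg ht, hzero _ (by omega)]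
        rintro ⟨R', -, t', ht', h⟩
        obtain ⟨rfl, h⟩ := tupleKey_inj (Nat.add_left_cancel h)
        exact ht (by rwa [eq_of_heq h])

/-! ### Preprocessing: collecting the answers -/

/-- The symbol of the `k`-th atom. -/
def JoinQuery.symAt (q : JoinQuery) (k : ℕ) : ℕ := if h : k < q.numAtoms then q.sym ⟨k, h⟩ else 0

/-- For a relation `s` whose tuples have the value of the variable `x` at position `pos x`: the position of
the value of the `j`-th variable of the `k`-th atom. -/
def atomPos {s : Fin q.numSyms} (pos : Fin q.numVars → Fin (q.arity s)) (k j : ℕ) : ℕ :=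
  if h : k < q.numAtoms then
    if h' : j < q.arity (q.sym ⟨k, h⟩) then pos (q.args ⟨k, h⟩ ⟨j, h'⟩) else 0
  else 0

/-- The position of the value of the `k`-th variable. -/
def posAt {s : Fin q.numSyms} (pos : Fin q.numVars → Fin (q.arity s)) (k : ℕ) : ℕ :=
  if h : k < q.numVars then pos ⟨k, h⟩ else 0

/-- Multiply register 17 by the table entry for the `k`-th atom and the tuple at the address in
register 12. -/
def checkAtom {s : Fin q.numSyms} (pos : Fin q.numVars → Fin (q.arity s)) (k : ℕ) : Fragment :=
  tableAddr q (q.symAt k) (atomPos pos k) (q.arityAt (q.symAt k)) ;; ops [.load 16 15, .mul 17 17 16]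

/-- Add the weight of the `k`-th variable in the tuple at the address in register 12 to register 18. -/
def addWeight {s : Fin q.numSyms} (pos : Fin q.numVars → Fin (q.arity s)) (k : ℕ) : Fragment :=
  ops [.const 16 (posAt pos k), .add 16 16 12, .load 16 16, .add 16 16 1, .load 16 16, .add 18 18 16]

/-- For each tuple of the relation `s`, append its sort key to the array. The length of the array, in
register 10, is incremented only if the tuple is an answer, so that other keys are overwritten. The sort
key is the weight, made non-negative, followed by the index of the tuple as its last digit. -/
def collect {s : Fin q.numSyms} (pos : Fin q.numVars → Fin (q.arity s)) : Fragment :=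
  ops [.const 10 0, .const 16 0, .add 12 5 16] ;;
  forLoop 13 4 14 (ops [.const 17 1] ;; seqN (checkAtom pos) q.numAtoms ;; ops [.const 18 0] ;;
    seqN (addWeight pos) q.numVars ;;
    ops [.add 18 18 3, .mul 18 18 4, .add 18 18 13, .add 16 7 10, .store 16 18, .add 10 10 17,
      .const 16 (q.arityAt s), .add 12 12 16])

open Classical in
/-- An assignment is an answer if the table has an entry for each atom, so the product of the entries is
the indicator of the answers. -/
theorem exec_checkAtoms {W Y am : ℕ} {D : Database q} {w : Fin D.domSize → ℤ}
    {s : Fin q.numSyms} {pos : Fin q.numVars → Fin (q.arity s)} {μ₀ ρ₀ : ℕ → ℤ} {ta : ℕ}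
    {t : Fin (q.arity s) → Fin D.domSize}
    (hP : Pointers D w s ρ₀)
    (hY : ∀ R : Fin q.numSyms, ∀ j ≤ q.arity R, D.domSize ^ j ≤ Y)
    (ha : ∀ R, q.arity R ≤ am)
    (hW : D.blockAddr q.numSyms + 3 + 2 * (D.rel s).length + (Y + 1) * q.numSyms ≤ W)
    (hT : IsTable D (D.blockAddr q.numSyms + 3 + 2 * (D.rel s).length) μ₀)
    (h12 : ρ₀ 12 = ta) (ht : ∀ x : Fin (q.arity s), μ₀ (ta + x) = ((t x : ℕ) : ℤ)) (hta : ta + q.arity s ≤ W)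
    (h17 : ρ₀ 17 = 1) :
    Exec W (q.numAtoms * (am * 5 + 8)) (seqN (checkAtom pos) q.numAtoms) (fun ρ μ =>
      (∀ r, r ≠ 15 → r ≠ 16 → r ≠ 17 → ρ r = ρ₀ r) ∧
      ρ 17 = (if (fun x => t (pos x)) ∈ D.answers then 1 else 0) ∧ μ = μ₀) ρ₀ μ₀ := by
  have hiff : (fun x => t (pos x)) ∈ D.answers ↔ ∀ i : Fin q.numAtoms, (i : ℕ) < q.numAtoms →
      (fun j => t (pos (q.args i j))) ∈ D.rel (q.sym i) :=
    ⟨fun h i _ => h i, fun h i => h i i.2⟩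
  simp only [hiff]
  refine (Exec.seqN (T := am * 5 + 8) (fun k ρ μ => (∀ r, r ≠ 15 → r ≠ 16 → r ≠ 17 → ρ r = ρ₀ r) ∧
    ρ 17 = (if ∀ i : Fin q.numAtoms, (i : ℕ) < k →
      (fun j => t (pos (q.args i j))) ∈ D.rel (q.sym i) then 1 else 0) ∧ μ = μ₀) ?_ ?_)
  · rintro k hk ρ μ ⟨hr, h17, rfl⟩
    obtain ⟨i, rfl⟩ : ∃ i : Fin q.numAtoms, (i : ℕ) = k := ⟨⟨k, hk⟩, rfl⟩
    have hs : q.symAt i = q.sym i := by simp [JoinQuery.symAt]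
    have hai := ha (q.sym i)
    have hP' : Pointers D w s ρ := hP.congr fun r h => hr r (by omega) (by omega) (by omega)
    have g12 : ρ 12 = ta := by rw [hr 12 (by norm_num) (by norm_num) (by norm_num), h12]
    rw [checkAtom, hs, JoinQuery.arityAt_val]
    have hap : ∀ j : Fin (q.arity (q.sym i)), atomPos pos i j = pos (q.args i j) := fun j => by
      simp [atomPos]
    refine (Exec.seq (T₁ := q.arity (q.sym i) * 5 + 6) (T₂ := 2) ((exec_tableAddr
      (v := entry fun j => t (pos (q.args i j))) (Y := Y) hP'.dom g12 hP'.tab (q.sym i).2 ?_ ?_ ?_ (hY _)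
      hW).mono le_rfl ?_)).mono (by omega) fun _ _ h => h
    · intro j hj
      have := ht (pos (q.args i ⟨j, hj⟩))
      rw [← hap, ← entry_val (fun j => t (pos (q.args i j)))] at this
      exact this
    · exact fun j hj => entry_lt _ hj
    · intro j hj
      rw [hap ⟨j, hj⟩]
      omega
    · rintro ρ' μ' ⟨hr', h15, rfl⟩
      have hload := hT (q.sym i) fun j => t (pos (q.args i j))
      rw [tupleKey] at hload
      have hiff' : (∀ i' : Fin q.numAtoms, (i' : ℕ) < i + 1 →
          (fun j => t (pos (q.args i' j))) ∈ D.rel (q.sym i')) ↔ (∀ i' : Fin q.numAtoms, (i' : ℕ) < i →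
          (fun j => t (pos (q.args i' j))) ∈ D.rel (q.sym i')) ∧
          (fun j => t (pos (q.args i j))) ∈ D.rel (q.sym i) := by
        constructor
        · exact fun h => ⟨fun i' hi' => h i' (by omega), h i (by omega)⟩
        · rintro ⟨h1, h2⟩ i' hi'
          rcases Nat.lt_succ_iff_lt_or_eq.1 hi' with h | h
          · exact h1 i' h
          · obtain rfl := Fin.ext h
            exact h2
      have hval : ρ' 17 * μ' ((ρ' 15).toNat) = if ∀ i' : Fin q.numAtoms, (i' : ℕ) < i + 1 →
          (fun j => t (pos (q.args i' j))) ∈ D.rel (q.sym i') then 1 else 0 := by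
        rw [h15, Int.toNat_natCast, hload, hr' 17 (by norm_num) (by norm_num), h17]
        simp only [hiff']
        split_ifs <;> simp_all
      refine Exec.block (by simp) ?_
      simp only [OpsPre, Function.update_apply, Nat.reduceEqDiff, if_true, if_false]
      rw [hval]
      refine ⟨?_, fun r h1 h2 h3 => ?_, rfl, trivial⟩
      · have : 1 ≤ W := by
          have := Nat.le_mul_of_pos_right (Y + 1) (q.sym i).pos
          omega
        split_ifs <;> simp [this]
      · simp only [if_neg h2, if_neg h3, hr' r h1 h2, hr r h1 h2 h3]
  · simp [h17]

theorem exec_addWeights {W : ℕ} {D : Database q} {w : Fin D.domSize → ℤ}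
    {s : Fin q.numSyms} {pos : Fin q.numVars → Fin (q.arity s)} {μ₀ ρ₀ : ℕ → ℤ} {ta : ℕ}
    {t : Fin (q.arity s) → Fin D.domSize} (h1 : ρ₀ 1 = 1) (hL : D.Layout w μ₀)
    (hn : D.domSize + 1 ≤ W) (hr : q.numVars * weightBound w ≤ W)
    (h12 : ρ₀ 12 = ta) (ht : ∀ x : Fin (q.arity s), μ₀ (ta + x) = ((t x : ℕ) : ℤ)) (hta : ta + q.arity s ≤ W)
    (h18 : ρ₀ 18 = 0) :
    Exec W (q.numVars * 6) (seqN (addWeight pos) q.numVars) (fun ρ μ =>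
      (∀ r, r ≠ 16 → r ≠ 18 → ρ r = ρ₀ r) ∧ ρ 18 = D.weight w (fun x => t (pos x)) ∧ μ = μ₀) ρ₀ μ₀ := by
  set f : ℕ → ℤ := fun k => if h : k < q.numVars then w (t (pos ⟨k, h⟩)) else 0 with hf
  have hfv : ∀ x : Fin q.numVars, f x = w (t (pos x)) := fun x => by simp [hf]
  have hsum : D.weight w (fun x => t (pos x)) = ∑ k ∈ Finset.range q.numVars, f k := by
    rw [← Fin.sum_univ_eq_sum_range, Database.weight]
    exact Finset.sum_congr rfl fun x _ => (hfv x).symm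
  have hpart : ∀ k ≤ q.numVars, |∑ x ∈ Finset.range k, f x| ≤ W := fun k hk => by
    refine (Finset.abs_sum_le_sum_abs _ _).trans ?_
    have : ∑ x ∈ Finset.range k, |f x| ≤ ∑ x ∈ Finset.range k, (weightBound w : ℤ) := by
      refine Finset.sum_le_sum fun x hx => ?_
      have hx := Finset.mem_range.1 hx
      rw [hfv ⟨x, by omega⟩]
      exact abs_le_weightBound _ _
    refine this.trans ?_
    rw [Finset.sum_const, Finset.card_range, nsmul_eq_mul]
    exact_mod_cast (Nat.mul_le_mul_right _ hk).trans hr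
  rw [hsum]
  refine Exec.seqN (T := 6) (fun k ρ μ => (∀ r, r ≠ 16 → r ≠ 18 → ρ r = ρ₀ r) ∧
    ρ 18 = ∑ x ∈ Finset.range k, f x ∧ μ = μ₀) ?_ ?_
  · rintro k hk ρ μ ⟨hr, h18, rfl⟩
    have g1 : ρ 1 = 1 := by rw [hr 1 (by norm_num) (by norm_num), h1]
    have g12 : ρ 12 = ta := by rw [hr 12 (by norm_num) (by norm_num), h12]
    have hp : posAt pos k = pos ⟨k, hk⟩ := by simp [posAt, hk]
    have hl1 : μ ((posAt pos k : ℤ) + ta).toNat = ((t (pos ⟨k, hk⟩) : ℕ) : ℤ) := by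
      rw [← ht]; congr 1; rw [hp]; omega
    have hl2 : μ (((t (pos ⟨k, hk⟩) : ℕ) : ℤ) + 1).toNat = f k := by
      rw [hfv ⟨k, hk⟩, ← hL.weight]; congr 1; omega
    have h0 := (pos ⟨k, hk⟩).2
    have h0' := (t (pos ⟨k, hk⟩)).2
    have hb := hpart (k + 1) hk
    refine Exec.block (by simp) ?_
    simp only [OpsPre, Function.update_apply, Nat.reduceEqDiff, if_true, if_false, g1, g12, h18, hl1, hl2]
    rw [Finset.sum_range_succ] at hb ⊢
    rw [hp]
    simp only [abs_le] at hb ⊢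
    refine ⟨by omega, by omega, by omega, hb, fun r h1 h2 => ?_, trivial, trivial⟩
    simp only [if_neg h1, if_neg h2, hr r h1 h2]
  · simp [h18]

/-- The sort key of the tuple with index `e.2`, which stands for the answer `e.1`. -/
def sortKey (D : Database q) (w : Fin D.domSize → ℤ) (N : ℕ) (e : (Fin q.numVars → Fin D.domSize) × ℕ) : ℤ :=
  (D.weight w e.1 + (q.numVars * weightBound w : ℕ)) * N + e.2

open Classical in
/-- The answers among the given assignments, with their indices. -/
noncomputable def indexedAnswers (D : Database q) (l : List (Fin q.numVars → Fin D.domSize)) :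
    List ((Fin q.numVars → Fin D.domSize) × ℕ) :=
  l.zipIdx.filter fun e => e.1 ∈ D.answers

theorem abs_weight_le (D : Database q) (w : Fin D.domSize → ℤ) (t : Fin q.numVars → Fin D.domSize) :
    |D.weight w t| ≤ (q.numVars * weightBound w : ℕ) := by
  refine (Finset.abs_sum_le_sum_abs _ _).trans ?_
  refine (Finset.sum_le_sum fun x _ => abs_le_weightBound w (t x)).trans ?_
  simp

theorem indexedAnswers_concat (D : Database q) (l : List (Fin q.numVars → Fin D.domSize))
    (t : Fin q.numVars → Fin D.domSize) [Decidable (t ∈ D.answers)] :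
    indexedAnswers D (l ++ [t]) =
      indexedAnswers D l ++ if t ∈ D.answers then [(t, l.length)] else [] := by
  rw [indexedAnswers, List.zipIdx_append, List.filter_append]
  congr 1
  by_cases h : t ∈ D.answers <;> simp [h]

theorem length_indexedAnswers_le (D : Database q) (l : List (Fin q.numVars → Fin D.domSize)) :
    (indexedAnswers D l).length ≤ l.length := by
  simpa [indexedAnswers] using List.length_filter_le _ l.zipIdx

theorem exec_collect {W Y am : ℕ} {D : Database q} {w : Fin D.domSize → ℤ}
    {s : Fin q.numSyms} {pos : Fin q.numVars → Fin (q.arity s)} {μ₀ ρ₀ : ℕ → ℤ}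
    (hP : Pointers D w s ρ₀) (hL : D.Layout w μ₀)
    (hY : ∀ R : Fin q.numSyms, ∀ j ≤ q.arity R, D.domSize ^ j ≤ Y)
    (ha : ∀ R, q.arity R ≤ am) (haW : am ≤ W)
    (hW : D.blockAddr q.numSyms + 3 + 2 * (D.rel s).length + (Y + 1) * q.numSyms ≤ W)
    (hT : IsTable D (D.blockAddr q.numSyms + 3 + 2 * (D.rel s).length) μ₀)
    (hK : (2 * (q.numVars * weightBound w) + 1) * (D.rel s).length + q.numVars * weightBound w ≤ W) :
    Exec W ((D.rel s).length * (q.numAtoms * (am * 5 + 8) + q.numVars * 6 + 14) + 7) (collect pos)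
      (fun ρ μ => Pointers D w s ρ ∧ (∀ a < D.blockAddr q.numSyms + 3, μ a = μ₀ a) ∧
        ∃ J, J = indexedAnswers D ((D.rel s).map fun t x => t (pos x)) ∧ ρ 10 = J.length ∧
        Holds μ (D.blockAddr q.numSyms + 3) (J.map (sortKey D w (D.rel s).length))) ρ₀ μ₀ := by
  classical
  set N := (D.rel s).length with hN
  set T₀ := D.blockAddr q.numSyms with hT₀
  set off := q.numVars * weightBound w with hoff
  have hYpos : 1 ≤ (Y + 1) * q.numSyms :=
    (Nat.le_mul_of_pos_left 1 (Nat.succ_pos Y)).trans (Nat.mul_le_mul_left _ s.pos)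
  have hb := D.blockAddr_pos q.numSyms
  have hbs := D.blockAddr_mono (show (s : ℕ) + 1 ≤ q.numSyms by omega)
  rw [Database.blockAddr, D.lenAt_val, JoinQuery.arityAt_val, ← hN] at hbs
  have hoffW : off ≤ W := (Nat.le_add_left _ _).trans hK
  set ans : (Fin (q.arity s) → Fin D.domSize) → Fin q.numVars → Fin D.domSize := fun t x => t (pos x)
    with hans
  -- the answers among the first `j` tuples
  set J : ℕ → List ((Fin q.numVars → Fin D.domSize) × ℕ) :=
    fun j => indexedAnswers D (((D.rel s).take j).map ans) with hJ
  refine (Exec.ops_seq (T := 4 + N * (1 + (q.numAtoms * (am * 5 + 8) + (1 + (q.numVars * 6 + 8))) + 4))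
    ?_).mono (by simp only [List.length_cons, List.length_nil]; ring_nf; omega) fun _ _ h => h
  simp only [OpsPre, Function.update_apply, Nat.reduceEqDiff, if_true, if_false, hP.tup, abs_le]
  refine ⟨by omega, by omega, by omega, ?_⟩
  refine Exec.forLoop N (fun j ρ μ => Pointers D w s ρ ∧
    ρ 12 = ((D.blockAddr s + 1 + j * q.arity s : ℕ) : ℤ) ∧ ρ 10 = (J j).length ∧
    Holds μ (T₀ + 3) ((J j).map (sortKey D w N)) ∧
    ∀ a, a < T₀ + 3 ∨ T₀ + 3 + N ≤ a → μ a = μ₀ a) (by decide) (by decide) (by decide)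
    (by omega) (by simpa using hP.num) ?_ ?_ ?_ ?_
  · rintro j ρ μ x y ⟨hP, h⟩
    refine ⟨hP.congr fun r hr => ?_, by simpa using h⟩
    rw [Function.update_of_ne (by omega), Function.update_of_ne (by omega)]
  · refine ⟨hP.congr fun r hr => ?_, by simp, by simp [hJ, indexedAnswers],
      by simp [hJ, indexedAnswers, holds_nil], fun _ _ => rfl⟩
    rw [Function.update_of_ne (by omega), Function.update_of_ne (by omega), Function.update_of_ne (by omega)]
  · rintro j hj ρ μ ⟨hP, h12, h10, hH, hμ⟩ h13 h4
    have hL' : D.Layout w μ := hL.congr fun a ha => hμ a (by omega)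
    have hT' : IsTable D (T₀ + 3 + 2 * N) μ := fun R t => by rw [hμ _ (by omega), hT R t]
    have htup := hL'.tuple s j hj
    have hmul : (j + 1) * q.arity s ≤ N * q.arity s := Nat.mul_le_mul_right _ hj
    have hmul' : (j + 1) * q.arity s = j * q.arity s + q.arity s := by ring
    refine Exec.seq (T₁ := 1) (Exec.block (by simp) ?_)
    simp only [OpsPre, abs_le]
    refine ⟨by omega, ?_⟩
    refine Exec.seq ((exec_checkAtoms (t := (D.rel s)[j]) (Y := Y) (am := am)
      (hP.congr fun r hr => Function.update_of_ne (by omega) _ _) hY ha hW hT'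
      (by simpa using h12) htup (by omega) (by simp)).mono le_rfl ?_)
    rintro ρ' μ' ⟨hr', h17, rfl⟩
    refine Exec.seq (T₁ := 1) (Exec.block (by simp) ?_)
    simp only [OpsPre, abs_le]
    refine ⟨by omega, ?_⟩
    have hP' : Pointers D w s ρ' := hP.congr fun r hr => by
      rw [hr' r (by omega) (by omega) (by omega), Function.update_of_ne (by omega)]
    refine Exec.seq ((exec_addWeights (t := (D.rel s)[j]) (D := D) (w := w)
      (ta := D.blockAddr s + 1 + j * q.arity s) (by simpa using hP'.one) hL' (by omega) hoffW ?_ htup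
      (by omega) (by simp)).mono le_rfl ?_)
    · rw [Function.update_of_ne (by norm_num), hr' 12 (by norm_num) (by norm_num) (by norm_num),
        Function.update_of_ne (by norm_num), h12]
    rintro ρ'' μ'' ⟨hr'', h18, rfl⟩
    have hrr : ∀ r, r < 15 → ρ'' r = ρ r := fun r hr => by
      rw [hr'' r (by omega) (by omega), Function.update_of_ne (by omega),
        hr' r (by omega) (by omega) (by omega), Function.update_of_ne (by omega)]
    have k17 : ρ'' 17 = if ans (D.rel s)[j] ∈ D.answers then 1 else 0 := by
      rw [hr'' 17 (by norm_num) (by norm_num), Function.update_of_ne (by norm_num), h17]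
    have hP'' : Pointers D w s ρ'' := hP.congr fun r hr => hrr r (by omega)
    have hwt := abs_weight_le D w (ans (D.rel s)[j])
    have hJlen : (J j).length ≤ j := by
      refine (length_indexedAnswers_le D _).trans ?_
      simp
    have haddr : ((T₀ + 3 : ℕ) : ℤ) + (J j).length = ((T₀ + 3 + (J j).length : ℕ) : ℤ) := by push_cast; rfl
    have hkey : (D.weight w (ans (D.rel s)[j]) + (off : ℕ)) * (N : ℤ) + j = sortKey D w N (ans (D.rel s)[j], j) :=
      rfl
    rw [abs_le] at hwt
    have hkb : 0 ≤ (D.weight w (ans (D.rel s)[j]) + (off : ℕ)) * (N : ℤ) ∧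
        (D.weight w (ans (D.rel s)[j]) + (off : ℕ)) * (N : ℤ) ≤ ((2 * off * N : ℕ) : ℤ) := by
      constructor
      · exact mul_nonneg (by omega) (by positivity)
      · push_cast
        exact mul_le_mul_of_nonneg_right (by omega) (by positivity)
    have hK' : (2 * off + 1) * N = 2 * off * N + N := by ring
    have has := ha s
    have poff : ρ'' 3 = ((off : ℕ) : ℤ) := hP''.off
    have pnum : ρ'' 4 = (N : ℤ) := hP''.num
    have parr : ρ'' 7 = ((T₀ + 3 : ℕ) : ℤ) := hP''.arr
    have k18 : ρ'' 18 = D.weight w (ans (D.rel s)[j]) := h18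
    refine Exec.block (by simp) ?_
    simp only [OpsPre, Function.update_apply, Nat.reduceEqDiff, if_true, if_false, poff, pnum,
      parr, k18, k17, hrr 13 (by norm_num), h13, hrr 10 (by norm_num), h10, hrr 12 (by norm_num), h12,
      JoinQuery.arityAt_val, haddr, Int.toNat_natCast]
    have h2off : 2 * off * N + N + off ≤ W := by omega
    have hlin : off ≤ off * N := Nat.le_mul_of_pos_right _ (by omega)
    have hlin' : 2 * off * N = off * N + off * N := by ring
    have htk : (D.rel s).take (j + 1) = (D.rel s).take j ++ [(D.rel s)[j]] := by simp
    have hJs : J (j + 1) = J j ++ if ans (D.rel s)[j] ∈ D.answers then [(ans (D.rel s)[j], j)] else [] := by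
      simp only [hJ]
      rw [htk, List.map_append, List.map_singleton, indexedAnswers_concat]
      congr
      simp; omega
    have hHupd : ∀ v, Holds (Function.update μ'' (T₀ + 3 + (J j).length) v) (T₀ + 3)
        ((J j).map (sortKey D w N)) := fun v => hH.update (by simp)
    have hμupd : ∀ v a, a < T₀ + 3 ∨ T₀ + 3 + N ≤ a →
        (if a = T₀ + 3 + (J j).length then v else μ'' a) = μ₀ a := fun v a h => by
      rw [if_neg (by omega), hμ a h]
    simp only [abs_le]
    refine ⟨by omega, by omega, by omega, by omega, by split_ifs <;> omega, by omega, by omega, trivial,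
      trivial, hP''.congr fun r hr => ?_, ?_, ?_, ?_, hμupd _⟩
    · have : r ≠ 12 ∧ r ≠ 16 ∧ r ≠ 10 ∧ r ≠ 18 := by omega
      simp [this]
    · rw [hmul']; push_cast; ring
    · rw [hJs]
      split_ifs <;> simp
    · rw [hkey, hJs]
      split_ifs
      · rw [List.map_append, List.map_singleton]
        exact hH.concat (by simp)
      · rw [List.append_nil]
        exact hHupd _
  · rintro ρ μ ⟨hP, -, h10, hH, hμ⟩ -
    refine ⟨hP, fun a ha => hμ a (.inl ha), J N, ?_, h10, hH⟩
    simp only [hJ]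
    rw [hN, List.take_length]

/-! ### The access program -/

/-- The memory after preprocessing, for the sorted array `L`: cell 0 has the address of a descriptor, which
consists of the length of `L`, a modulus `N` and the address of the tuples of the relation `s`; it is
followed by an array with the sort keys, whose remainders modulo `N` are the indices of the tuples. -/
structure Ready {n : ℕ} {s : Fin q.numSyms} (pos : Fin q.numVars → Fin (q.arity s)) (W : ℕ)
    (L : List (Fin q.numVars → Fin n)) (T₀ N tb : ℕ) (M : ℕ → ℤ) : Prop where
  ptr : M 0 = T₀
  len : M T₀ = L.length
  mod : M (T₀ + 1) = N
  tup : M (T₀ + 2) = tb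
  fits : ∀ a, |M a| ≤ W
  bound : T₀ + 2 + L.length ≤ W
  entry : ∀ i (h : i < L.length), 0 ≤ M (T₀ + 3 + i) ∧ ∃ j < N, M (T₀ + 3 + i) % N = j ∧
    tb + (j + 1) * q.arity s ≤ W ∧ ∀ x, M (tb + j * q.arity s + pos x) = ((L[i] x : ℕ) : ℤ)

/-- Look up the tuple with the index in the requested cell of the sorted array. -/
def access {s : Fin q.numSyms} (pos : Fin q.numVars → Fin (q.arity s)) : Fragment :=
  ops [.load 2 1, .load 3 2, .sub 3 0 3, .add 4 0 1, .const 0 0] ;;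
  skipIf 3 (ops [.const 1 1, .add 5 2 1, .load 6 5, .add 5 5 1, .load 7 5, .add 5 5 4, .load 8 5,
      .div 9 8 6, .mul 9 9 6, .sub 8 8 9, .const 9 (q.arity s), .mul 8 8 9, .add (q.numVars + 1) 8 7] ;;
    seqN (fun x => ops [.const (q.numVars + 2) (posAt pos x),
      .add (q.numVars + 2) (q.numVars + 2) (q.numVars + 1), .load (x + 1) (q.numVars + 2)]) q.numVars ;;
    ops [.const 0 1])

theorem exec_access {n W T₀ N tb i : ℕ} {s : Fin q.numSyms} {pos : Fin q.numVars → Fin (q.arity s)}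
    {L : List (Fin q.numVars → Fin n)} {M : ℕ → ℤ} (hM : Ready pos W L T₀ N tb M) (hi : 1 ≤ i)
    (hiW : i ≤ W) (ha : q.arity s ≤ W) :
    Exec W (q.numVars * 3 + 20) (access pos) (fun ρ μ => IsReply ⟨0, ρ, μ⟩ L[i - 1]? ∧ μ = M)
      (requestConfig M i).reg M := by
  unfold access
  refine (Exec.seq (T₁ := 5) (T₂ := q.numVars * 3 + 14 + 1) (Exec.block (by simp) ?_)).mono (by omega)
    fun _ _ h => h
  simp only [OpsPre, requestConfig, Function.update_apply, Nat.reduceEqDiff, if_true, if_false,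
    Int.toNat_zero, one_ne_zero, hM.ptr, Int.toNat_natCast, hM.len, abs_le]
  have hb := hM.bound
  refine ⟨by omega, by omega, by omega, Exec.skipIf (T := q.numVars * 3 + 14) (fun h => ?_) fun h => ?_⟩
  · simp only [Function.update_apply, Nat.reduceEqDiff, if_true, if_false] at h
    obtain ⟨hv, j, hj, hvj, htb, hx⟩ := hM.entry (i - 1) (by omega)
    have haddr : ((T₀ : ℤ) + 1 + 1 + (i + 0)).toNat = T₀ + 3 + (i - 1) := by omega
    have haddr1 : ((T₀ : ℤ) + 1).toNat = T₀ + 1 := by omega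
    have haddr2 : ((T₀ : ℤ) + 1 + 1).toNat = T₀ + 2 := by omega
    have hsub : M (T₀ + 3 + (i - 1)) - M (T₀ + 3 + (i - 1)) / N * N = j := by
      rw [← hvj, Int.emod_def, mul_comm]
    have hvW := abs_le.1 (hM.fits (T₀ + 3 + (i - 1)))
    have hd1 : 0 ≤ M (T₀ + 3 + (i - 1)) / (N : ℤ) := Int.ediv_nonneg hv (by positivity)
    have hd2 : M (T₀ + 3 + (i - 1)) / (N : ℤ) ≤ M (T₀ + 3 + (i - 1)) := Int.ediv_le_self _ hv
    have hmul : (j + 1) * q.arity s = j * q.arity s + q.arity s := by ring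
    have hta : (j : ℤ) * q.arity s + tb = ((tb + j * q.arity s : ℕ) : ℤ) := by push_cast; ring
    have hmul' : (j : ℤ) * q.arity s = ((j * q.arity s : ℕ) : ℤ) := by push_cast; ring
    refine (Exec.seq (T₁ := 13) (T₂ := q.numVars * 3 + 1) (Exec.block (by simp) ?_)).mono (by omega)
      fun _ _ h => h
    simp only [OpsPre, Function.update_apply, Nat.reduceEqDiff, if_true, if_false, haddr, haddr1, haddr2,
      hM.mod, hM.tup, hsub, hta, OfNat.ofNat_ne_zero, one_ne_zero, OfNat.ofNat_ne_one,
      OfNat.one_ne_ofNat]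
    simp only [hmul', abs_le]
    have hd3 : 0 ≤ M (T₀ + 3 + (i - 1)) / (N : ℤ) * N := mul_nonneg hd1 (by positivity)
    have hjN : j ≤ W := by omega
    refine ⟨by omega, by omega, by omega, by omega, by omega, by omega, by omega, by omega, by omega,
      by omega, ?_⟩
    refine Exec.seq ((Exec.seqN (T := 3) (fun k ρ μ => ρ (q.numVars + 1) = ((tb + j * q.arity s : ℕ) : ℤ) ∧
      (∀ x : Fin q.numVars, (x : ℕ) < k → ρ (x + 1) = ((L[i - 1] x : ℕ) : ℤ)) ∧ μ = M) ?_ ?_).mono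
      le_rfl ?_)
    · rintro k hk ρ μ ⟨hta, hx', rfl⟩
      have hp : posAt pos k = pos ⟨k, hk⟩ := by simp [posAt, hk]
      have hpl := (pos ⟨k, hk⟩).2
      refine Exec.block (by simp) ?_
      simp only [OpsPre, Function.update_self, Function.update_of_ne (show q.numVars + 1 ≠ q.numVars + 2 by omega),
        hta, abs_le, hp]
      refine ⟨by omega, by omega, ?_, fun x hxk => ?_, trivial⟩
      · rw [Function.update_of_ne (by omega), Function.update_of_ne (by omega),
          Function.update_of_ne (by omega), hta]
      · rcases Nat.lt_succ_iff_lt_or_eq.1 hxk with h | h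
        · rw [Function.update_of_ne (by omega), Function.update_of_ne (by omega),
            Function.update_of_ne (by omega), hx' x h]
        · subst h
          rw [Function.update_self, ← hx x, Fin.eta]
          congr 1; omega
    · exact ⟨by simp, fun x hx => by omega, rfl⟩
    · rintro ρ μ ⟨-, hx', rfl⟩
      refine Exec.block (by simp) ?_
      simp only [OpsPre, abs_le]
      refine ⟨by omega, ?_, trivial⟩
      rw [List.getElem?_eq_getElem (by omega)]
      exact ⟨by simp, fun x => by simpa using hx' x x.2⟩
  · simp only [Function.update_apply, Nat.reduceEqDiff, if_true, if_false] at h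
    rw [List.getElem?_eq_none (by omega)]
    simp [IsReply]

/-! ### Correctness of the preprocessing program -/

/-- A permutation of the image of a list is the image of a permutation of the list. -/
theorem exists_map_eq_of_perm_map {α β : Type} {f : α → β} {ys : List β} {J : List α}
    (h : ys.Perm (J.map f)) : ∃ J' : List α, J'.Perm J ∧ ys = J'.map f := by
  obtain ⟨J', h1, h2⟩ := List.perm_comp_forall₂ (r := fun b a => b = f a) h
    (List.forall₂_map_left_iff.2 (List.forall₂_same.2 fun _ _ => rfl))
  refine ⟨J', h2, ?_⟩
  rwa [← List.forall₂_eq_eq_eq, List.forall₂_map_right_iff]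

/-- The sorted sequence of keys yields the array of answers in sum order: the quotient of a key by the
number of tuples is the weight up to a constant, and the remainder is the index of the tuple. -/
theorem exists_isSumOrdered {D : Database q} {w : Fin D.domSize → ℤ} {i₀ : Fin q.numAtoms}
    {pos : Fin q.numVars → Fin (q.arity (q.sym i₀))} (hpos : ∀ x, q.args i₀ (pos x) = x)
    (hpos' : ∀ j, pos (q.args i₀ j) = j) {ys : List ℤ}
    (hperm : ys.Perm ((indexedAnswers D ((D.rel (q.sym i₀)).map fun t x => t (pos x))).map
      (sortKey D w (D.rel (q.sym i₀)).length))) (hsort : ys.Pairwise (· ≤ ·)) :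
    ∃ L, D.IsSumOrdered w L ∧ L.length = ys.length ∧ ∀ i (h : i < L.length) (h' : i < ys.length),
      0 ≤ ys[i] ∧ ∃ j, ∃ hj : j < (D.rel (q.sym i₀)).length, ys[i] % (D.rel (q.sym i₀)).length = j ∧
        ∀ x, L[i] x = (D.rel (q.sym i₀))[j] (pos x) := by
  classical
  set ts := D.rel (q.sym i₀) with hts
  obtain ⟨J, hJ, rfl⟩ := exists_map_eq_of_perm_map hperm
  have hmem : ∀ e ∈ J, e.1 ∈ D.answers ∧ ∃ hj : e.2 < ts.length, e.1 = fun x => ts[e.2] (pos x) := by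
    intro e he
    have := List.mem_filter.1 (hJ.mem_iff.1 he)
    refine ⟨by simpa using this.2, ?_⟩
    have h := List.mem_zipIdx_iff_getElem?.1 this.1
    rw [List.getElem?_map] at h
    have hj : e.2 < ts.length := by
      by_contra hj
      rw [List.getElem?_eq_none (by omega)] at h
      simp at h
    refine ⟨hj, ?_⟩
    rw [List.getElem?_eq_getElem hj] at h
    simpa using h.symm
  have hfst : (J.map Prod.fst).Perm ((ts.map fun t x => t (pos x)).filter fun t => t ∈ D.answers) := by
    refine (hJ.map _).trans (List.Perm.of_eq ?_)
    have : (ts.map fun t x => t (pos x)) = (ts.map fun t x => t (pos x)).zipIdx.map Prod.fst := by simp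
    conv_rhs => rw [this, List.filter_map]
    rfl
  have hkey : ∀ e ∈ J, 0 ≤ sortKey D w ts.length e ∧ sortKey D w ts.length e % ts.length = e.2 ∧
      sortKey D w ts.length e / ts.length = D.weight w e.1 + (q.numVars * weightBound w : ℕ) := by
    intro e he
    obtain ⟨-, hj, -⟩ := hmem e he
    have h := abs_le.1 (abs_weight_le D w e.1)
    have h0 : 0 ≤ (D.weight w e.1 + (q.numVars * weightBound w : ℕ)) * (ts.length : ℤ) :=
      mul_nonneg (by omega) (by positivity)
    refine ⟨by rw [sortKey]; omega, ?_, ?_⟩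
    · rw [sortKey, add_comm, Int.add_mul_emod_self_right, Int.emod_eq_of_lt (by omega) (by omega)]
    · rw [sortKey, add_comm, Int.add_mul_ediv_right _ _ (by omega),
        Int.ediv_eq_zero_of_lt (by omega) (by omega), zero_add]
  refine ⟨J.map Prod.fst, ⟨?_, fun t => ?_, ?_⟩, by simp, fun i h h' => ?_⟩
  · refine hfst.nodup_iff.2 (List.Nodup.filter _ ((D.rel_nodup _).map fun t t' h => ?_))
    funext j
    have := congrFun h (q.args i₀ j)
    simpa only [hpos'] using this
  · rw [hfst.mem_iff, List.mem_filter, List.mem_map]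
    simp only [decide_eq_true_eq]
    refine ⟨fun h => h.2, fun h => ⟨⟨_, h i₀, ?_⟩, h⟩⟩
    funext x
    rw [hpos]
  · rw [List.pairwise_map] at hsort ⊢
    refine hsort.imp_of_mem fun {e e'} he he' h => ?_
    obtain ⟨-, hj, -⟩ := hmem e he
    have := Int.ediv_le_ediv (by omega : (0 : ℤ) < ts.length) h
    rw [(hkey e he).2.2, (hkey e' he').2.2] at this
    omega
  · rw [List.length_map] at h
    have he : J[i] ∈ J := List.getElem_mem h
    obtain ⟨-, hj, ht⟩ := hmem _ he
    refine ⟨by rw [List.getElem_map]; exact (hkey _ he).1, J[i].2, hj, ?_, fun x => ?_⟩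
    · rw [List.getElem_map]
      exact (hkey _ he).2.1
    · rw [List.getElem_map, ht]

/-- The preprocessing program: build a table of all tuples, collect the keys of the answers among the
tuples of the relation `s`, sort them, and write the descriptor. -/
def preprocess {s : Fin q.numSyms} (pos : Fin q.numVars → Fin (q.arity s)) : Fragment :=
  setup q ;; scan q s ;; markAll q ;; collect pos ;;
  ops [.add 11 3 3, .add 11 11 1, .mul 11 11 4] ;; radixSort ;;
  ops [.const 16 0, .store 16 6, .store 6 10, .add 16 6 1, .store 16 4, .add 16 16 1, .store 16 5]

theorem exec_preprocess {W Y m am J : ℕ} {D : Database q} {w : Fin D.domSize → ℤ} {i₀ : Fin q.numAtoms}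
    {pos : Fin q.numVars → Fin (q.arity (q.sym i₀))} (hpos : ∀ x, q.args i₀ (pos x) = x)
    (hpos' : ∀ j, pos (q.args i₀ j) = j)
    (hY : ∀ R : Fin q.numSyms, ∀ j ≤ q.arity R, D.domSize ^ j ≤ Y)
    (ha : ∀ R, q.arity R ≤ am) (haW : am ≤ W) (hlen : ∀ R, (D.rel R).length ≤ m) (hm : m + 1 ≤ W)
    (hW : D.blockAddr q.numSyms + 3 + 2 * m + (Y + 1) * q.numSyms + 2 ≤ W) (hr : q.numVars ≤ W)
    (hS : weightBound w ≤ W)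
    (hK : 2 * ((2 * (q.numVars * weightBound w) + 1) * m) + 2 * (q.numVars * weightBound w) + 2 ≤ W)
    (hJ : (2 * (q.numVars * weightBound w) + 1) * m ≤ 2 ^ J) (hJ0 : 0 < J) :
    Exec W (D.domSize * 8 + q.numSyms * 7 + q.numSyms * (m * (am * 5 + 13) + 6) +
      m * (q.numAtoms * (am * 5 + 8) + q.numVars * 6 + 14) + J * (m * 27 + 13) + 40) (preprocess pos)
      (fun _ μ => ∃ L, D.IsSumOrdered w L ∧ ∃ T₀ N tb, ((∀ a, |μ a| ≤ W) → Ready pos W L T₀ N tb μ))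
      (fun _ => 0) (inputConfig (D.encode w)).mem := by
  set N := (D.rel (q.sym i₀)).length with hN
  have hNm : N ≤ m := hlen (q.sym i₀)
  set off := q.numVars * weightBound w with hoff
  clear_value off
  set T₀ := D.blockAddr q.numSyms with hT₀
  have hb := D.blockAddr_pos q.numSyms
  rw [← hT₀] at hb
  have hbs := D.blockAddr_mono (show (q.sym i₀ : ℕ) + 1 ≤ q.numSyms by omega)
  rw [Database.blockAddr, D.lenAt_val, JoinQuery.arityAt_val, ← hN, ← hT₀] at hbs
  have hKN : (2 * off + 1) * N ≤ (2 * off + 1) * m := Nat.mul_le_mul_left _ hNm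
  have hL : D.Layout w (inputConfig (D.encode w)).mem :=
    Database.layout_of_holds (Database.holds_inputConfig _)
  have hzero : ∀ a ≥ T₀, (inputConfig (D.encode w)).mem a = 0 := fun a ha => by
    have : (D.encode w).length ≤ a := by rw [D.length_encode]; exact ha
    simp [inputConfig, List.getD_eq_getElem?_getD, List.getElem?_eq_none this]
  have hC : N * (q.numAtoms * (am * 5 + 8) + q.numVars * 6 + 14) ≤
      m * (q.numAtoms * (am * 5 + 8) + q.numVars * 6 + 14) := Nat.mul_le_mul_right _ hNm
  unfold preprocess
  refine (Exec.seq (T₂ := (q.numSyms * 7 + 5) + ((q.numSyms * (m * (am * 5 + 13) + 6) + 1) +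
    ((N * (q.numAtoms * (am * 5 + 8) + q.numVars * 6 + 14) + 7) + (3 + ((J * (m * 27 + 13) + 1) + 7)))))
    ((exec_setup hL (by omega) hS (by omega) hr).mono le_rfl ?_)).mono (by omega) fun _ _ h => h
  rintro ρ μ ⟨h1, h2, h3, rfl⟩
  refine Exec.seq ((exec_scan (q.sym i₀) hL (by omega) (fun k => ?_) h1 h2 h3).mono le_rfl ?_)
  · rw [JoinQuery.arityAt]
    split_ifs
    · exact (ha _).trans haW
    · exact Nat.zero_le _
  rintro ρ μ ⟨hP, rfl⟩
  refine Exec.seq ((exec_markAll (Y := Y) (m := m) (am := am) hP hL hzero hY ha haW hlen hm (by omega)).mono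
    le_rfl ?_)
  rintro ρ μ ⟨hP, hμ, hT⟩
  have hL' : D.Layout w μ := hL.congr fun a ha => hμ a (by omega)
  refine Exec.seq ((exec_collect (Y := Y) (am := am) hP hL' hY ha haW (by omega) hT
    (by rw [← hoff, ← hN]; omega)).mono
    le_rfl ?_)
  rintro ρ μ' ⟨hP, hμ', A, rfl, h10, hH⟩
  set A := indexedAnswers D ((D.rel (q.sym i₀)).map fun t x => t (pos x)) with hA
  have hAN : A.length ≤ N := by simpa using length_indexedAnswers_le D ((D.rel (q.sym i₀)).map fun t x => t (pos x))
  have hoff' := hP.off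
  have hnum := hP.num
  rw [← hoff] at hoff'
  rw [← hN] at hnum
  have hKz : ((off : ℤ) + off + 1) * N = (((2 * off + 1) * N : ℕ) : ℤ) := by push_cast; ring
  refine Exec.seq (T₁ := 3) (Exec.block (by simp) ?_)
  simp only [OpsPre, Function.update_apply, Nat.reduceEqDiff, if_true, if_false, hoff', hnum, hP.one, hKz]
  have hoN : off ≤ W := by omega
  refine ⟨abs_le.2 (by omega), abs_le.2 (by omega), abs_le.2 (by omega), ?_⟩
  have hxs : ∀ v ∈ A.map (sortKey D w N), 0 ≤ v ∧ v < (((2 * off + 1) * N : ℕ) : ℤ) := by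
    intro v hv
    obtain ⟨e, he, rfl⟩ := List.mem_map.1 hv
    have hj : e.2 < N := by
      have := List.snd_lt_of_mem_zipIdx (List.mem_of_mem_filter he)
      simpa using this
    have h := abs_le.1 (abs_weight_le D w e.1)
    rw [← hoff] at h
    have h0 : 0 ≤ (D.weight w e.1 + (off : ℕ)) * (N : ℤ) := mul_nonneg (by omega) (by positivity)
    have h1 : (D.weight w e.1 + (off : ℕ)) * (N : ℤ) ≤ (2 * off) * N :=
      mul_le_mul_of_nonneg_right (by omega) (by positivity)
    have h2 : (((2 * off + 1) * N : ℕ) : ℤ) = (2 * off) * N + N := by push_cast; ring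
    rw [sortKey, ← hoff, h2]
    constructor <;> omega
  have hup : ∀ r ≤ 10, Function.update (Function.update (Function.update ρ 11 ((off : ℤ) + off)) 11
      ((off : ℤ) + off + 1)) 11 (((2 * off + 1) * N : ℕ) : ℤ) r = ρ r := fun r hr => by
    rw [Function.update_of_ne (by omega), Function.update_of_ne (by omega), Function.update_of_ne (by omega)]
  have hPu := hP.congr fun r (hr : r ≤ 9) => hup r (by omega)
  refine Exec.seq ((exec_radixSort (W := W) (K := (2 * off + 1) * N) (J := J) (bA := T₀ + 3) (bB := T₀ + 3 + N)
    (xs := A.map (sortKey D w N)) hPu.one hPu.arr hPu.buf (by simpa using h10) (by simp) hH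
    (by simp; omega) hxs (by omega) (by simp; omega) (by omega) hJ0).mono ?_ ?_)
  · rw [List.length_map]
    gcongr
    omega
  rintro ρ' μ'' ⟨hr', hμ'', ys, hperm, hsort, hys⟩
  have hr3 : ∀ r ≤ 10, ρ' r = ρ r := fun r hr => by
    rw [hr' r (by omega), hup r hr]
  have hP' : Pointers D w (q.sym i₀) ρ' := hP.congr fun r hr => hr3 r (by omega)
  obtain ⟨L, hLs, hLlen, hent⟩ := exists_isSumOrdered hpos hpos' hperm hsort
  have hlenA : ys.length = A.length := by simpa using hperm.length_eq
  have k10 : ρ' 10 = L.length := by rw [hr3 10 le_rfl, h10, hLlen, hlenA]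
  have k6 : ρ' 6 = T₀ := hP'.fin
  have k4 : ρ' 4 = N := hP'.num
  have k5 : ρ' 5 = ((D.blockAddr (q.sym i₀) + 1 : ℕ) : ℤ) := hP'.tup
  have e1 : ((T₀ : ℤ) + 1).toNat = T₀ + 1 := by omega
  have e2 : ((T₀ : ℤ) + 1 + 1).toNat = T₀ + 2 := by omega
  refine Exec.block (by simp) ?_
  simp only [OpsPre, Function.update_apply, Nat.reduceEqDiff, if_true, if_false, k10, k6, k4, k5, hP'.one,
    Int.toNat_natCast, Int.toNat_zero, e1, e2]
  refine ⟨by simp, abs_le.2 (by omega), abs_le.2 (by omega), L, hLs, T₀, N, D.blockAddr (q.sym i₀) + 1, fun hfits =>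
    ⟨?_, ?_, ?_, ?_, fun a => by simpa only [Function.update_apply] using hfits a, by omega, fun i hi => ?_⟩⟩
  · rw [Function.update_of_ne (by omega), Function.update_of_ne (by omega), Function.update_of_ne (by omega),
      Function.update_self]
  · rw [Function.update_of_ne (by omega), Function.update_of_ne (by omega), Function.update_self]
  · rw [Function.update_of_ne (by omega), Function.update_self]
  · rw [Function.update_self]
  · obtain ⟨h0, j, hj, hmod, hx⟩ := hent i hi (by omega)
    rw [← hys i (by omega)] at h0 hmod
    have hcell : ∀ a, a ≠ 0 → a < T₀ ∨ T₀ + 3 ≤ a → ∀ x y z v, Function.update (Function.update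
        (Function.update (Function.update μ'' 0 x) T₀ y) (T₀ + 1) z) (T₀ + 2) v a = μ'' a :=
      fun a h1 h2 x y z v => by
        rw [Function.update_of_ne (by omega), Function.update_of_ne (by omega),
          Function.update_of_ne (by omega), Function.update_of_ne h1]
    have hmul : (j + 1) * q.arity (q.sym i₀) ≤ N * q.arity (q.sym i₀) := Nat.mul_le_mul_right _ hj
    have hmul' : (j + 1) * q.arity (q.sym i₀) = j * q.arity (q.sym i₀) + q.arity (q.sym i₀) := by ring
    rw [hcell _ (by omega) (by omega)]
    refine ⟨h0, j, hj, hmod, by omega, fun x => ?_⟩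
    have hp := (pos x).2
    rw [hcell _ (by omega) (by omega), hμ'' _ (by omega), hμ' _ (by omega), hL'.tuple (q.sym i₀) j hj, hx]

end

/-! ### Growth rates -/

/-- Functions of polynomial growth, in the form used for word sizes. -/
def PolyBounded (f : ℕ → ℕ) : Prop := ∃ k, ∀ n, f n ≤ (n + k) ^ k

theorem add_pow_self_mono (n : ℕ) {k l : ℕ} (h : k ≤ l) : (n + k) ^ k ≤ (n + l) ^ l := by
  rcases Nat.eq_zero_or_pos l with rfl | hl
  · obtain rfl : k = 0 := by omega
    rfl
  · exact (Nat.pow_le_pow_left (by omega) k).trans (Nat.pow_le_pow_right (by omega) h)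

theorem PolyBounded.const (c : ℕ) : PolyBounded fun _ => c :=
  ⟨c + 1, fun n => (by omega : c ≤ n + (c + 1)).trans (Nat.le_self_pow (by omega) _)⟩

theorem PolyBounded.id : PolyBounded fun n => n := ⟨1, fun n => by simp⟩

theorem PolyBounded.mul {f g : ℕ → ℕ} (hf : PolyBounded f) (hg : PolyBounded g) :
    PolyBounded fun n => f n * g n := by
  obtain ⟨k, hk⟩ := hf
  obtain ⟨l, hl⟩ := hg
  refine ⟨k + l, fun n => ?_⟩
  rw [pow_add]
  exact Nat.mul_le_mul ((hk n).trans (Nat.pow_le_pow_left (by omega) _))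
    ((hl n).trans (Nat.pow_le_pow_left (by omega) _))

theorem PolyBounded.add {f g : ℕ → ℕ} (hf : PolyBounded f) (hg : PolyBounded g) :
    PolyBounded fun n => f n + g n := by
  obtain ⟨k, hk⟩ := hf
  obtain ⟨l, hl⟩ := hg
  refine ⟨k + l + 2, fun n => ?_⟩
  have h1 := (hk n).trans (add_pow_self_mono n (show k ≤ k + l + 1 by omega))
  have h2 := (hl n).trans (add_pow_self_mono n (show l ≤ k + l + 1 by omega))
  have h3 : (n + (k + l + 1)) ^ (k + l + 1) ≤ (n + (k + l + 2)) ^ (k + l + 1) :=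
    Nat.pow_le_pow_left (by omega) _
  have h4 : 2 * (n + (k + l + 2)) ^ (k + l + 1) ≤ (n + (k + l + 2)) * (n + (k + l + 2)) ^ (k + l + 1) :=
    Nat.mul_le_mul_right _ (by omega)
  rw [show k + l + 2 = (k + l + 1) + 1 by omega, pow_succ, mul_comm]
  refine le_trans ?_ h4
  dsimp only
  omega

theorem PolyBounded.pow {f : ℕ → ℕ} (hf : PolyBounded f) (c : ℕ) : PolyBounded fun n => f n ^ c := by
  induction c with
  | zero => simpa using PolyBounded.const 1
  | succ c ih => simpa only [pow_succ] using ih.mul hf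

/-- Logarithmic factors are allowed by `Õ`. -/
theorem isSoftO_of_le_mul_log {T : ℕ → ℕ} {f : ℕ → ℝ} {C : ℝ}
    (h : ∀ᶠ n : ℕ in atTop, (T n : ℝ) ≤ C * ‖f n * Real.log n‖) : IsSoftO T f := by
  refine ⟨fun n => Real.log (Real.log n) / Real.log n, ?_, ?_⟩
  · have h1 : Tendsto (fun x : ℝ => Real.log x / x) atTop (𝓝 0) := by
      have := Real.isLittleO_log_id_atTop.tendsto_div_nhds_zero
      simpa using this
    exact h1.comp (Real.tendsto_log_atTop.comp tendsto_natCast_atTop_atTop)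
  · refine IsBigO.of_bound C ?_
    filter_upwards [h, eventually_ge_atTop 3] with n hn h3
    have h3' : (3 : ℝ) ≤ n := by exact_mod_cast h3
    have hlog : 0 < Real.log n := Real.log_pos (by linarith)
    have : (n : ℝ) ^ (Real.log (Real.log n) / Real.log n) = Real.log n := by
      rw [Real.rpow_def_of_pos (by linarith), mul_div_cancel₀ _ hlog.ne', Real.exp_log hlog]
    rw [this, Real.norm_of_nonneg (by positivity)]
    exact hn

theorem one_le_log_natCast {n : ℕ} (h : 3 ≤ n) : 1 ≤ Real.log n := by
  rw [Real.le_log_iff_exp_le (by positivity)]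
  have : (3 : ℝ) ≤ n := by exact_mod_cast h
  linarith [Real.exp_one_lt_d9]

theorem isSoftO_const (c : ℕ) : IsSoftO (fun _ => c) fun _ => 1 := by
  refine isSoftO_of_le_mul_log (C := c) ?_
  filter_upwards [eventually_ge_atTop 3] with n hn
  have := one_le_log_natCast hn
  rw [one_mul, Real.norm_of_nonneg (by linarith)]
  exact le_mul_of_one_le_right (by positivity) this

theorem clog_add_le (k : ℕ) {n : ℕ} (h : 3 ≤ n) :
    (Nat.clog 2 (n + k) : ℝ) ≤ (2 * (1 + Real.log (1 + k)) + 1) * Real.log n := by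
  have hlog := one_le_log_natCast h
  have h3 : (3 : ℝ) ≤ n := by exact_mod_cast h
  have hk : 0 ≤ Real.log (1 + k) := Real.log_nonneg (by have : (0 : ℝ) ≤ k := by positivity
                                                        linarith)
  have h1 : (Nat.clog 2 (n + k) : ℝ) ≤ Nat.log 2 (n + k) + 1 := by
    exact_mod_cast Nat.clog_le_of_le_pow (Nat.lt_pow_succ_log_self (by norm_num) _).le
  have h2 : (Nat.log 2 (n + k) : ℝ) * Real.log 2 ≤ Real.log (n + k) := by
    rw [← Real.log_pow]
    refine Real.log_le_log (by positivity) ?_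
    exact_mod_cast Nat.pow_log_le_self 2 (by omega)
  have h4 : Real.log (n + k) ≤ Real.log n + Real.log (1 + k) := by
    rw [← Real.log_mul (by positivity) (by positivity)]
    refine Real.log_le_log (by positivity) ?_
    have : (0 : ℝ) ≤ k := by positivity
    nlinarith
  have h5 : (1 : ℝ) / 2 ≤ Real.log 2 := by linarith [Real.log_two_gt_d9]
  have h6 : (0 : ℝ) ≤ Nat.log 2 (n + k) := by positivity
  have h7 : Real.log (1 + k) ≤ Real.log (1 + k) * Real.log n := le_mul_of_one_le_right hk hlog
  nlinarith

theorem isSoftO_mul_clog (a k : ℕ) :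
    IsSoftO (fun m => a * (m + 1) * (k * Nat.clog 2 (m + k) + 2)) fun m => (m : ℝ) := by
  refine isSoftO_of_le_mul_log (C := 2 * a * (k * (2 * (1 + Real.log (1 + k)) + 1) + 2)) ?_
  filter_upwards [eventually_ge_atTop 3] with n hn
  have hlog := one_le_log_natCast hn
  have h3 : (3 : ℝ) ≤ n := by exact_mod_cast hn
  have hc := clog_add_le k hn
  set L := 2 * (1 + Real.log (1 + k)) + 1
  rw [Real.norm_of_nonneg (by positivity)]
  push_cast
  have h1 : (k : ℝ) * Nat.clog 2 (n + k) + 2 ≤ (k * L + 2) * Real.log n := by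
    have := mul_le_mul_of_nonneg_left hc (Nat.cast_nonneg (α := ℝ) k)
    nlinarith
  have h2 : (a : ℝ) * (n + 1) ≤ 2 * a * n := by
    have : (0 : ℝ) ≤ a := by positivity
    nlinarith
  calc (a : ℝ) * (n + 1) * (k * Nat.clog 2 (n + k) + 2)
      ≤ (2 * a * n) * ((k * L + 2) * Real.log n) := mul_le_mul h2 h1 (by positivity) (by positivity)
    _ = _ := by ring

theorem RunsTo.mono {P : Program} {T T' W W' : ℕ} {c c' : Config} (h : RunsTo P T W c c')
    (hT : T ≤ T') (hW : W ≤ W') : RunsTo P T' W' c c' := by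
  obtain ⟨t, ht, h1, h2, h3⟩ := h
  have : (W : ℤ) ≤ W' := by exact_mod_cast hW
  exact ⟨t, ht.trans hT, h1, h2, fun u hu =>
    ⟨fun r => ((h3 u hu).1 r).trans this, fun a => ((h3 u hu).2 a).trans this⟩⟩

theorem RunsTo.fits {P : Program} {T W : ℕ} {c c' : Config} (h : RunsTo P T W c c') : c'.Fits W := by
  obtain ⟨t, ht, rfl, h2, h3⟩ := h
  exact h3 t le_rfl

/-! ### Direct access for queries with an atom that contains all variables -/

section

variable {q : JoinQuery}

namespace Database

theorem length_rel_le (D : Database q) (R : Fin q.numSyms) : (D.rel R).length ≤ D.size :=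
  Finset.single_le_sum (f := fun R => (D.rel R).length) (fun _ _ => Nat.zero_le _) (Finset.mem_univ R)

/-- Every domain element occurs in a tuple, so the domain has at most as many elements as there are
positions in tuples. -/
theorem domSize_le (D : Database q) {am : ℕ} (ha : ∀ R, q.arity R ≤ am) : D.domSize ≤ am * D.size := by
  classical
  let f : (Σ R : Fin q.numSyms, Fin (D.rel R).length × Fin (q.arity R)) → Fin D.domSize :=
    fun p => (D.rel p.1)[p.2.1] p.2.2
  have hf : Function.Surjective f := fun e => by
    obtain ⟨R, t, ht, j, hj⟩ := D.dom_active e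
    obtain ⟨i, hi, rfl⟩ := List.getElem_of_mem ht
    exact ⟨⟨R, ⟨i, hi⟩, j⟩, hj⟩
  have := Fintype.card_le_of_surjective f hf
  simp only [Fintype.card_fin, Fintype.card_sigma, Fintype.card_prod] at this
  refine this.trans ?_
  rw [size, Finset.mul_sum]
  exact Finset.sum_le_sum fun R _ => by rw [mul_comm]; exact Nat.mul_le_mul_right _ (ha R)

theorem blockAddr_le (D : Database q) {am : ℕ} (ha : ∀ R, q.arity R ≤ am) (k : ℕ) :
    D.blockAddr k ≤ 1 + am * D.size + k * (1 + D.size * am) := by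
  induction k with
  | zero => have := D.domSize_le ha; simp only [blockAddr]; omega
  | succ k ih =>
    have h1 : D.lenAt k ≤ D.size := by
      rw [lenAt]; split_ifs
      · exact D.length_rel_le _
      · exact Nat.zero_le _
    have h2 : q.arityAt k ≤ am := by
      rw [JoinQuery.arityAt]; split_ifs
      · exact ha _
      · exact Nat.zero_le _
    have := Nat.mul_le_mul h1 h2
    rw [blockAddr, add_mul, one_mul]
    omega

theorem weightBound_le (D : Database q) {w : Fin D.domSize → ℤ} {B am : ℕ} (hw : ∀ e, |w e| ≤ (B : ℤ))
    (ha : ∀ R, q.arity R ≤ am) : weightBound w ≤ am * D.size * B ^ 2 := by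
  have : weightBound w ≤ ∑ _e : Fin D.domSize, B ^ 2 := by
    refine Finset.sum_le_sum fun e _ => Nat.pow_le_pow_left ?_ 2
    have := hw e
    rw [← Int.natCast_natAbs] at this
    exact_mod_cast this
  refine this.trans ?_
  simp only [Finset.sum_const, Finset.card_univ, Fintype.card_fin, smul_eq_mul]
  exact Nat.mul_le_mul_right _ (D.domSize_le ha)

theorem abs_le_of_mem_encode (D : Database q) {w : Fin D.domSize → ℤ} {W : ℕ} (hd : D.domSize ≤ W)
    (hm : D.size ≤ W) (hw : ∀ e, |w e| ≤ (W : ℤ)) : ∀ z ∈ D.encode w, |z| ≤ (W : ℤ) := by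
  intro z hz
  simp only [encode, List.mem_cons, List.mem_append, List.mem_ofFn, List.mem_flatten] at hz
  rcases hz with rfl | ⟨e, rfl⟩ | ⟨_, ⟨R, rfl⟩, hz⟩
  · simpa using hd
  · exact hw e
  · simp only [List.mem_cons, List.mem_flatMap, List.mem_ofFn] at hz
    rcases hz with rfl | ⟨t, _, j, rfl⟩
    · have := D.length_rel_le R
      rw [abs_le]; omega
    · have := (t j).2
      rw [abs_le]; omega

end Database

theorem fits_inputConfig {l : List ℤ} {W : ℕ} (h : ∀ z ∈ l, |z| ≤ (W : ℤ)) : (inputConfig l).Fits W := by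
  refine ⟨fun r => by simp [inputConfig], fun a => ?_⟩
  simp only [inputConfig, List.getD_eq_getElem?_getD]
  by_cases ha : a < l.length
  · rw [List.getElem?_eq_getElem ha]
    exact h _ (List.getElem_mem ha)
  · rw [List.getElem?_eq_none (by omega)]
    simp

/-- If an atom contains all variables, then `pos x` is the position of the variable `x` in it, and each
tuple of its relation determines at most one answer. -/
theorem admitsSumDirectAccess_of_full_atom (i₀ : Fin q.numAtoms) (hfull : ∀ x, x ∈ q.scope i₀) :
    AdmitsSumDirectAccess q (fun m => (m : ℝ)) fun _ => 1 := by
  choose pos hpos using hfull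
  have hpos' : ∀ j, pos (q.args i₀ j) = j := fun j => q.args_injective i₀ (hpos _)
  refine ⟨preprocess pos 0, access pos 0, fun d => ?_⟩
  set am := Finset.univ.sup q.arity with ham
  have ha : ∀ R, q.arity R ≤ am := fun R => Finset.le_sup (Finset.mem_univ R)
  -- `B` bounds the weights, `S` the sum of their squares, `K` the sort keys, and `Y * numSyms` is the size
  -- of the table; `T₀` is the length of the input, and `W` bounds all numbers
  set B : ℕ → ℕ := fun m => (m + d) ^ d with hB
  set S : ℕ → ℕ := fun m => am * m * B m ^ 2 with hS
  set K : ℕ → ℕ := fun m => (2 * (q.numVars * S m) + 1) * m with hK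
  set Y : ℕ → ℕ := fun m => (am * m + 1) ^ am with hY
  set T₀ : ℕ → ℕ := fun m => 1 + am * m + q.numSyms * (1 + m * am) with hT₀
  set W : ℕ → ℕ := fun m => T₀ m + 3 + 2 * m + (Y m + 1) * q.numSyms + 2 + am + (m + 1) + q.numVars + S m +
    (2 * K m + 2 * (q.numVars * S m) + 2) + B m with hW
  have hBp : PolyBounded B := (PolyBounded.id.add (.const d)).pow d
  have hSp : PolyBounded S := ((PolyBounded.const am).mul .id).mul (hBp.pow 2)
  have hKp : PolyBounded K :=
    (((PolyBounded.const 2).mul ((PolyBounded.const _).mul hSp)).add (.const 1)).mul .id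
  have hYp : PolyBounded Y := (((PolyBounded.const am).mul .id).add (.const 1)).pow am
  have hT₀p : PolyBounded T₀ := ((PolyBounded.const 1).add ((PolyBounded.const am).mul .id)).add
    ((PolyBounded.const _).mul ((PolyBounded.const 1).add (PolyBounded.id.mul (.const am))))
  have hWp : PolyBounded W := ((((((((((hT₀p.add (.const 3)).add ((PolyBounded.const 2).mul .id)).add
    ((hYp.add (.const 1)).mul (.const _))).add (.const 2)).add (.const am)).add
    (PolyBounded.id.add (.const 1))).add (.const _)).add hSp).add
    ((((PolyBounded.const 2).mul hKp).add ((PolyBounded.const 2).mul ((PolyBounded.const _).mul hSp))).add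
      (.const 2))).add hBp)
  obtain ⟨k, hk⟩ := hWp
  obtain ⟨l, hl⟩ := hKp
  set A := am * 8 + q.numSyms * 7 + q.numSyms * (am * 5 + 13 + 6) +
    (q.numAtoms * (am * 5 + 8) + q.numVars * 6 + 14) + 40 + 40 with hA
  refine ⟨k, _, _, isSoftO_mul_clog A l, isSoftO_const (q.numVars * 3 + 20), fun D w hw => ?_⟩
  set m := D.size with hm
  have hdom : D.domSize ≤ am * m := D.domSize_le ha
  have hwb : weightBound w ≤ S m := D.weightBound_le hw ha
  have hoff : q.numVars * weightBound w ≤ q.numVars * S m := Nat.mul_le_mul_left _ hwb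
  have hKK : (2 * (q.numVars * weightBound w) + 1) * m ≤ K m := Nat.mul_le_mul_right _ (by omega)
  have hblk : D.blockAddr q.numSyms ≤ T₀ m := D.blockAddr_le ha _
  have hWm : W m = T₀ m + 3 + 2 * m + (Y m + 1) * q.numSyms + 2 + am + (m + 1) + q.numVars + S m +
    (2 * K m + 2 * (q.numVars * S m) + 2) + B m := rfl
  have hdomW : D.domSize ≤ W m := by
    have := D.blockAddr_pos q.numSyms
    omega
  have hfits : (inputConfig (D.encode w)).Fits (W m) :=
    fits_inputConfig (D.abs_le_of_mem_encode hdomW (by omega) fun e => (hw e).trans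
      (by exact_mod_cast (by omega : B m ≤ W m)))
  obtain ⟨c, hc, L, hL, T₁, N, tb, hready⟩ := (exec_preprocess (W := W m) (Y := Y m) (m := m) (am := am)
    (J := l * Nat.clog 2 (m + l) + 1) (D := D) (w := w) hpos hpos'
    (fun R j hj => (Nat.pow_le_pow_left (by omega : D.domSize ≤ am * m + 1) j).trans
      (Nat.pow_le_pow_right (Nat.succ_pos _) (hj.trans (ha R))))
    ha (by omega) D.length_rel_le (by omega) (by omega) (by omega) (by omega) (by omega)
    ((hKK.trans (hl m)).trans (by
      rw [pow_succ, mul_comm l, pow_mul]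
      exact (Nat.pow_le_pow_left (Nat.le_pow_clog (by norm_num) _) _).trans
        (Nat.le_mul_of_pos_right _ (by norm_num)))) (Nat.succ_pos _)).runsTo hfits
  refine ⟨L, hL, Ready pos (W m) L T₁ N tb, ⟨c, hc.mono ?_ (hk m), hready hc.fits.2⟩,
    fun M hM i hi hid => ?_⟩
  · set x := l * Nat.clog 2 (m + l)
    have hmm : m * (am * 5 + 13) + 6 ≤ (m + 1) * (am * 5 + 13 + 6) := by ring_nf; omega
    obtain ⟨p, hp⟩ : ∃ p, p = (m + 1) * (x + 2) := ⟨_, rfl⟩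
    have hpm : m + 1 ≤ p := hp ▸ Nat.le_mul_of_pos_right _ (by omega)
    have hp1 : 1 ≤ p := by omega
    have hm0 : m ≤ p := by omega
    have hx : (x + 1) * (m * 27 + 13) ≤ 40 * p := by
      rw [hp, show 40 * ((m + 1) * (x + 2)) = (x + 2) * (40 * (m + 1)) by ring]
      exact Nat.mul_le_mul (by omega) (by omega)
    calc _ ≤ am * m * 8 + q.numSyms * 7 + q.numSyms * ((m + 1) * (am * 5 + 13 + 6)) +
          m * (q.numAtoms * (am * 5 + 8) + q.numVars * 6 + 14) + (x + 1) * (m * 27 + 13) + 40 := by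
          gcongr
      _ ≤ am * p * 8 + q.numSyms * 7 * p + q.numSyms * (p * (am * 5 + 13 + 6)) +
          p * (q.numAtoms * (am * 5 + 8) + q.numVars * 6 + 14) + 40 * p + 40 * p := by
          have e1 : q.numSyms * 7 ≤ q.numSyms * 7 * p := Nat.le_mul_of_pos_right _ hp1
          have e2 : am * m * 8 ≤ am * p * 8 := by gcongr
          have e3 : q.numSyms * ((m + 1) * (am * 5 + 13 + 6)) ≤ q.numSyms * (p * (am * 5 + 13 + 6)) := by
            gcongr
          have e4 := Nat.mul_le_mul_right (q.numAtoms * (am * 5 + 8) + q.numVars * 6 + 14) hm0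
          omega
      _ = A * (m + 1) * (x + 2) := by rw [hA, mul_assoc _ (m + 1), ← hp]; ring
  · have hreq : (requestConfig M i).Fits (W m) := by
      refine ⟨fun r => ?_, hM.fits⟩
      have : i ≤ W m := by have : i ≤ B m := hid
                           omega
      simp only [requestConfig]
      split_ifs
      · simpa using this
      · simp
    obtain ⟨c, hc, hrep, hmem⟩ := (exec_access hM hi (by have : i ≤ B m := hid
                                                         omega) (by have := ha (q.sym i₀)
                                                                    omega)).runsTo hreq
    exact ⟨c, hc.mono le_rfl (hk m), hrep, by rw [hmem]; exact hM⟩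

end

/-! ### Running a program as a subroutine -/

/-- The translation of one instruction of a program of length `len` that is simulated from line `p` on.
Its registers are shifted by 32, and its memory cell `a` becomes the cell `a * K`, where `K` is in
register 2; the product is computed in register 3. -/
def simInstr (p len : ℕ) : Instr → List Instr
  | .const r z => [.const (r + 32) z, .const 3 0]
  | .add r s t => [.add (r + 32) (s + 32) (t + 32), .const 3 0]
  | .sub r s t => [.sub (r + 32) (s + 32) (t + 32), .const 3 0]
  | .mul r s t => [.mul (r + 32) (s + 32) (t + 32), .const 3 0]
  | .div r s t => [.div (r + 32) (s + 32) (t + 32), .const 3 0]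
  | .load r s => [.mul 3 (s + 32) 2, .load (r + 32) 3]
  | .store r s => [.mul 3 (r + 32) 2, .store 3 (s + 32)]
  | .jumpPos r l => [.const 3 0, .jumpPos (r + 32) (p + 2 * min l len)]

/-- Run the program `P` on the registers from 32 on and the memory cells whose address is a multiple of
register 2. -/
def simulate (P : Program) : Fragment := fun p => P.flatMap (simInstr p P.length)

theorem length_simInstr (p len : ℕ) (I : Instr) : (simInstr p len I).length = 2 := by
  cases I <;> rfl

theorem length_flatMap_simInstr (p len : ℕ) (P : Program) :
    (P.flatMap (simInstr p len)).length = 2 * P.length := by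
  simp [List.length_flatMap, length_simInstr, mul_comm]

theorem getElem?_flatMap_simInstr (p len : ℕ) (P : Program) (j b : ℕ) (hb : b < 2) :
    (P.flatMap (simInstr p len))[2 * j + b]? = P[j]?.bind fun I => (simInstr p len I)[b]? := by
  induction P generalizing j with
  | nil => simp
  | cons I P ih =>
    rw [List.flatMap_cons]
    cases j with
    | zero =>
      rw [List.getElem?_append_left (by rw [length_simInstr]; omega)]
      simp
    | succ j =>
      rw [List.getElem?_append_right (by rw [length_simInstr]; omega), length_simInstr,
        show 2 * (j + 1) + b - 2 = 2 * j + b by omega, ih]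
      simp

/-- The configuration `c'` represents the configuration `c` of the simulated program; the other registers
and memory cells are as in `ρ` and `μ`. -/
structure Simulates (K len p : ℕ) (ρ μ : ℕ → ℤ) (c c' : Config) : Prop where
  pc : c'.pc = p + 2 * min c.pc len
  reg : ∀ r, c'.reg (r + 32) = c.reg r
  own : ∀ r < 32, r ≠ 3 → c'.reg r = ρ r
  mem : ∀ a, c'.mem (a * K) = c.mem a
  rest : ∀ a, ¬ K ∣ a → c'.mem a = μ a

theorem toNat_mul_natCast (z : ℤ) (K : ℕ) : (z * K).toNat = z.toNat * K := by
  rcases le_total 0 z with h | h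
  · lift z to ℕ using h
    rw [← Nat.cast_mul]; rfl
  · rw [Int.toNat_of_nonpos h, zero_mul, Int.toNat_of_nonpos]
    exact mul_nonpos_of_nonpos_of_nonneg h (by positivity)

/-- An assignment to the simulated register `s`, followed by one to register 3. -/
theorem update_shift (f g : ℕ → ℤ) (h : ∀ r, f (r + 32) = g r) (s : ℕ) (z y : ℤ) (r : ℕ) :
    Function.update (Function.update f (s + 32) z) 3 y (r + 32) = Function.update g s z r := by
  rw [Function.update_of_ne (by omega)]
  by_cases hr : r = s
  · subst hr; simp
  · rw [Function.update_of_ne (by omega), Function.update_of_ne hr, h]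

theorem Simulates.step {P P' : Program} {K p W W' : ℕ} {ρ μ : ℕ → ℤ} {c c' : Config}
    (hP' : Placed P' p (simulate P p)) (hK : ρ 2 = K) (hK0 : 0 < K) (hW : W * K ≤ W')
    (h : Simulates K P.length p ρ μ c c') (hc : c.pc < P.length) (hf : c.Fits W)
    (hf1 : (step P c).Fits W) (hf' : c'.Fits W') :
    Reaches P' W' 2 c' fun c'' => Simulates K P.length p ρ μ (step P c) c'' := by
  obtain ⟨pc, reg, mem⟩ := c
  obtain ⟨pc', reg', mem'⟩ := c'
  obtain ⟨hpc, hreg, hown, hmem, hrest⟩ := h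
  dsimp only at *
  rw [min_eq_left hc.le] at hpc
  subst hpc
  have hWW : (W : ℤ) ≤ W' := by exact_mod_cast (Nat.le_mul_of_pos_right W hK0).trans hW
  have hlook : ∀ b < 2, P'[p + 2 * pc + b]? = (simInstr p P.length P[pc])[b]? := fun b hb => by
    have hlen : (simulate P p).length = 2 * P.length := length_flatMap_simInstr _ _ _
    rw [add_assoc, hP' _ (by omega)]
    unfold simulate
    rw [getElem?_flatMap_simInstr _ _ _ _ _ hb, List.getElem?_eq_getElem hc]
    rfl
  have h0 := hlook 0 (by norm_num)
  have h1 := hlook 1 (by norm_num)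
  rw [add_zero] at h0
  have hs : SumDirectAccess.step P ⟨pc, reg, mem⟩ = P[pc].exec ⟨pc, reg, mem⟩ := by
    rw [SumDirectAccess.step, List.getElem?_eq_getElem hc]
  rw [hs] at hf1 ⊢
  have hs0 : ∀ I ρ' μ', (simInstr p P.length P[pc])[0]? = some I →
      SumDirectAccess.step P' ⟨p + 2 * pc, ρ', μ'⟩ = I.exec ⟨p + 2 * pc, ρ', μ'⟩ := fun I ρ' μ' hI => by
    rw [SumDirectAccess.step, h0, hI]
  have hs1 : ∀ I ρ' μ', (simInstr p P.length P[pc])[1]? = some I →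
      SumDirectAccess.step P' ⟨p + 2 * pc + 1, ρ', μ'⟩ = I.exec ⟨p + 2 * pc + 1, ρ', μ'⟩ := fun I ρ' μ' hI => by
    rw [SumDirectAccess.step, h1, hI]
  have hpc1 : p + 2 * pc + 1 + 1 = p + 2 * min (pc + 1) P.length := by
    rw [min_eq_left (by omega)]; ring
  -- instructions that only assign a value `z` to a register `r`
  have assign : ∀ (I : Instr) (r : ℕ) (z : ℤ), I.exec ⟨pc, reg, mem⟩ = ⟨pc + 1, Function.update reg r z, mem⟩ →
      |z| ≤ W → Reaches P' W' 1 ⟨p + 2 * pc + 1, Function.update reg' (r + 32) z, mem'⟩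
        (fun c'' => Simulates K P.length p ρ μ (I.exec ⟨pc, reg, mem⟩) c'') ∨
        (simInstr p P.length P[pc])[1]? ≠ some (.const 3 0) := by
    intro I r z hI hz
    by_cases h3 : (simInstr p P.length P[pc])[1]? = some (.const 3 0)
    · left
      have hf2 := fits_update_reg (r := r + 32) hf' (hz.trans hWW) (p + 2 * pc + 1)
      refine Reaches.step hf2 ?_
      rw [hs1 _ _ _ h3, hI]
      refine Reaches.refl (fits_update_reg hf2 (by simp) _) ⟨hpc1, update_shift _ _ hreg r z 0,
        fun x hx hx3 => ?_, hmem, hrest⟩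
      change Function.update (Function.update reg' (r + 32) z) 3 0 x = ρ x
      rw [Function.update_of_ne hx3, Function.update_of_ne (by omega), hown x hx hx3]
    · exact .inr h3
  have hval : ∀ r z m, P[pc].exec ⟨pc, reg, mem⟩ = ⟨pc + 1, Function.update reg r z, m⟩ → |z| ≤ W :=
    fun r z m hI => by
      rw [hI] at hf1
      simpa using hf1.1 r
  have hmul : ∀ r, |reg r * K| ≤ (W' : ℤ) := fun r => by
    rw [abs_mul, Nat.abs_cast]
    exact (mul_le_mul_of_nonneg_right (hf.1 r) (by positivity)).trans (by exact_mod_cast hW)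
  refine Reaches.step (T := 1) hf' ?_
  generalize hI : P[pc] = I at *
  cases I with
  | const r z =>
    rw [hs0 _ _ _ rfl]
    exact (assign (.const r z) r z rfl (hval _ _ _ rfl)).resolve_right fun h => h rfl
  | add r s t =>
    rw [hs0 _ _ _ rfl]
    simp only [Instr.exec, hreg]
    exact (assign (.add r s t) r _ rfl (hval _ _ _ rfl)).resolve_right fun h => h rfl
  | sub r s t =>
    rw [hs0 _ _ _ rfl]
    simp only [Instr.exec, hreg]
    exact (assign (.sub r s t) r _ rfl (hval _ _ _ rfl)).resolve_right fun h => h rfl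
  | mul r s t =>
    rw [hs0 _ _ _ rfl]
    simp only [Instr.exec, hreg]
    exact (assign (.mul r s t) r _ rfl (hval _ _ _ rfl)).resolve_right fun h => h rfl
  | div r s t =>
    rw [hs0 _ _ _ rfl]
    simp only [Instr.exec, hreg]
    exact (assign (.div r s t) r _ rfl (hval _ _ _ rfl)).resolve_right fun h => h rfl
  | load r s =>
    rw [hs0 _ _ _ rfl]
    simp only [Instr.exec, hreg, hown 2 (by norm_num) (by norm_num), hK]
    have hf2 := fits_update_reg (r := 3) hf' (hmul s) (p + 2 * pc + 1)
    refine Reaches.step (T := 0) hf2 ?_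
    rw [hs1 _ _ _ rfl]
    simp only [Instr.exec, Function.update_self, toNat_mul_natCast, hmem]
    refine Reaches.refl (fits_update_reg hf2 ((hf.2 _).trans hWW) _) ⟨hpc1, fun x => ?_, fun x hx hx3 => ?_,
      hmem, hrest⟩
    · change Function.update (Function.update reg' 3 _) (r + 32) _ (x + 32) = Function.update reg r _ x
      rw [Function.update_comm (by omega)]
      exact update_shift _ _ hreg _ _ _ _
    · change Function.update (Function.update reg' 3 _) (r + 32) _ x = ρ x
      rw [Function.update_of_ne (by omega), Function.update_of_ne hx3, hown x hx hx3]
  | store r s =>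
    rw [hs0 _ _ _ rfl]
    simp only [Instr.exec, hreg, hown 2 (by norm_num) (by norm_num), hK]
    have hf2 := fits_update_reg (r := 3) hf' (hmul r) (p + 2 * pc + 1)
    refine Reaches.step (T := 0) hf2 ?_
    rw [hs1 _ _ _ rfl]
    simp only [Instr.exec, Function.update_self, toNat_mul_natCast,
      Function.update_of_ne (show s + 32 ≠ 3 by omega), hreg]
    refine Reaches.refl (fits_update_mem hf2 ((hf.1 _).trans hWW) _) ⟨hpc1, fun x => ?_, fun x hx hx3 => ?_,
      fun a => ?_, fun a ha => ?_⟩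
    · change Function.update reg' 3 (reg r * K) (x + 32) = reg x
      rw [Function.update_of_ne (by omega), hreg]
    · change Function.update reg' 3 _ x = ρ x
      rw [Function.update_of_ne hx3, hown x hx hx3]
    · change Function.update mem' _ _ (a * K) = Function.update mem _ _ a
      by_cases ha : a = (reg r).toNat
      · rw [ha]; simp
      · rw [Function.update_of_ne ha, Function.update_of_ne (fun h => ha (Nat.eq_of_mul_eq_mul_right hK0 h)),
          hmem]
    · change Function.update mem' _ _ a = μ a
      rw [Function.update_of_ne (by rintro rfl; exact ha (Dvd.intro_left _ rfl)), hrest a ha]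
  | jumpPos r l =>
    rw [hs0 _ _ _ rfl]
    have hf2 := fits_update_reg (r := 3) (z := 0) hf' (by simp) (p + 2 * pc + 1)
    refine Reaches.step (T := 0) hf2 ?_
    simp only [Instr.exec]
    rw [hs1 _ _ _ rfl]
    simp only [Instr.exec, Function.update_of_ne (show r + 32 ≠ 3 by omega), hreg]
    refine Reaches.refl ⟨hf2.1, hf2.2⟩ ⟨?_, fun x => ?_, fun x hx hx3 => ?_, hmem, hrest⟩
    · simp only []
      split_ifs
      · rfl
      · exact hpc1
    · change Function.update reg' 3 0 (x + 32) = reg x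
      rw [Function.update_of_ne (by omega), hreg]
    · change Function.update reg' 3 _ x = ρ x
      rw [Function.update_of_ne hx3, hown x hx hx3]

theorem iterate_step_of_halted {P : Program} {c : Config} (h : Halted P c) (t : ℕ) : (step P)^[t] c = c := by
  refine Function.iterate_fixed ?_ t
  rw [step, List.getElem?_eq_none h]

theorem Simulates.reaches {P P' : Program} {K p W W' : ℕ} {ρ μ : ℕ → ℤ}
    (hP' : Placed P' p (simulate P p)) (hK : ρ 2 = K) (hK0 : 0 < K) (hW : W * K ≤ W') {t : ℕ} {c c' : Config}
    (h : Simulates K P.length p ρ μ c c') (hhalt : Halted P ((SumDirectAccess.step P)^[t] c))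
    (hf : ∀ u ≤ t, ((SumDirectAccess.step P)^[u] c).Fits W) (hf' : c'.Fits W') :
    Reaches P' W' (2 * t) c' fun c'' => Simulates K P.length p ρ μ ((SumDirectAccess.step P)^[t] c) c'' := by
  induction t generalizing c c' with
  | zero => exact Reaches.refl hf' h
  | succ t ih =>
    by_cases hc : c.pc < P.length
    · refine ((Simulates.step hP' hK hK0 hW h hc (hf 0 (Nat.zero_le _)) (hf 1 (by omega)) hf').trans
        fun c'' hf'' h'' => ih h'' hhalt (fun u hu => hf (u + 1) (by omega)) hf'').mono (by omega)
        fun _ h => h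
    · rw [iterate_step_of_halted (not_lt.1 hc)]
      exact Reaches.refl hf' h

/-- A simulated program takes twice its running time, with numbers that are larger by a factor `K`. It leaves
the registers below 32, except for register 3, and the memory cells that are not multiples of `K` intact. -/
theorem exec_simulate {P : Program} {T W W' K : ℕ} {c c' : Config} {ρ μ : ℕ → ℤ} (h : RunsTo P T W c c')
    (hpc : c.pc = 0) (hreg : ∀ r, ρ (r + 32) = c.reg r) (hmem : ∀ a, μ (a * K) = c.mem a)
    (hK : ρ 2 = K) (hK0 : 0 < K) (hW : W * K ≤ W') :
    Exec W' (2 * T) (simulate P) (fun ρ' μ' => (∀ r, ρ' (r + 32) = c'.reg r) ∧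
      (∀ r < 32, r ≠ 3 → ρ' r = ρ r) ∧ (∀ a, μ' (a * K) = c'.mem a) ∧ ∀ a, ¬ K ∣ a → μ' a = μ a) ρ μ := by
  obtain ⟨t, ht, rfl, hhalt, hf⟩ := h
  intro hf' P' p hP'
  have hs : Simulates K P.length p ρ μ c ⟨p, ρ, μ⟩ :=
    ⟨by simp [hpc], hreg, fun _ _ _ => rfl, hmem, fun _ _ => rfl⟩
  refine (hs.reaches hP' hK hK0 hW hhalt hf hf').mono (by omega) fun c'' h'' =>
    ⟨?_, h''.reg, h''.own, h''.mem, h''.rest⟩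
  rw [h''.pc, min_eq_right hhalt]
  exact congrArg (p + ·) (length_flatMap_simInstr _ _ _).symm

/-- A program changes only finitely many registers. -/
theorem exists_register_bound (P : Program) :
    ∃ R, ∀ (T W : ℕ) (c c' : Config), RunsTo P T W c c' → ∀ r ≥ R, c'.reg r = c.reg r := by
  have h1 : ∃ R, ∀ I ∈ P, ∀ (c : Config), ∀ r ≥ R, (I.exec c).reg r = c.reg r := by
    induction P with
    | nil => exact ⟨0, by simp⟩
    | cons I P ih =>
      obtain ⟨R, hR⟩ := ih
      have h0 : ∃ R, ∀ (c : Config), ∀ r ≥ R, (I.exec c).reg r = c.reg r := by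
        cases I with
        | store r s => exact ⟨0, fun _ _ _ => rfl⟩
        | jumpPos r l => exact ⟨0, fun _ _ _ => rfl⟩
        | const r _ => exact ⟨r + 1, fun c x hx => Function.update_of_ne (by omega) _ _⟩
        | add r _ _ => exact ⟨r + 1, fun c x hx => Function.update_of_ne (by omega) _ _⟩
        | sub r _ _ => exact ⟨r + 1, fun c x hx => Function.update_of_ne (by omega) _ _⟩
        | mul r _ _ => exact ⟨r + 1, fun c x hx => Function.update_of_ne (by omega) _ _⟩
        | div r _ _ => exact ⟨r + 1, fun c x hx => Function.update_of_ne (by omega) _ _⟩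
        | load r _ => exact ⟨r + 1, fun c x hx => Function.update_of_ne (by omega) _ _⟩
      obtain ⟨R', hR'⟩ := h0
      refine ⟨max R R', fun J hJ c r hr => ?_⟩
      rcases List.mem_cons.1 hJ with rfl | hJ
      · exact hR' c r (le_trans (le_max_right _ _) hr)
      · exact hR J hJ c r (le_trans (le_max_left _ _) hr)
  obtain ⟨R, hR⟩ := h1
  refine ⟨R, fun T W c c' h r hr => ?_⟩
  obtain ⟨t, -, rfl, -, -⟩ := h
  induction t generalizing c with
  | zero => rfl
  | succ t ih =>
    rw [Function.iterate_succ_apply, ih]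
    rw [step]
    cases h : P[c.pc]? with
    | none => rfl
    | some I => exact hR I (List.mem_of_getElem? h) c r hr

/-! ### Acyclic hypergraphs are conformal -/

/-- Acyclic hypergraphs are conformal: if any two vertices lie in a common edge, then some edge contains
all vertices. The property is carried backwards through a reduction: the unique edge of a vertex that is
deleted contains all its neighbours, i.e. all vertices, and an edge that is deleted can be replaced by the
larger one. -/
theorem HypergraphAcyclic.exists_edge_eq_vertexSet {V : Type} {H : Hypergraph V} (h : HypergraphAcyclic H)
    (hne : H.edgeSet.Nonempty)
    (hpair : ∀ x ∈ H.vertexSet, ∀ y ∈ H.vertexSet, ∃ e ∈ H.edgeSet, x ∈ e ∧ y ∈ e) :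
    ∃ e ∈ H.edgeSet, H.vertexSet ⊆ e := by
  obtain ⟨H', hr, h0⟩ := h
  induction hr using Relation.ReflTransGen.head_induction_on with
  | refl =>
    obtain ⟨e, he⟩ := hne
    exact ⟨e, he, by simp [h0]⟩
  | head hstep _ ih =>
    rename_i H H₁
    cases hstep with
    | vertex v hv honce hV hE =>
      obtain ⟨e, he, hve, -⟩ := hpair v hv v hv
      refine ⟨e, he, fun x hx => ?_⟩
      obtain ⟨f, hf, hvf, hxf⟩ := hpair v hv x hx
      rwa [honce e he f hf hve hvf]
    | edge e f he hf hef' hef hV hE =>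
      obtain ⟨g, hg, hsub⟩ := ih ⟨f, by rw [hE]; exact ⟨hf, fun h => hef' h.symm⟩⟩ (by
        rw [hV]
        intro x hx y hy
        obtain ⟨g, hg, hxg, hyg⟩ := hpair x hx y hy
        by_cases hge : g = e
        · subst hge
          exact ⟨f, by rw [hE]; exact ⟨hf, fun h => hef' h.symm⟩, hef hxg, hef hyg⟩
        · exact ⟨g, by rw [hE]; exact ⟨hg, hge⟩, hxg, hyg⟩)
      rw [hE] at hg
      exact ⟨g, hg.1, hV ▸ hsub⟩

/-- An acyclic query without an atom that contains all variables has two variables without a common atom. -/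
theorem JoinQuery.Acyclic.exists_pair {q : JoinQuery} (h : q.Acyclic)
    (hfull : ¬ ∃ i : Fin q.numAtoms, ∀ x : Fin q.numVars, x ∈ q.scope i) :
    ∃ x y : Fin q.numVars, x ≠ y ∧ ∀ i, x ∈ q.scope i → y ∉ q.scope i := by
  by_contra! hcon
  refine hfull ?_
  obtain ⟨e, ⟨i, rfl⟩, hi⟩ := h.exists_edge_eq_vertexSet ⟨_, ⟨⟨0, q.numAtoms_pos⟩, rfl⟩⟩ fun x _ y _ => by
    by_cases hxy : x = y
    · subst hxy
      obtain ⟨i, j, hj⟩ := q.var_occurs x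
      exact ⟨_, ⟨i, rfl⟩, ⟨j, hj⟩, ⟨j, hj⟩⟩
    · obtain ⟨i, hx, hy⟩ := hcon x y hxy
      exact ⟨_, ⟨i, rfl⟩, hx, hy⟩
  exact ⟨i, fun x => hi (Set.mem_univ x)⟩

/-! ### A database whose answers are the pairs of two lists -/

namespace JoinQuery

variable (q : JoinQuery)

/-- The variable in the `j`-th column of the symbol `R`, in some atom with this symbol. -/
noncomputable def colVar (R : Fin q.numSyms) (j : Fin (q.arity R)) : Fin q.numVars :=
  q.args (Function.surjInv q.sym_surjective R)
    (Fin.cast (congrArg q.arity (Function.surjInv_eq q.sym_surjective R).symm) j)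

variable {q}

theorem SelfJoinFree.colVar_sym (h : q.SelfJoinFree) (i : Fin q.numAtoms) (j : Fin (q.arity (q.sym i))) :
    q.colVar (q.sym i) j = q.args i j := by
  have key : ∀ i' (hi' : q.sym i' = q.sym i), i' = i →
      q.args i' (Fin.cast (congrArg q.arity hi'.symm) j) = q.args i j := by
    rintro i' hi' rfl
    rfl
  exact key _ (Function.surjInv_eq q.sym_surjective _) (h (Function.surjInv_eq q.sym_surjective _))

end JoinQuery

section PairDatabase

variable {q : JoinQuery} (x y : Fin q.numVars) {n : ℕ}

/-- The element of the domain `{0, …, 2 n - 1}` that a variable takes for the index `i`: one of the first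
`n` elements for `x`, one of the last `n` for `y`, and the constant `0` for all other variables. -/
def pairElem (hn : 0 < n) (v : Fin q.numVars) (i : Fin n) : Fin (n + n) :=
  if v = x then Fin.castAdd n i else if v = y then Fin.natAdd n i else Fin.castAdd n ⟨0, hn⟩

open Classical in
/-- The number of tuples in the relation `R`: `n` if `x` or `y` is among its columns, and otherwise 1. -/
noncomputable def pairLen (n : ℕ) (R : Fin q.numSyms) : ℕ :=
  if ∃ j, q.colVar R j = x ∨ q.colVar R j = y then n else 1

theorem pairLen_le (hn : 0 < n) (R : Fin q.numSyms) : pairLen x y n R ≤ n := by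
  unfold pairLen; split_ifs <;> omega

/-- The relation `R` of the database whose answers are the pairs of indices. -/
noncomputable def pairRel (hn : 0 < n) (R : Fin q.numSyms) : List (Fin (q.arity R) → Fin (n + n)) :=
  List.ofFn fun (i : Fin (pairLen x y n R)) j =>
    pairElem x y hn (q.colVar R j) ⟨i, i.2.trans_le (pairLen_le x y hn R)⟩

variable {x y}

theorem pairElem_left (hn : 0 < n) (i : Fin n) : pairElem x y hn x i = Fin.castAdd n i := by
  simp [pairElem]

theorem pairElem_right (hxy : x ≠ y) (hn : 0 < n) (i : Fin n) :
    pairElem x y hn y i = Fin.natAdd n i := by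
  simp [pairElem, hxy.symm]

/-- In terms of an atom, the relation consists of one tuple for each index; if neither `x` nor `y` is in
the atom, these tuples coincide. -/
theorem mem_pairRel (hsjf : q.SelfJoinFree) (hn : 0 < n) {i : Fin q.numAtoms}
    {t : Fin (q.arity (q.sym i)) → Fin (n + n)} :
    t ∈ pairRel x y hn (q.sym i) ↔ ∃ k, ∀ j, t j = pairElem x y hn (q.args i j) k := by
  rw [pairRel, List.mem_ofFn]
  constructor
  · rintro ⟨k, rfl⟩
    exact ⟨⟨k, k.2.trans_le (pairLen_le x y hn _)⟩, fun j => by simp only [hsjf.colVar_sym]⟩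
  · rintro ⟨k, hk⟩
    by_cases h : ∃ j, q.colVar (q.sym i) j = x ∨ q.colVar (q.sym i) j = y
    · refine ⟨⟨k, by rw [pairLen, if_pos h]; exact k.2⟩, ?_⟩
      funext j
      rw [hk, hsjf.colVar_sym]
    · refine ⟨⟨0, by rw [pairLen, if_neg h]; exact one_pos⟩, ?_⟩
      funext j
      rw [hk, hsjf.colVar_sym]
      push Not at h
      have := h j
      rw [hsjf.colVar_sym] at this
      simp [pairElem, this]

/-- The database over the domain `{0, …, 2 n - 1}` in which `x` and `y` range independently over the first
and the last `n` elements, and all other variables are constant. -/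
noncomputable def pairDatabase (hsjf : q.SelfJoinFree) (hxy : x ≠ y) (hn : 0 < n) : Database q where
  domSize := n + n
  rel := pairRel x y hn
  rel_nodup R := by
    refine List.nodup_ofFn.2 fun i i' h => ?_
    by_cases hR : ∃ j, q.colVar R j = x ∨ q.colVar R j = y
    · obtain ⟨j, hj | hj⟩ := hR
      · have := congrFun h j
        simp only [hj, pairElem_left] at this
        simpa [Fin.ext_iff] using this
      · have := congrFun h j
        simp only [hj, pairElem_right hxy] at this
        simpa [Fin.ext_iff] using this
    · have h1 := i.2
      have h2 := i'.2
      have h3 : pairLen x y n R = 1 := if_neg hR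
      exact Fin.ext (by omega)
  dom_active a := by
    induction a using Fin.addCases with
    | left a =>
      obtain ⟨i, j, hj⟩ := q.var_occurs x
      exact ⟨q.sym i, _, (mem_pairRel hsjf hn).2 ⟨a, fun _ => rfl⟩, j, by simp only [hj, pairElem_left]⟩
    | right a =>
      obtain ⟨i, j, hj⟩ := q.var_occurs y
      exact ⟨q.sym i, _, (mem_pairRel hsjf hn).2 ⟨a, fun _ => rfl⟩, j,
        by simp only [hj, pairElem_right hxy]⟩

/-- The answer for a pair of indices. -/
def pairAnswer (x y : Fin q.numVars) (hn : 0 < n) (i j : Fin n) : Fin q.numVars → Fin (n + n) :=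
  fun v => pairElem x y hn v (if v = x then i else j)

/-- The indices of `x` and `y` are chosen independently because no atom contains both variables. -/
theorem mem_answers_pairDatabase (hsjf : q.SelfJoinFree) (hxy : x ≠ y)
    (hno : ∀ i, x ∈ q.scope i → y ∉ q.scope i) (hn : 0 < n) {s : Fin q.numVars → Fin (n + n)} :
    s ∈ (pairDatabase hsjf hxy hn).answers ↔ ∃ i j, s = pairAnswer x y hn i j := by
  change (∀ i, (fun j => s (q.args i j)) ∈ pairRel x y hn (q.sym i)) ↔ _
  simp only [mem_pairRel hsjf hn]
  constructor
  · intro h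
    choose f hf using h
    obtain ⟨ix, jx, hx⟩ := q.var_occurs x
    obtain ⟨iy, jy, hy⟩ := q.var_occurs y
    refine ⟨f ix, f iy, funext fun v => ?_⟩
    by_cases hvx : v = x
    · subst hvx
      rw [← hx, hf, hx]
      simp [pairAnswer]
    · by_cases hvy : v = y
      · subst hvy
        rw [← hy, hf, hy]
        simp [pairAnswer, hvx]
      · obtain ⟨i, j, hj⟩ := q.var_occurs v
        rw [← hj, hf, hj]
        simp [pairAnswer, pairElem, hvx, hvy]
  · rintro ⟨i, j, rfl⟩ k
    by_cases hx : x ∈ q.scope k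
    · refine ⟨i, fun l => ?_⟩
      have hl : q.args k l ≠ y := fun h => hno k hx ⟨l, h⟩
      simp only [pairAnswer, pairElem, hl, if_false]
      split_ifs <;> rfl
    · refine ⟨j, fun l => ?_⟩
      have hl : q.args k l ≠ x := fun h => hx ⟨l, h⟩
      simp only [pairAnswer, hl, if_false]

theorem pairAnswer_left (hn : 0 < n) (i j : Fin n) : pairAnswer x y hn i j x = Fin.castAdd n i := by
  simp [pairAnswer, pairElem]

theorem pairAnswer_right (hxy : x ≠ y) (hn : 0 < n) (i j : Fin n) :
    pairAnswer x y hn i j y = Fin.natAdd n j := by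
  simp [pairAnswer, pairElem, hxy.symm]

/-- Up to a constant, the weight of an answer is the weight of the values of `x` and `y`. -/
theorem weight_pairAnswer (hsjf : q.SelfJoinFree) (hxy : x ≠ y) (hn : 0 < n) (A B : Fin n → ℤ) :
    ∃ z, ∀ i j, (pairDatabase hsjf hxy hn).weight (Fin.append A B) (pairAnswer x y hn i j) =
      A i + B j + z := by
  refine ⟨∑ v ∈ (Finset.univ.erase x).erase y, A ⟨0, hn⟩, fun i j => ?_⟩
  unfold Database.weight
  rw [← Finset.add_sum_erase _ _ (Finset.mem_univ x), ← Finset.add_sum_erase (Finset.univ.erase x) _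
    (Finset.mem_erase.2 ⟨hxy.symm, Finset.mem_univ y⟩), ← add_assoc]
  congr 1
  · congr 1
    · exact (congrArg _ (pairAnswer_left hn i j)).trans (Fin.append_left _ _ _)
    · exact (congrArg _ (pairAnswer_right hxy hn i j)).trans (Fin.append_right _ _ _)
  · refine Finset.sum_congr rfl fun v hv => ?_
    simp only [Finset.mem_erase] at hv
    have : pairAnswer x y hn i j v = Fin.castAdd n ⟨0, hn⟩ := by simp [pairAnswer, pairElem, hv.1, hv.2.1]
    exact (congrArg _ this).trans (Fin.append_left _ _ _)

/-- A list of the answers in sum order gives the pairwise sums of `A` and `B` in sorted order. -/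
theorem Database.IsSumOrdered.pairSums (hsjf : q.SelfJoinFree) (hxy : x ≠ y)
    (hno : ∀ i, x ∈ q.scope i → y ∉ q.scope i) (hn : 0 < n) (A B : Fin n → ℤ)
    {L : List (Fin q.numVars → Fin (n + n))}
    (hL : (pairDatabase hsjf hxy hn).IsSumOrdered (Fin.append A B) L) :
    ∃ I J : ℕ → Fin n, (∀ p < n * n, L[p]? = some (pairAnswer x y hn (I p) (J p))) ∧
      (∀ p p', p ≤ p' → p' < n * n → A (I p) + B (J p) ≤ A (I p') + B (J p')) ∧
      ∀ i j, ∃ p < n * n, I p = i ∧ J p = j := by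
  obtain ⟨hnd, hmem, hsort⟩ := hL
  -- the domain size unfolds to `n + n`
  let wt : (Fin q.numVars → Fin (n + n)) → ℤ := (pairDatabase hsjf hxy hn).weight (Fin.append A B)
  replace hnd : List.Nodup (α := Fin q.numVars → Fin (n + n)) L := hnd
  replace hsort : List.Pairwise (α := Fin q.numVars → Fin (n + n)) (fun s t => wt s ≤ wt t) L := hsort
  have hmem' : ∀ s, s ∈ L ↔ ∃ i j, s = pairAnswer x y hn i j := fun s =>
    (hmem s).trans (mem_answers_pairDatabase hsjf hxy hno hn)
  have hinj : ∀ i j i' j', pairAnswer x y hn i j = pairAnswer x y hn i' j' → i = i' ∧ j = j' := by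
    intro i j i' j' h
    have h1 := congrFun h x
    have h2 := congrFun h y
    rw [pairAnswer_left, pairAnswer_left] at h1
    rw [pairAnswer_right hxy, pairAnswer_right hxy] at h2
    exact ⟨Fin.castAdd_injective _ _ h1, Fin.natAdd_injective _ _ h2⟩
  have hlen : L.length = n * n := by
    classical
    rw [← List.toFinset_card_of_nodup hnd]
    have : L.toFinset = Finset.univ.image fun p : Fin n × Fin n => pairAnswer x y hn p.1 p.2 := by
      ext s
      simp only [List.mem_toFinset, hmem', Finset.mem_image, Finset.mem_univ, true_and, Prod.exists]
      exact ⟨fun ⟨i, j, h⟩ => ⟨i, j, h.symm⟩, fun ⟨i, j, h⟩ => ⟨i, j, h.symm⟩⟩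
    rw [this, Finset.card_image_of_injective]
    · simp
    · rintro ⟨i, j⟩ ⟨i', j'⟩ h
      obtain ⟨rfl, rfl⟩ := hinj _ _ _ _ h
      rfl
  have hex : ∀ p, ∃ i j, p < n * n → L[p]? = some (pairAnswer x y hn i j) := fun p => by
    by_cases hp : p < n * n
    · have hp' : p < L.length := hlen ▸ hp
      obtain ⟨i, j, h⟩ := (hmem' _).1 (List.getElem_mem hp')
      exact ⟨i, j, fun _ => by rw [List.getElem?_eq_getElem hp', h]⟩
    · exact ⟨⟨0, hn⟩, ⟨0, hn⟩, fun h => absurd h hp⟩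
  choose I J hIJ using hex
  obtain ⟨z, hz⟩ := weight_pairAnswer hsjf hxy hn A B
  replace hz : ∀ i j, wt (pairAnswer x y hn i j) = A i + B j + z := hz
  refine ⟨I, J, hIJ, fun p p' hpp hp' => ?_, fun i j => ?_⟩
  · rcases hpp.eq_or_lt with rfl | hlt
    · exact le_rfl
    have hp1 : p < L.length := by omega
    have hp2 : p' < L.length := by omega
    have := List.pairwise_iff_getElem.1 hsort p p' hp1 hp2 hlt
    have h1 := hIJ p (by omega)
    have h2 := hIJ p' hp'
    rw [List.getElem?_eq_getElem hp1, Option.some_inj] at h1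
    rw [List.getElem?_eq_getElem hp2, Option.some_inj] at h2
    rw [h1, h2, hz, hz] at this
    linarith
  · obtain ⟨p, hp, h⟩ := List.getElem_of_mem ((hmem' _).2 ⟨i, j, rfl⟩)
    have h1 := hIJ p (by omega)
    rw [List.getElem?_eq_getElem hp, Option.some_inj, h] at h1
    obtain ⟨h1, h2⟩ := hinj _ _ _ _ h1
    exact ⟨p, by omega, h1.symm, h2.symm⟩

open Classical in
/-- The size is linear in the number of indices: `α` relations have `n` tuples, and `β` have one. -/
theorem size_pairDatabase (hsjf : q.SelfJoinFree) (hxy : x ≠ y) :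
    ∃ α β, 0 < α ∧ ∀ n (hn : 0 < n), (pairDatabase hsjf hxy hn).size = α * n + β := by
  refine ⟨(Finset.univ.filter fun R => ∃ j, q.colVar R j = x ∨ q.colVar R j = y).card,
    (Finset.univ.filter fun R => ¬ ∃ j, q.colVar R j = x ∨ q.colVar R j = y).card, ?_, fun n hn => ?_⟩
  · obtain ⟨i, j, hj⟩ := q.var_occurs x
    exact Finset.card_pos.2 ⟨q.sym i, Finset.mem_filter.2 ⟨Finset.mem_univ _, j,
      .inl ((hsjf.colVar_sym i j).trans hj)⟩⟩
  · have : (pairDatabase hsjf hxy hn).size = ∑ R, pairLen x y n R := by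
      simp [Database.size, pairDatabase, pairRel]
    rw [this]
    simp only [pairLen, Finset.sum_ite, Finset.sum_const, smul_eq_mul, mul_one]

end PairDatabase

/-! ### Writing the database for a pair of lists -/

/-- The fragments `F a` for the entries `a` of a list, one after the other. -/
def seqList {α : Type} (F : α → Fragment) : List α → Fragment
  | [] => ops []
  | a :: l => F a ;; seqList F l

/-- The rule for sequences in which `F a` appends `out a` to a list of total length at most `M`. -/
theorem Exec.seqList {α : Type} {W T M : ℕ} {F : α → Fragment} {out : α → List ℤ}
    (I : List ℤ → Assertion) {l : List α}
    (h : ∀ a ∈ l, ∀ pre ρ μ, pre.length + (out a).length ≤ M → I pre ρ μ →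
      Exec W T (F a) (I (pre ++ out a)) ρ μ) {pre : List ℤ}
    (hM : pre.length + (l.flatMap out).length ≤ M) {ρ μ : ℕ → ℤ} (h0 : I pre ρ μ) :
    Exec W (l.length * T) (seqList F l) (I (pre ++ l.flatMap out)) ρ μ := by
  induction l generalizing pre ρ μ with
  | nil => exact (Exec.ops (l := []) (by simpa [OpsPre] using h0)).mono (by simp) fun _ _ h => h
  | cons a l ih =>
    rw [List.flatMap_cons, List.length_append] at hM
    refine (Exec.seq (T₂ := l.length * T) ((h a (by simp) pre ρ μ (by omega) h0).mono le_rfl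
      fun ρ' μ' h' => ?_)).mono (by rw [List.length_cons]; ring_nf; omega) fun _ _ h => h
    have := ih (fun b hb => h b (List.mem_cons_of_mem _ hb))
      (by rw [List.length_append]; omega) h'
    rwa [List.append_assoc, ← List.flatMap_cons] at this

/-- The list `l` has been written to the memory cells whose address is a multiple of `K`, with register 4
pointing behind it. The other cells are as in `μ₀`, register 1 holds `n`, register 2 holds `K`, and the
registers of a program that is to be simulated are still blank. -/
structure Emitted (K n : ℕ) (μ₀ : ℕ → ℤ) (l : List ℤ) (ρ μ : ℕ → ℤ) : Prop where
  reg_n : ρ 1 = n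
  reg_K : ρ 2 = K
  ptr : ρ 4 = ((l.length * K : ℕ) : ℤ)
  blank : ∀ r, 32 ≤ r → ρ r = 0
  view : ∀ a, μ (a * K) = l.getD a 0
  rest : ∀ a, ¬ K ∣ a → μ a = μ₀ a

section

variable {K n W : ℕ} {μ₀ : ℕ → ℤ} {l : List ℤ} {ρ μ : ℕ → ℤ}

theorem Emitted.congr (h : Emitted K n μ₀ l ρ μ) {ρ' : ℕ → ℤ} (h1 : ρ' 1 = ρ 1) (h2 : ρ' 2 = ρ 2)
    (h4 : ρ' 4 = ρ 4) (h32 : ∀ r, 32 ≤ r → ρ' r = ρ r) : Emitted K n μ₀ l ρ' μ :=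
  ⟨h1.trans h.reg_n, h2.trans h.reg_K, h4.trans h.ptr, fun r hr => (h32 r hr).trans (h.blank r hr), h.view,
    h.rest⟩

theorem getD_append_singleton (l : List ℤ) (z : ℤ) (a : ℕ) :
    (l ++ [z]).getD a 0 = Function.update (fun a => l.getD a 0) l.length z a := by
  rcases lt_trichotomy a l.length with h | rfl | h
  · rw [Function.update_of_ne h.ne, List.getD_append _ _ _ _ h]
  · simp
  · rw [Function.update_of_ne h.ne', List.getD_eq_default _ _ (by simp; omega),
      List.getD_eq_default _ _ (by omega)]

/-- Storing a value at the pointer and moving the pointer on appends the value to the output. -/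
theorem Emitted.push (h : Emitted K n μ₀ l ρ μ) (hK : 0 < K) {ρ' : ℕ → ℤ} {z : ℤ} (h1 : ρ' 1 = ρ 1)
    (h2 : ρ' 2 = ρ 2) (h4 : ρ' 4 = ρ 4 + K) (h32 : ∀ r, 32 ≤ r → ρ' r = ρ r) :
    Emitted K n μ₀ (l ++ [z]) ρ' (Function.update μ (l.length * K) z) := by
  refine ⟨h1.trans h.reg_n, h2.trans h.reg_K, ?_, fun r hr => (h32 r hr).trans (h.blank r hr),
    fun a => ?_, fun a ha => ?_⟩
  · rw [h4, h.ptr, List.length_append, List.length_singleton]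
    push_cast; ring
  · rw [getD_append_singleton]
    by_cases ha : a = l.length
    · subst ha; simp
    · rw [Function.update_of_ne ha,
        Function.update_of_ne fun h => ha (Nat.eq_of_mul_eq_mul_right hK h), h.view]
  · rw [Function.update_of_ne (by rintro rfl; exact ha (Dvd.intro_left _ rfl)), h.rest a ha]

/-- Append the entry `a * n + b * i` to the output, for the index `i` in register 6. -/
def emitEntry (a b : ℕ) : Fragment :=
  ops [.const 9 b, .mul 9 9 6, .const 12 a, .mul 12 12 1, .add 9 9 12, .store 4 9, .add 4 4 2]

theorem exec_emitEntry {M a b i N : ℕ} (hK : 0 < K) (ha : a ≤ 1) (hb : b ≤ 1) (hi : i < n)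
    (hW : M * K + 2 * n + 1 ≤ W)
    (hl : l.length + 1 ≤ M) (h : Emitted K n μ₀ l ρ μ) (h6 : ρ 6 = i) (h10 : ρ 10 = (N : ℤ)) :
    Exec W 7 (emitEntry a b) (fun ρ' μ' => Emitted K n μ₀ (l ++ [((a * n + b * i : ℕ) : ℤ)]) ρ' μ' ∧
      ρ' 6 = i ∧ ρ' 10 = (N : ℤ)) ρ μ := by
  have hptr : l.length * K + K ≤ M * K := by
    rw [← Nat.succ_mul]; exact Nat.mul_le_mul_right _ hl
  have h1 : b * i ≤ 1 * i := Nat.mul_le_mul_right _ hb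
  have h2 : a * n ≤ 1 * n := Nat.mul_le_mul_right _ ha
  refine Exec.block (by simp) ?_
  simp only [OpsPre, Function.update_apply, Nat.reduceEqDiff, if_true, if_false, h.reg_n, h.reg_K, h.ptr,
    h6, h10, Int.toNat_natCast, ← Nat.cast_mul, ← Nat.cast_add, Nat.abs_cast, Nat.cast_le]
  refine ⟨by omega, by omega, by omega, by omega, by omega, by omega, ?_, trivial, trivial⟩
  rw [show b * i + a * n = a * n + b * i from add_comm _ _]
  refine h.push hK (by simp) (by simp) (by simp [h.ptr]) fun r hr => ?_
  simp only [Function.update_apply]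
  repeat rw [if_neg (by omega)]

/-- The code of a relation with `c * n + d` tuples whose `i`-th tuple has the entries `p.1 * n + p.2 * i`
for `p` in a list. -/
def relationCode (n c d : ℕ) (cols : List (ℕ × ℕ)) : List ℤ :=
  ((c * n + d : ℕ) : ℤ) ::
    (List.range (c * n + d)).flatMap fun i => cols.flatMap fun p => [((p.1 * n + p.2 * i : ℕ) : ℤ)]

/-- Append the code of a relation to the output. -/
def emitRelation (c d : ℕ) (cols : List (ℕ × ℕ)) : Fragment :=
  ops [.const 10 c, .mul 10 10 1, .const 9 d, .add 10 10 9, .store 4 10, .add 4 4 2] ;;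
    forLoop 6 10 8 (seqList (fun p => emitEntry p.1 p.2) cols)

theorem exec_emitRelation {M c d w : ℕ} {cols : List (ℕ × ℕ)} (hK : 0 < K) (hc : c ≤ 1) (hd : d ≤ 1)
    (hlen : c * n + d ≤ n) (hcols : ∀ p ∈ cols, p.1 ≤ 1 ∧ p.2 ≤ 1) (hw : cols.length ≤ w)
    (hW : M * K + 2 * n + 1 ≤ W) (hl : l.length + (relationCode n c d cols).length ≤ M)
    (h : Emitted K n μ₀ l ρ μ) :
    Exec W (10 + n * (w * 7 + 4)) (emitRelation c d cols)
      (Emitted K n μ₀ (l ++ relationCode n c d cols)) ρ μ := by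
  generalize hN : c * n + d = N at *
  let body : ℕ → List ℤ := fun i => cols.flatMap fun p => [((p.1 * n + p.2 * i : ℕ) : ℤ)]
  have hcode : relationCode n c d cols = [(N : ℤ)] ++ (List.range N).flatMap body := by
    rw [relationCode, hN]; rfl
  have hpre : ∀ k < N, l.length + 1 + ((List.range k).flatMap body).length + (body k).length ≤ M := by
    intro k hk
    have h1 : ((List.range (k + 1)).flatMap body).length ≤ ((List.range N).flatMap body).length :=
      ((List.range_sublist.2 hk).flatMap body).length_le
    rw [List.range_succ, List.flatMap_append, List.length_append] at h1
    simp only [List.flatMap_cons, List.flatMap_nil, List.append_nil] at h1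
    rw [hcode, List.length_append, List.length_singleton] at hl
    omega
  have hl1 : l.length + 1 ≤ M := by
    rw [hcode, List.length_append, List.length_singleton] at hl; omega
  have hptr : l.length * K + K ≤ M * K := by
    rw [← Nat.succ_mul]; exact Nat.mul_le_mul_right _ hl1
  refine (Exec.ops_seq (T := 4 + N * (cols.length * 7 + 4)) ?_).mono ?_ fun _ _ h => h
  swap
  · have : N * (cols.length * 7 + 4) ≤ n * (w * 7 + 4) := Nat.mul_le_mul hlen (by omega)
    simp only [List.length_cons, List.length_nil]
    omega
  have hcn : c * n ≤ N := by omega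
  simp only [OpsPre, Function.update_apply, Nat.reduceEqDiff, if_true, if_false, h.reg_n, h.reg_K, h.ptr,
    Int.toNat_natCast, ← Nat.cast_mul, ← Nat.cast_add, Nat.abs_cast, Nat.cast_le, hN]
  refine ⟨by omega, by omega, by omega, by omega, by omega, ?_⟩
  refine Exec.forLoop N (fun k => Emitted K n μ₀ (l ++ [(N : ℤ)] ++ (List.range k).flatMap body))
    (by norm_num) (by norm_num) (by norm_num) (by omega) (by simp) ?_ ?_ ?_ ?_
  · intro k ρ μ x y hk
    refine hk.congr (by simp) (by simp) (by simp) fun r hr => ?_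
    rw [Function.update_of_ne (by omega), Function.update_of_ne (by omega)]
  · rw [List.range_zero, List.flatMap_nil, List.append_nil]
    refine h.push hK (by simp) (by simp) (by simp [h.ptr]) fun r hr => ?_
    simp only [Function.update_apply]
    repeat rw [if_neg (by omega)]
  · intro k hk ρ μ hI h6 h10
    refine (Exec.seqList (M := M) (out := fun p => [((p.1 * n + p.2 * k : ℕ) : ℤ)])
      (fun l' ρ' μ' => Emitted K n μ₀ l' ρ' μ' ∧ ρ' 6 = k ∧ ρ' 10 = (N : ℤ)) ?_ ?_
      ⟨hI, h6, h10⟩).mono le_rfl ?_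
    · rintro ⟨a, b⟩ hab pre ρ μ hpre ⟨hI, h6, h10⟩
      exact exec_emitEntry hK (hcols _ hab).1 (hcols _ hab).2 (by omega) hW hpre hI h6 h10
    · have := hpre k hk
      simp only [List.length_append, List.length_singleton]
      exact this
    · rintro ρ' μ' ⟨hE, h6, h10⟩
      refine ⟨h6, h10, ?_⟩
      rw [List.range_succ, List.flatMap_append]
      simp only [List.flatMap_cons, List.flatMap_nil, List.append_nil, ← List.append_assoc] at hE ⊢
      exact hE
  · intro ρ μ hI _
    rwa [hcode, ← List.append_assoc]

/-- Write a database code: the number `2 * n`, the cells `1, …, 2 * n`, and the codes of some relations,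
where `n` is in register 1. The memory cells used are the multiples of `K = 3 * n + 1`, which is computed into
register 2: the cells `1, …, 3 * n` with the input of 3SUM are not among them. -/
def emitDatabase (rels : List (ℕ × ℕ × List (ℕ × ℕ))) : Fragment :=
  ops [.const 5 1, .const 2 3, .mul 2 2 1, .add 2 2 5, .const 4 0, .add 7 1 1, .store 4 7, .add 4 4 2] ;;
    forLoop 6 7 8 (ops [.const 5 1, .add 9 6 5, .load 9 9, .store 4 9, .add 4 4 2]) ;;
      seqList (fun R => emitRelation R.1 R.2.1 R.2.2) rels

/-- The code that `emitDatabase` writes, where `rels` has the numbers of tuples and the columns of the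
relations as in `relationCode`. -/
def databaseCode (n : ℕ) (μ₀ : ℕ → ℤ) (rels : List (ℕ × ℕ × List (ℕ × ℕ))) : List ℤ :=
  ((2 * n : ℕ) : ℤ) :: ((List.range (2 * n)).map fun i => μ₀ (1 + i)) ++
    rels.flatMap fun R => relationCode n R.1 R.2.1 R.2.2

theorem exec_emitDatabase {w : ℕ} {rels : List (ℕ × ℕ × List (ℕ × ℕ))} (hn : 0 < n)
    (hrels : ∀ R ∈ rels, R.1 ≤ 1 ∧ R.2.1 ≤ 1 ∧ R.1 * n + R.2.1 ≤ n ∧ (∀ p ∈ R.2.2, p.1 ≤ 1 ∧ p.2 ≤ 1) ∧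
      R.2.2.length ≤ w)
    (hW : (databaseCode n μ₀ rels).length * (3 * n + 1) + 2 * n + 2 ≤ W)
    (hblank : ∀ r, r ≠ 1 → r ≠ 5 → ρ r = 0) (h1 : ρ 1 = n) (hμ : ∀ a, 3 * n < a → μ₀ a = 0) :
    Exec W (12 + 18 * n + rels.length * (10 + n * (w * 7 + 4))) (emitDatabase rels)
      (Emitted (3 * n + 1) n μ₀ (databaseCode n μ₀ rels)) ρ μ₀ := by
  set M := (databaseCode n μ₀ rels).length with hM
  have hM' : M = 1 + 2 * n + (rels.flatMap fun R => relationCode n R.1 R.2.1 R.2.2).length := by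
    simp [hM, databaseCode]; omega
  have hMK : (1 + 2 * n) * (3 * n + 1) ≤ M * (3 * n + 1) := Nat.mul_le_mul_right _ (by omega)
  have hMK' : (1 + 2 * n) * (3 * n + 1) = 3 * n + 1 + 2 * n * (3 * n + 1) := by ring
  refine (Exec.ops_seq (T := 4 + 2 * n * (5 + 4) + rels.length * (10 + n * (w * 7 + 4))) ?_).mono
    (by simp only [List.length_cons, List.length_nil]; omega) fun _ _ h => h
  simp only [OpsPre, Function.update_apply, Nat.reduceEqDiff, if_true, if_false, h1, abs_le]
  refine ⟨by omega, by omega, by omega, by omega, by omega, by omega, by omega, ?_⟩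
  refine Exec.seq (Exec.forLoop (2 * n) (fun k => Emitted (3 * n + 1) n μ₀
    (((2 * n : ℕ) : ℤ) :: (List.range k).map fun i => μ₀ (1 + i))) (by norm_num) (by norm_num) (by norm_num)
    (by omega) (by simp; ring) ?_ ?_ ?_ ?_)
  · intro k ρ μ x y hk
    refine hk.congr (by simp) (by simp) (by simp) fun r hr => ?_
    rw [Function.update_of_ne (by omega), Function.update_of_ne (by omega)]
  · refine ⟨by simp [h1], by simp, by simp, fun r hr => ?_, fun a => ?_, fun a ha => ?_⟩
    · simp only [Function.update_apply]
      repeat rw [if_neg (by omega)]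
      exact hblank r (by omega) (by omega)
    · cases a with
      | zero => simp; ring
      | succ a =>
        have : (a + 1) * (3 * n + 1) = a * (3 * n + 1) + (3 * n + 1) := by ring
        rw [Function.update_of_ne (by simp), hμ _ (by omega)]
        simp
    · rw [Function.update_of_ne (by rintro rfl; exact ha (dvd_zero _))]
  · intro k hk ρ μ hI h6 h7
    have hptr : (k + 1) * (3 * n + 1) + (3 * n + 1) ≤ M * (3 * n + 1) := by
      rw [← Nat.succ_mul]; exact Nat.mul_le_mul_right _ (by omega)
    have hlen := hI.ptr
    simp only [List.length_cons, List.length_map, List.length_range] at hlen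
    have hval : μ (1 + k) = μ₀ (1 + k) :=
      hI.rest _ (Nat.not_dvd_of_pos_of_lt (by omega) (by omega))
    refine Exec.block (by simp) ?_
    have hk1 : ((k : ℤ) + 1).toNat = 1 + k := by omega
    simp only [OpsPre, Function.update_apply, Nat.reduceEqDiff, if_true, if_false, hI.reg_K, hlen,
      h6, h7, Int.toNat_natCast, hk1, hval]
    refine ⟨by norm_num; omega, by rw [abs_le]; omega, ?_, trivial, trivial, ?_⟩
    · rw [← Nat.cast_add, Nat.abs_cast]; exact_mod_cast (by omega : (k + 1) * (3 * n + 1) + (3 * n + 1) ≤ W)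
    · rw [List.range_succ, List.map_append, ← List.cons_append]
      have := hI.push (z := μ₀ (1 + k)) (ρ' := fun r => if r = 4 then ρ 4 + ((3 * n + 1 : ℕ) : ℤ) else
        if r = 9 then μ₀ (1 + k) else if r = 5 then 1 else ρ r) (by omega) (by simp) (by simp) (by simp)
        (fun r hr => by repeat rw [if_neg (by omega)])
      simp only [List.length_cons, List.length_map, List.length_range] at this
      refine this.congr (by simp) (by simp) (by simp [hlen]) fun r hr => ?_
      simp only [Function.update_apply]
      repeat rw [if_neg (by omega)]
  · intro ρ μ hI _
    refine Exec.seqList (M := M) (out := fun R : ℕ × ℕ × List (ℕ × ℕ) => relationCode n R.1 R.2.1 R.2.2)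
      (Emitted (3 * n + 1) n μ₀) ?_
      (by simp only [List.length_cons, List.length_map, List.length_range]; omega) hI
    intro R hR pre ρ μ hpre hE
    obtain ⟨hc, hd, hlen, hcols, hw⟩ := hrels R hR
    exact exec_emitRelation (by omega) hc hd hlen hcols hw (by omega) hpre hE

end

section

variable {q : JoinQuery} (x y : Fin q.numVars)

/-- The entry of a variable in the tuple for the index `i` is `p.1 * n + p.2 * i`, with these `p`. -/
def pairColumn (v : Fin q.numVars) : ℕ × ℕ := if v = x then (0, 1) else if v = y then (1, 1) else (0, 0)

open Classical in
/-- The numbers that determine the relations of the database whose answers are the pairs of indices. They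
do not depend on the number of indices. -/
noncomputable def pairRelations : List (ℕ × ℕ × List (ℕ × ℕ)) :=
  (List.finRange q.numSyms).map fun R =>
    (if ∃ j, q.colVar R j = x ∨ q.colVar R j = y then 1 else 0,
      if ∃ j, q.colVar R j = x ∨ q.colVar R j = y then 0 else 1,
      (List.finRange (q.arity R)).map fun j => pairColumn x y (q.colVar R j))

variable {x y} {n : ℕ}

theorem val_pairElem (hn : 0 < n) (v : Fin q.numVars) (i : Fin n) :
    (pairElem x y hn v i : ℕ) = (pairColumn x y v).1 * n + (pairColumn x y v).2 * i := by
  unfold pairElem pairColumn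
  split_ifs <;> simp [add_comm]

theorem pairColumn_le (v : Fin q.numVars) : (pairColumn x y v).1 ≤ 1 ∧ (pairColumn x y v).2 ≤ 1 := by
  unfold pairColumn
  split_ifs <;> simp

theorem exists_pairRelations_bound : ∃ w, ∀ n, 0 < n → ∀ R ∈ pairRelations x y,
    R.1 ≤ 1 ∧ R.2.1 ≤ 1 ∧ R.1 * n + R.2.1 ≤ n ∧ (∀ p ∈ R.2.2, p.1 ≤ 1 ∧ p.2 ≤ 1) ∧ R.2.2.length ≤ w := by
  refine ⟨∑ R, q.arity R, fun n hn R hR => ?_⟩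
  obtain ⟨R, -, rfl⟩ := List.mem_map.1 hR
  refine ⟨by dsimp only; split_ifs <;> simp, by dsimp only; split_ifs <;> simp,
    by dsimp only; split_ifs <;> omega, fun p hp => ?_, ?_⟩
  · obtain ⟨j, -, rfl⟩ := List.mem_map.1 hp
    exact pairColumn_le _
  · simpa using Finset.single_le_sum (f := fun R => q.arity R) (fun _ _ => Nat.zero_le _) (Finset.mem_univ R)

/-- The weights of the database are the first two lists of 3SUM, in the order of the input. -/
theorem encode_pairDatabase (hsjf : q.SelfJoinFree) (hxy : x ≠ y) (hn : 0 < n) {A B : Fin n → ℤ}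
    {μ : ℕ → ℤ} (hμ : ∀ i : Fin (n + n), μ (1 + i) = Fin.append A B i) :
    (pairDatabase hsjf hxy hn).encode (Fin.append A B) = databaseCode n μ (pairRelations x y) := by
  have hrel : ∀ R, (((pairDatabase hsjf hxy hn).rel R).length : ℤ) ::
      ((pairDatabase hsjf hxy hn).rel R).flatMap (fun t => List.ofFn fun j => ((t j : ℕ) : ℤ)) =
      relationCode n (if ∃ j, q.colVar R j = x ∨ q.colVar R j = y then 1 else 0)
        (if ∃ j, q.colVar R j = x ∨ q.colVar R j = y then 0 else 1)
        ((List.finRange (q.arity R)).map fun j => pairColumn x y (q.colVar R j)) := by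
    intro R
    have hlen : (if ∃ j, q.colVar R j = x ∨ q.colVar R j = y then 1 else 0) * n +
        (if ∃ j, q.colVar R j = x ∨ q.colVar R j = y then 0 else 1) = pairLen x y n R := by
      unfold pairLen; split_ifs <;> simp
    rw [relationCode, hlen]
    congr 1
    · simp [pairDatabase, pairRel]
    · change (pairRel x y hn R).flatMap (fun t : Fin (q.arity R) → Fin (n + n) =>
        List.ofFn fun j => ((t j : ℕ) : ℤ)) = _
      rw [pairRel, List.ofFn_eq_map, ← List.map_coe_finRange_eq_range, List.flatMap_map, List.flatMap_map]
      refine List.flatMap_congr fun i _ => ?_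
      rw [List.ofFn_eq_map, List.flatMap_map, ← List.map_eq_flatMap]
      exact List.map_congr_left fun j _ => by rw [val_pairElem]
  change ((n + n : ℕ) : ℤ) :: (List.ofFn (Fin.append A B) ++ (List.ofFn fun R =>
    (((pairDatabase hsjf hxy hn).rel R).length : ℤ) :: ((pairDatabase hsjf hxy hn).rel R).flatMap
      fun t => List.ofFn fun j => ((t j : ℕ) : ℤ)).flatten) = _
  rw [databaseCode, List.cons_append]
  congr 1
  · rw [two_mul]
  · congr 1
    · rw [← List.map_coe_finRange_eq_range, two_mul, List.map_map, List.ofFn_eq_map]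
      exact List.map_congr_left fun i _ => (hμ i).symm
    · rw [List.ofFn_eq_map, ← List.flatMap_def, pairRelations, List.flatMap_map]
      exact List.flatMap_congr fun R _ => hrel R

end

/-! ### Deciding 3SUM by binary search in the sorted sums -/

/-- The simulated programs use only `R` registers, and their part of the memory has the property `Inv`. The
other memory cells are as in `μ₀`, register 1 holds `n`, and register 2 holds `K`. -/
structure SearchState (K n R : ℕ) (Inv : (ℕ → ℤ) → Prop) (μ₀ ρ μ : ℕ → ℤ) : Prop where
  reg_n : ρ 1 = n
  reg_K : ρ 2 = K
  blank : ∀ r, 32 + R ≤ r → ρ r = 0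
  inv : Inv fun a => μ (a * K)
  rest : ∀ a, ¬ K ∣ a → μ a = μ₀ a

/-- The access program, started in a memory with the property `Inv`, replies to the request of position
`p + 1` with domain elements whose weights, found in `μ₀`, have the sum `S p`. -/
def RepliesSums (acc : Program) (x y Ta Wd n N : ℕ) (Inv : (ℕ → ℤ) → Prop) (μ₀ : ℕ → ℤ) (S : ℕ → ℤ) : Prop :=
  ∀ M, Inv M → ∀ p < N, ∃ c, RunsTo acc Ta Wd (requestConfig M (p + 1)) c ∧ Inv c.mem ∧
    ∃ e f : ℕ, c.reg (x + 1) = e ∧ c.reg (y + 1) = f ∧ e < 2 * n ∧ f < 2 * n ∧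
      μ₀ (1 + e) + μ₀ (1 + f) = S p

/-- Replace the range of positions from register 14 up to register 15 by the part behind the position in
register 17 if register 20 is not positive, and by the part before it if register 21 is not positive. -/
def narrow : Fragment :=
  skipIf 20 (ops [.add 14 17 5]) ;; skipIf 21 (ops [.add 15 17 19]) ;; ops [.sub 16 15 14]

theorem exec_narrow {W lo hi mid : ℕ} {s z : ℤ} {ρ μ : ℕ → ℤ} (hW : hi + mid + 1 ≤ W) (hlo : lo ≤ hi)
    (h21 : ρ 21 = z - s) (h20 : ρ 20 = s - z) (h19 : ρ 19 = 0) (h5 : ρ 5 = 1) (h17 : ρ 17 = mid)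
    (h14 : ρ 14 = lo) (h15 : ρ 15 = hi) :
    Exec W (2 + (2 + 1)) narrow (fun ρ' μ' => (∀ r, r ≠ 14 → r ≠ 15 → r ≠ 16 → ρ' r = ρ r) ∧
      ρ' 14 = (if s ≤ z then ((mid + 1 : ℕ) : ℤ) else lo) ∧ ρ' 15 = (if z ≤ s then (mid : ℤ) else hi) ∧
      ρ' 16 = ρ' 15 - ρ' 14 ∧ μ' = μ) ρ μ := by
  refine Exec.seq (Exec.skipIf (T := 1) (fun h => ?_) fun h => ?_)
  · refine Exec.block (by simp) ?_
    simp only [OpsPre, h17, h5]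
    refine ⟨by rw [abs_le]; omega, Exec.seq (Exec.skipIf (T := 1) (fun h' => ?_) fun h' => ?_)⟩
    · refine Exec.block (by simp) ?_
      simp only [OpsPre, Function.update_apply, Nat.reduceEqDiff, if_false, h17, h19] at h' ⊢
      refine ⟨by rw [abs_le]; omega, Exec.block (by simp) ?_⟩
      simp only [OpsPre, Function.update_apply, Nat.reduceEqDiff, if_true, if_false]
      refine ⟨by rw [abs_le]; omega, fun r a b c => by simp [a, b, c], ?_, ?_, trivial, trivial⟩
      · rw [if_pos (by omega)]; push_cast; rfl
      · rw [if_pos (by omega), add_zero]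
    · simp only [Function.update_apply, Nat.reduceEqDiff, if_false] at h'
      refine Exec.block (by simp) ?_
      simp only [OpsPre, Function.update_apply, Nat.reduceEqDiff, if_true, if_false, h15]
      refine ⟨by rw [abs_le]; omega, fun r a b c => by simp [a, c], ?_, ?_, trivial, trivial⟩
      · rw [if_pos (by omega)]; push_cast; rfl
      · rw [if_neg (by omega)]
  · refine Exec.seq (Exec.skipIf (T := 1) (fun h' => ?_) fun h' => by omega)
    refine Exec.block (by simp) ?_
    simp only [OpsPre, h17, h19]
    refine ⟨by rw [abs_le]; omega, Exec.block (by simp) ?_⟩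
    simp only [OpsPre, Function.update_apply, Nat.reduceEqDiff, if_true, if_false, h14]
    refine ⟨by rw [abs_le]; omega, fun r a b c => by simp [b, c], ?_, ?_, trivial, trivial⟩
    · rw [if_neg (by omega)]
    · rw [if_pos (by omega), add_zero]

/-- One step of the search for the value in register 13 among the positions from register 14 up to, but not
including, register 15. If the value is found, the range becomes empty with the upper end below the lower
end. -/
def probe (acc : Program) (x y R : ℕ) : Fragment :=
  ops [.add 17 14 15, .const 18 2, .div 17 17 18] ;; seqN (fun j => ops [.const (32 + j) 0]) R ;;
    ops [.const 5 1, .add 32 17 5] ;; simulate acc ;;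
      ops [.const 5 1, .add 20 (x + 33) 5, .load 20 20, .add 21 (y + 33) 5, .load 21 21, .add 20 20 21,
        .sub 20 20 13, .const 19 0, .sub 21 19 20] ;;
        narrow

/-- The registers of the access program have to be cleared between two requests. -/
theorem exec_clear {W R : ℕ} {ρ μ : ℕ → ℤ} (h : ∀ r, 32 + R ≤ r → ρ r = 0) :
    Exec W R (seqN (fun j => ops [.const (32 + j) 0]) R)
      (fun ρ' μ' => (∀ r, 32 ≤ r → ρ' r = 0) ∧ (∀ r < 32, ρ' r = ρ r) ∧ μ' = μ) ρ μ := by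
  refine (Exec.seqN (T := 1) (n := R) (fun k ρ' μ' => (∀ r, 32 ≤ r → r < 32 + k ∨ 32 + R ≤ r → ρ' r = 0) ∧
    (∀ r < 32, ρ' r = ρ r) ∧ μ' = μ) ?_ ⟨fun r h1 h2 => h r (by omega), fun _ _ => rfl, rfl⟩).mono
    (by omega) fun ρ' μ' h' => ⟨fun r hr => h'.1 r hr (by omega), h'.2⟩
  rintro k hk ρ' μ' ⟨h1, h2, rfl⟩
  refine Exec.block (by simp) ⟨by simp, fun r hr hr' => ?_, fun r hr => ?_, rfl⟩
  · by_cases hrk : r = 32 + k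
    · subst hrk; simp
    · rw [Function.update_of_ne hrk]
      exact h1 r hr (by omega)
  · rw [Function.update_of_ne (by omega), h2 r hr]

theorem exec_probe {acc : Program} {x y Ta Wd K n N R W B : ℕ} {Inv : (ℕ → ℤ) → Prop} {μ₀ : ℕ → ℤ}
    {S : ℕ → ℤ} (hacc : RepliesSums acc x y Ta Wd n N Inv μ₀ S) (hR1 : 1 ≤ R)
    (hR : ∀ T W c c', RunsTo acc T W c c' → ∀ r ≥ R, c'.reg r = c.reg r) (hK : 2 * n < K)
    (hB : ∀ a, |μ₀ a| ≤ (B : ℤ)) (hW : Wd * K + 2 * N + 3 * B + K + 2 ≤ W)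
    {ρ μ : ℕ → ℤ} {lo hi : ℕ} {z : ℤ} (h : SearchState K n R Inv μ₀ ρ μ) (h14 : ρ 14 = lo) (h15 : ρ 15 = hi)
    (h13 : ρ 13 = z) (hz : |z| ≤ (B : ℤ)) (hlo : lo < hi) (hhi : hi ≤ N) :
    Exec W (R + 2 * Ta + 19) (probe acc x y R) (fun ρ' μ' => SearchState K n R Inv μ₀ ρ' μ' ∧
      ρ' 0 = ρ 0 ∧ ρ' 6 = ρ 6 ∧ ρ' 13 = z ∧
      ρ' 14 = (if S ((lo + hi) / 2) ≤ z then (((lo + hi) / 2 + 1 : ℕ) : ℤ) else lo) ∧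
      ρ' 15 = (if z ≤ S ((lo + hi) / 2) then (((lo + hi) / 2 : ℕ) : ℤ) else hi) ∧
      ρ' 16 = ρ' 15 - ρ' 14) ρ μ := by
  obtain ⟨h1, h2, hblank, hinv, hrest⟩ := h
  have hmid : ((lo : ℤ) + hi) / 2 = ((lo + hi) / 2 : ℕ) := by omega
  generalize hm : (lo + hi) / 2 = mid at *
  have hmN : mid < N := by omega
  obtain ⟨c, hrun, hcinv, e, f, he, hf, heN, hfN, hS⟩ := hacc _ hinv mid hmN
  have hcB := hB (1 + e)
  have hdB := hB (1 + f)
  rw [abs_le] at hcB hdB hz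
  refine (Exec.ops_seq (T := R + (2 + (2 * Ta + (9 + (2 + (2 + 1)))))) ?_).mono
    (by simp only [List.length_cons, List.length_nil]; omega) fun _ _ h => h
  simp only [OpsPre, Function.update_apply, Nat.reduceEqDiff, if_true, if_false, h14, h15, hmid, abs_le]
  refine ⟨by omega, by omega, by omega, ?_⟩
  refine Exec.seq ((exec_clear fun r hr => ?_).mono le_rfl ?_)
  · rw [Function.update_of_ne (by omega), Function.update_of_ne (by omega), Function.update_of_ne (by omega)]
    exact hblank r hr
  rintro ρ₁ μ₁ ⟨hb, ho, rfl⟩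
  refine Exec.ops_seq (l := [.const 5 1, .add 32 17 5]) ?_
  simp only [OpsPre, Function.update_apply, Nat.reduceEqDiff, if_true, if_false, ho 17 (by norm_num)]
  refine ⟨by simp; omega, by rw [abs_le]; omega, ?_⟩
  refine Exec.seq ((exec_simulate (K := K) hrun rfl (fun r => ?_) (fun a => rfl) ?_ (by omega)
    (by omega : Wd * K ≤ W)).mono le_rfl ?_)
  · simp only [Function.update_apply, requestConfig]
    by_cases hr : r = 0
    · subst hr; simp
    · rw [if_neg (by omega), if_neg (by omega), if_neg hr, hb _ (by omega)]
  · simp [ho, h2]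
  rintro ρ₂ μ₂ ⟨hr, hown, hmem, hrest₂⟩
  have h17 : ρ₂ 17 = mid := by
    rw [hown 17 (by norm_num) (by norm_num), Function.update_of_ne (by norm_num),
      Function.update_of_ne (by norm_num), ho 17 (by norm_num), Function.update_self]
  replace hown : ∀ r < 32, r ≠ 3 → r ≠ 5 → r ≠ 17 → r ≠ 18 → ρ₂ r = ρ r := fun r a b c d e => by
    rw [hown r a b, Function.update_of_ne (by omega), Function.update_of_ne c, ho r a,
      Function.update_of_ne d, Function.update_of_ne e, Function.update_of_ne d]
  have hx : ρ₂ (x + 33) = e := by rw [← he, ← hr]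
  have hy : ρ₂ (y + 33) = f := by rw [← hf, ← hr]
  have hlook : ∀ a < 2 * n, μ₂ (1 + a) = μ₀ (1 + a) := fun a ha => by
    have := Nat.not_dvd_of_pos_of_lt (by omega : 0 < 1 + a) (by omega : 1 + a < K)
    rw [hrest₂ _ this, hrest _ this]
  have hte : ((e : ℤ) + 1).toNat = 1 + e := by omega
  have htf : ((f : ℤ) + 1).toNat = 1 + f := by omega
  have h13' := hown 13 (by norm_num) (by norm_num) (by norm_num) (by norm_num) (by norm_num)
  rw [h13] at h13'
  have hblank₂ : ∀ r, 32 + R ≤ r → ρ₂ r = 0 := fun r hr' => by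
    obtain ⟨s, rfl⟩ := Nat.exists_eq_add_of_le' (by omega : 32 ≤ r)
    rw [hr, hR _ _ _ _ hrun s (by omega)]
    exact if_neg (by omega)
  refine Exec.ops_seq (l := [.const 5 1, .add 20 (x + 33) 5, .load 20 20, .add 21 (y + 33) 5, .load 21 21,
    .add 20 20 21, .sub 20 20 13, .const 19 0, .sub 21 19 20]) ?_
  have e1 : ∀ v, ¬ v + 33 = 5 := by omega
  have e2 : ∀ v, ¬ v + 33 = 20 := by omega
  simp only [OpsPre, Function.update_apply, Nat.reduceEqDiff, if_true, if_false, e1, e2, hx, hy, hte, htf,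
    hlook e heN, hlook f hfN, hS, h13', abs_le]
  refine ⟨by omega, by omega, by omega, by omega, by omega, by omega, by omega, ?_⟩
  refine (exec_narrow (W := W) (lo := lo) (hi := hi) (mid := mid) (s := S mid) (z := z) (by omega) (by omega)
    (by simp) (by simp) (by simp) (by simp) (by simp [h17]) ?_ ?_).mono le_rfl ?_
  · simp [hown, h14]
  · simp [hown, h15]
  rintro ρ₃ μ₃ ⟨hkeep, h14', h15', h16', rfl⟩
  have hkeep' : ∀ r < 32, r ∉ [3, 5, 14, 15, 16, 17, 18, 19, 20, 21] → ρ₃ r = ρ r := fun r hr hr' => by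
    simp only [List.mem_cons, List.not_mem_nil, not_or] at hr'
    rw [hkeep r (by tauto) (by tauto) (by tauto), ← hown r hr (by tauto) (by tauto) (by tauto) (by tauto)]
    simp [hr']
  refine ⟨⟨?_, ?_, fun r hr' => ?_, ?_, fun a ha => ?_⟩, ?_, ?_, ?_, h14', h15', h16'⟩
  · rw [hkeep' 1 (by norm_num) (by simp), h1]
  · rw [hkeep' 2 (by norm_num) (by simp), h2]
  · rw [hkeep r (by omega) (by omega) (by omega), ← hblank₂ r hr']
    simp only [Function.update_apply]
    repeat rw [if_neg (by omega)]
  · convert hcinv using 1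
    exact funext hmem
  · rw [hrest₂ a ha, hrest a ha]
  · exact hkeep' 0 (by norm_num) (by simp)
  · exact hkeep' 6 (by norm_num) (by simp)
  · rw [hkeep' 13 (by norm_num) (by simp), h13]

/-- Binary search: the sums before the range are smaller, and those behind it larger than the target. -/
theorem exec_search {acc : Program} {x y Ta Wd K n N R W B : ℕ} {Inv : (ℕ → ℤ) → Prop} {μ₀ : ℕ → ℤ}
    {S : ℕ → ℤ} (hacc : RepliesSums acc x y Ta Wd n N Inv μ₀ S) (hR1 : 1 ≤ R)
    (hR : ∀ T W c c', RunsTo acc T W c c' → ∀ r ≥ R, c'.reg r = c.reg r) (hK : 2 * n < K)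
    (hB : ∀ a, |μ₀ a| ≤ (B : ℤ)) (hW : Wd * K + 2 * N + 3 * B + K + 2 ≤ W)
    (hS : ∀ p p', p ≤ p' → p' < N → S p ≤ S p') (hN : 0 < N)
    {ρ μ : ℕ → ℤ} {z : ℤ} (h : SearchState K n R Inv μ₀ ρ μ) (h14 : ρ 14 = 0) (h15 : ρ 15 = N)
    (h13 : ρ 13 = z) (hz : |z| ≤ (B : ℤ)) :
    Exec W (Nat.clog 2 (N + 1) * (R + 2 * Ta + 20)) (doWhile (probe acc x y R) 16) (fun ρ' μ' =>
      SearchState K n R Inv μ₀ ρ' μ' ∧ ρ' 0 = ρ 0 ∧ ρ' 6 = ρ 6 ∧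
      (ρ' 16 = -1 ∧ (∃ p < N, S p = z) ∨ ρ' 16 = 0 ∧ ¬ ∃ p < N, S p = z)) ρ μ := by
  refine Exec.doWhile (T := R + 2 * Ta + 19) (fun m ρ' μ' => SearchState K n R Inv μ₀ ρ' μ' ∧ ρ' 0 = ρ 0 ∧
    ρ' 6 = ρ 6 ∧ ρ' 13 = z ∧ ∃ lo hi : ℕ, ρ' 14 = lo ∧ ρ' 15 = hi ∧ lo < hi ∧ hi ≤ N ∧ hi < lo + 2 ^ m ∧
      (∀ p < lo, S p < z) ∧ ∀ p, hi ≤ p → p < N → z < S p) ?_ _ ?_ (Nat.clog_pos one_lt_two (by omega))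
  · rintro m ρ₁ μ₁ ⟨hst, h0, h6, h13, lo, hi, h14, h15, hlt, hhi, hpow, hlow, hup⟩
    refine (exec_probe hacc hR1 hR hK hB hW hst h14 h15 h13 hz hlt hhi).mono le_rfl ?_
    rintro ρ₂ μ₂ ⟨hst', h0', h6', h13', h14', h15', h16'⟩
    have hmid1 : lo ≤ (lo + hi) / 2 := by omega
    have hmid2 : (lo + hi) / 2 < hi := by omega
    rw [pow_succ] at hpow
    have hmid3 : hi ≤ (lo + hi) / 2 + 2 ^ m := by omega
    have hmid4 : (lo + hi) / 2 < lo + 2 ^ m := by omega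
    generalize (lo + hi) / 2 = mid at *
    rcases lt_trichotomy (S mid) z with hs | hs | hs
    · rw [if_pos hs.le] at h14'
      rw [if_neg (not_le.2 hs)] at h15'
      have hlow' : ∀ p < mid + 1, S p < z := fun p hp => (hS p mid (by omega) (by omega)).trans_lt hs
      refine ⟨fun hpos => ⟨Nat.pos_of_ne_zero ?_, hst', h0'.trans h0, h6'.trans h6, h13', mid + 1, hi, h14',
        h15', by omega, hhi, by omega, hlow', hup⟩, fun hle => ⟨hst', h0'.trans h0, h6'.trans h6,
        .inr ⟨by omega, ?_⟩⟩⟩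
      · rintro rfl
        rw [pow_zero] at hmid3
        omega
      · rintro ⟨p, hp, rfl⟩
        by_cases hpm : p < mid + 1
        · exact lt_irrefl _ (hlow' p hpm)
        · exact lt_irrefl _ (hup p (by omega) hp)
    · rw [if_pos hs.le] at h14'
      rw [if_pos hs.ge] at h15'
      exact ⟨fun hpos => by omega, fun hle => ⟨hst', h0'.trans h0, h6'.trans h6,
        .inl ⟨by omega, mid, by omega, hs⟩⟩⟩
    · rw [if_neg (not_le.2 hs)] at h14'
      rw [if_pos hs.le] at h15'
      have hup' : ∀ p, mid ≤ p → p < N → z < S p := fun p hp hpN => hs.trans_le (hS mid p hp hpN)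
      refine ⟨fun hpos => ⟨Nat.pos_of_ne_zero ?_, hst', h0'.trans h0, h6'.trans h6, h13', lo, mid, h14',
        h15', by omega, by omega, hmid4, hlow, hup'⟩, fun hle => ⟨hst', h0'.trans h0, h6'.trans h6,
        .inr ⟨by omega, ?_⟩⟩⟩
      · rintro rfl
        rw [pow_zero] at hmid4
        omega
      · rintro ⟨p, hp, rfl⟩
        by_cases hpm : p < lo
        · exact lt_irrefl _ (hlow p hpm)
        · exact lt_irrefl _ (hup' p (by omega) hp)
  · refine ⟨h, rfl, rfl, h13, 0, N, by simp [h14], h15, hN, le_rfl, ?_, by simp, by omega⟩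
    have := Nat.le_pow_clog one_lt_two (N + 1)
    omega

/-- Search for each of the numbers in the cells `2 * n + 1, …, 3 * n` among the sums, and leave in register
0 whether one of them has been found. -/
def searchAll (acc : Program) (x y R : ℕ) : Fragment :=
  ops [.const 0 0] ;; forLoop 6 1 8
    (ops [.const 5 1, .add 9 1 1, .add 9 9 6, .add 9 9 5, .load 13 9, .const 14 0, .mul 15 1 1] ;;
      doWhile (probe acc x y R) 16 ;;
        ops [.const 5 1, .const 18 2, .sub 0 0 16, .add 0 0 5, .div 0 0 18])

open Classical in
theorem exec_searchAll {acc : Program} {x y Ta Wd K n R W B : ℕ} {Inv : (ℕ → ℤ) → Prop} {μ₀ : ℕ → ℤ}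
    {S : ℕ → ℤ} (hacc : RepliesSums acc x y Ta Wd n (n * n) Inv μ₀ S) (hR1 : 1 ≤ R)
    (hR : ∀ T W c c', RunsTo acc T W c c' → ∀ r ≥ R, c'.reg r = c.reg r) (hK : 3 * n < K)
    (hB : ∀ a, |μ₀ a| ≤ (B : ℤ)) (hW : Wd * K + 2 * (n * n) + 3 * B + K + 2 ≤ W)
    (hS : ∀ p p', p ≤ p' → p' < n * n → S p ≤ S p') (hn : 0 < n)
    {ρ μ : ℕ → ℤ} (h : SearchState K n R Inv μ₀ ρ μ) :
    Exec W (5 + n * (Nat.clog 2 (n * n + 1) * (R + 2 * Ta + 20) + 16)) (searchAll acc x y R) (fun ρ' _ =>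
      ρ' 0 = if ∃ k < n, ∃ p < n * n, S p = μ₀ (1 + 2 * n + k) then 1 else 0) ρ μ := by
  refine (Exec.ops_seq (T := 4 + n * ((7 + (Nat.clog 2 (n * n + 1) * (R + 2 * Ta + 20) + 5)) + 4)) ?_).mono
    (by simp only [List.length_cons, List.length_nil]; ring_nf; omega) fun _ _ h => h
  simp only [OpsPre]
  refine ⟨by simp, ?_⟩
  refine Exec.forLoop n (fun m ρ' μ' => SearchState K n R Inv μ₀ ρ' μ' ∧
      ρ' 0 = if ∃ k < m, ∃ p < n * n, S p = μ₀ (1 + 2 * n + k) then 1 else 0)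
    (by norm_num) (by norm_num) (by norm_num) (by omega) (by simp [h.reg_n]) ?_ ?_ ?_ ?_
  · rintro k ρ μ u v ⟨hst, h0⟩
    refine ⟨⟨by simp [hst.reg_n], by simp [hst.reg_K], fun r hr => ?_, hst.inv, hst.rest⟩, by simp [h0]⟩
    rw [Function.update_of_ne (by omega), Function.update_of_ne (by omega)]
    exact hst.blank r hr
  · refine ⟨⟨by simp [h.reg_n], by simp [h.reg_K], fun r hr => ?_, h.inv, h.rest⟩, by simp⟩
    rw [Function.update_of_ne (by omega)]
    exact h.blank r hr
  · rintro k hk ρ₁ μ₁ ⟨hst, h0⟩ h6 h1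
    have hnn : n ≤ n * n := Nat.le_mul_self n
    refine Exec.ops_seq (l := [.const 5 1, .add 9 1 1, .add 9 9 6, .add 9 9 5, .load 13 9, .const 14 0,
      .mul 15 1 1]) ?_
    have hadd : ((n : ℤ) + n + k + 1).toNat = 1 + 2 * n + k := by omega
    have hlook : μ₁ (1 + 2 * n + k) = μ₀ (1 + 2 * n + k) :=
      hst.rest _ (Nat.not_dvd_of_pos_of_lt (by omega) (by omega))
    simp only [OpsPre, Function.update_apply, Nat.reduceEqDiff, if_true, if_false, h1, h6, hadd, hlook,
      ← Nat.cast_mul, Nat.abs_cast, Nat.cast_le]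
    refine ⟨by simp; omega, by rw [abs_le]; omega, by rw [abs_le]; omega, by rw [abs_le]; omega, by simp,
      by omega, ?_⟩
    refine Exec.seq ((exec_search hacc hR1 hR (by omega) hB hW hS (by positivity) (z := μ₀ (1 + 2 * n + k))
      ⟨by simp [hst.reg_n], by simp [hst.reg_K], fun r hr => ?_, hst.inv, hst.rest⟩ (by simp) (by simp)
      (by simp) (hB _)).mono le_rfl ?_)
    · simp only [Function.update_apply]
      repeat rw [if_neg (by omega)]
      exact hst.blank r hr
    rintro ρ₂ μ₂ ⟨hst', h0', h6', h16⟩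
    simp only [Function.update_apply, Nat.reduceEqDiff, if_false, h0, h6] at h0' h6'
    refine Exec.block (by simp) ?_
    have hex : (∃ j < k + 1, ∃ p < n * n, S p = μ₀ (1 + 2 * n + j)) ↔
        (∃ j < k, ∃ p < n * n, S p = μ₀ (1 + 2 * n + j)) ∨ ∃ p < n * n, S p = μ₀ (1 + 2 * n + k) := by
      constructor
      · rintro ⟨j, hj, hp⟩
        rcases Nat.lt_succ_iff_lt_or_eq.1 hj with hj | rfl
        · exact .inl ⟨j, hj, hp⟩
        · exact .inr hp
      · rintro (⟨j, hj, hp⟩ | hp)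
        · exact ⟨j, by omega, hp⟩
        · exact ⟨k, by omega, hp⟩
    -- with `b, d ∈ {0, 1}`, the disjunction of `b` and `d` is `(b + d + 1) / 2`
    obtain ⟨b, hb, hbP⟩ : ∃ b : ℤ, ρ₂ 0 = b ∧ (b = 0 ∧ ¬ (∃ j < k, ∃ p < n * n, S p = μ₀ (1 + 2 * n + j)) ∨
        b = 1 ∧ ∃ j < k, ∃ p < n * n, S p = μ₀ (1 + 2 * n + j)) := by
      refine ⟨_, h0', ?_⟩
      split_ifs with hP
      exacts [.inr ⟨rfl, hP⟩, .inl ⟨rfl, hP⟩]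
    have hb1 : 0 ≤ b ∧ b ≤ 1 := by rcases hbP with ⟨rfl, -⟩ | ⟨rfl, -⟩ <;> simp
    have hd1 : 0 ≤ - ρ₂ 16 ∧ - ρ₂ 16 ≤ 1 := by rcases h16 with ⟨h, -⟩ | ⟨h, -⟩ <;> simp [h]
    clear h0 h0'
    simp only [OpsPre, Function.update_apply, Nat.reduceEqDiff, if_true, if_false, hb, h6', hst'.reg_n, hex]
    refine ⟨by simp; omega, by simp; omega, by rw [abs_le]; omega, by rw [abs_le]; omega,
      by rw [abs_le]; omega, trivial, trivial, ⟨by simp [hst'.reg_n], by simp [hst'.reg_K], fun r hr => ?_,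
        hst'.inv, hst'.rest⟩, ?_⟩
    · simp only [Function.update_apply]
      repeat rw [if_neg (by omega)]
      exact hst'.blank r hr
    · rcases hbP with ⟨rfl, hP⟩ | ⟨rfl, hP⟩ <;> rcases h16 with ⟨h16, hQ⟩ | ⟨h16, hQ⟩ <;> rw [h16]
      · rw [if_pos (.inr hQ)]; rfl
      · rw [if_neg (not_or.2 ⟨hP, hQ⟩)]; rfl
      · rw [if_pos (.inr hQ)]; rfl
      · rw [if_pos (.inl hP)]; rfl
  · intro ρ μ hI _
    exact hI.2

/-! ### The running time -/

/-- The factor `n ^ o(1)` is bounded by any fixed positive power of `n`. -/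
theorem IsSoftO.isBigO {T : ℕ → ℕ} {f : ℕ → ℝ} (h : IsSoftO T f) {ε : ℝ} (hε : 0 < ε) :
    (fun n => (T n : ℝ)) =O[atTop] fun n => f n * (n : ℝ) ^ ε := by
  obtain ⟨h, h0, hT⟩ := h
  refine hT.trans (IsBigO.mul (isBigO_refl f atTop) (IsBigO.of_bound 1 ?_))
  filter_upwards [h0.eventually_le_const hε, eventually_ge_atTop 1] with n hn h1
  have h1' : (1 : ℝ) ≤ n := by exact_mod_cast h1
  rw [one_mul, Real.norm_of_nonneg (by positivity), Real.norm_of_nonneg (by positivity)]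
  exact Real.rpow_le_rpow_of_exponent_le h1' hn

theorem isSoftO_of_isBigO {T : ℕ → ℕ} {f : ℕ → ℝ} (h : (fun n => (T n : ℝ)) =O[atTop] f) : IsSoftO T f :=
  ⟨fun _ => 0, tendsto_const_nhds, by simpa using h⟩

theorem isBigO_natCast_rpow {a b : ℝ} (hab : a ≤ b) :
    (fun n : ℕ => (n : ℝ) ^ a) =O[atTop] fun n : ℕ => (n : ℝ) ^ b := by
  refine IsBigO.of_bound 1 ?_
  filter_upwards [eventually_ge_atTop 1] with n h1
  have h1' : (1 : ℝ) ≤ n := by exact_mod_cast h1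
  rw [one_mul, Real.norm_of_nonneg (by positivity), Real.norm_of_nonneg (by positivity)]
  exact Real.rpow_le_rpow_of_exponent_le h1' hab

theorem isBigO_clog_sq :
    (fun n : ℕ => (Nat.clog 2 (n * n + 1) : ℝ)) =O[atTop] fun n : ℕ => (n : ℝ) ^ (1 / 4 : ℝ) := by
  have h1 : (fun n : ℕ => (Nat.clog 2 (n * n + 1) : ℝ)) =O[atTop] fun n : ℕ => Real.log n := by
    refine IsBigO.of_bound ((2 * (1 + Real.log (1 + (1 : ℕ))) + 1) * 2) ?_
    filter_upwards [eventually_ge_atTop 3] with n hn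
    have h := clog_add_le 1 (n := n * n) (by nlinarith)
    have hlog := one_le_log_natCast hn
    have h3 : (n : ℝ) ≠ 0 := by positivity
    rw [Real.norm_of_nonneg (by positivity), Real.norm_of_nonneg (by linarith)]
    rw [Nat.cast_mul, Real.log_mul h3 h3] at h
    linarith
  exact h1.trans ((isLittleO_log_rpow_atTop (by norm_num)).isBigO.comp_tendsto tendsto_natCast_atTop_atTop)

/-- The time of the 3SUM algorithm: linear work, one preprocessing, and `n` binary searches, on a database
of linear size. -/
theorem isSoftO_searchTime {Tp Ta : ℕ → ℕ} (hTp : IsSoftO Tp fun m => (m : ℝ)) (hTa : IsSoftO Ta fun _ => 1)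
    (a b c d r : ℕ) (ha : 0 < a) :
    IsSoftO (fun n => c + d * n + 2 * Tp (a * n + b) +
      n * (Nat.clog 2 (n * n + 1) * (r + 2 * Ta (a * n + b)))) fun n => (n : ℝ) ^ (2 - 1 / 2 : ℝ) := by
  refine isSoftO_of_isBigO ?_
  have hm : Tendsto (fun n => a * n + b) atTop atTop :=
    tendsto_atTop_mono (fun n => (Nat.le_mul_of_pos_left n ha).trans (Nat.le_add_right _ _)) tendsto_id
  have hconst : ∀ (c : ℕ) {e : ℝ}, 0 ≤ e → (fun _ : ℕ => (c : ℝ)) =O[atTop] fun n : ℕ => (n : ℝ) ^ e := by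
    intro c e he
    have h1 : (fun _ : ℕ => (1 : ℝ)) =O[atTop] fun n : ℕ => (n : ℝ) ^ e := by
      simpa using isBigO_natCast_rpow he
    simpa using h1.const_mul_left (c : ℝ)
  have hid : (fun n : ℕ => (n : ℝ)) =O[atTop] fun n : ℕ => (n : ℝ) ^ (1 : ℝ) := by
    simpa using isBigO_refl (fun n : ℕ => (n : ℝ)) atTop
  have hlin : (fun n : ℕ => ((a * n + b : ℕ) : ℝ)) =O[atTop] fun n : ℕ => (n : ℝ) ^ (1 : ℝ) := by
    push_cast
    exact (hid.const_mul_left _).add (hconst b zero_le_one)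
  have hpow : ∀ e : ℝ, 0 ≤ e →
      (fun n : ℕ => ((a * n + b : ℕ) : ℝ) ^ e) =O[atTop] fun n : ℕ => (n : ℝ) ^ e := by
    intro e he
    have := hlin.rpow he (Eventually.of_forall fun n => by positivity)
    simpa using this
  have hTp' : (fun n : ℕ => (Tp (a * n + b) : ℝ)) =O[atTop] fun n : ℕ => (n : ℝ) ^ (2 - 1 / 2 : ℝ) := by
    refine ((hTp.isBigO (ε := 1 / 2) (by norm_num)).comp_tendsto hm).trans ?_
    refine (hlin.mul (hpow (1 / 2) (by norm_num))).trans ?_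
    refine IsBigO.of_bound 1 ?_
    filter_upwards [eventually_ge_atTop 1] with n h1
    have h1' : (0 : ℝ) < n := by exact_mod_cast h1
    rw [← Real.rpow_add h1']
    norm_num
  have hTa' : (fun n : ℕ => (Ta (a * n + b) : ℝ)) =O[atTop] fun n : ℕ => (n : ℝ) ^ (1 / 4 : ℝ) := by
    refine ((hTa.isBigO (ε := 1 / 4) (by norm_num)).comp_tendsto hm).trans ?_
    simpa [Function.comp_def] using hpow (1 / 4) (by norm_num)
  have hsearch : (fun n : ℕ => (n : ℝ) * (Nat.clog 2 (n * n + 1) * (r + 2 * Ta (a * n + b)))) =O[atTop]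
      fun n : ℕ => (n : ℝ) ^ (2 - 1 / 2 : ℝ) := by
    refine (hid.mul (isBigO_clog_sq.mul ((hconst r (by norm_num)).add (hTa'.const_mul_left 2)))).trans ?_
    refine IsBigO.of_bound 1 ?_
    filter_upwards [eventually_ge_atTop 1] with n h1
    have h1' : (0 : ℝ) < n := by exact_mod_cast h1
    rw [← Real.rpow_add h1', ← Real.rpow_add h1']
    norm_num
  push_cast
  exact (((hconst c (by norm_num)).add ((hid.trans (isBigO_natCast_rpow (by norm_num))).const_mul_left _)).add
    (hTp'.const_mul_left 2)).add hsearch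

/-! ### Direct access decides 3SUM -/

section

variable {n : ℕ} (A B C : Fin n → ℤ)

/-- The input of 3SUM. -/
def threeSumInput : List ℤ := (n : ℤ) :: (List.ofFn A ++ List.ofFn B ++ List.ofFn C)

theorem length_threeSumInput : (threeSumInput A B C).length = 3 * n + 1 := by
  simp [threeSumInput]; omega

theorem threeSumInput_append (i : Fin (n + n)) :
    (inputConfig (threeSumInput A B C)).mem (1 + i) = Fin.append A B i := by
  have h : (threeSumInput A B C).getD (1 + i) 0 = (List.ofFn (Fin.append A B) ++ List.ofFn C).getD i 0 := by
    rw [threeSumInput, List.ofFn_fin_append, add_comm]; rfl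
  refine h.trans ?_
  rw [List.getD_append _ _ _ _ (by simp), List.getD_eq_getElem _ _ (by simp), List.getElem_ofFn]

theorem threeSumInput_last (k : Fin n) : (inputConfig (threeSumInput A B C)).mem (1 + 2 * n + k) = C k := by
  have h : (threeSumInput A B C).getD (1 + 2 * n + k) 0 =
      (List.ofFn A ++ List.ofFn B ++ List.ofFn C).getD (2 * n + k) 0 := by
    rw [threeSumInput, show 1 + 2 * n + k = (2 * n + k) + 1 by omega]; rfl
  refine h.trans ?_
  have hlen : (List.ofFn A ++ List.ofFn B).length = 2 * n := by simp; omega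
  rw [List.getD_append_right _ _ _ _ (by omega), hlen, Nat.add_sub_cancel_left,
    List.getD_eq_getElem _ _ (by simp), List.getElem_ofFn]

variable {A B C}

theorem abs_le_of_mem_threeSumInput (hA : ∀ i, |A i| ≤ (n : ℤ) ^ 4) (hB : ∀ i, |B i| ≤ (n : ℤ) ^ 4)
    (hC : ∀ i, |C i| ≤ (n : ℤ) ^ 4) {z : ℤ} (hz : z ∈ threeSumInput A B C) : |z| ≤ ((n ^ 4 : ℕ) : ℤ) := by
  simp only [threeSumInput, List.mem_cons, List.mem_append, List.mem_ofFn] at hz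
  push_cast
  rcases hz with rfl | (⟨i, rfl⟩ | ⟨i, rfl⟩) | ⟨i, rfl⟩
  · rw [Nat.abs_cast]
    exact_mod_cast Nat.le_self_pow (by norm_num) n
  · exact hA i
  · exact hB i
  · exact hC i

end

/-- The program for 3SUM: it writes the database whose answers are the pairs of indices, preprocesses it,
and searches for each target among the sorted sums. -/
def threeSumSolver (rels : List (ℕ × ℕ × List (ℕ × ℕ))) (pre acc : Program) (x y R : ℕ) : Fragment :=
  ops [.load 1 0, .const 5 1, .sub 5 5 1] ;;
    skipIf 5 (emitDatabase rels ;; simulate pre ;; searchAll acc x y R)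

open Classical in
/-- If a self-join free query with two variables that do not occur together in an atom had direct access
with quasilinear preprocessing and subpolynomial access time, then 3SUM could be solved in time
`Õ(n ^ (3/2))`. -/
theorem AdmitsSumDirectAccess.exists_solvesThreeSum {q : JoinQuery}
    (h : AdmitsSumDirectAccess q (fun m => (m : ℝ)) fun _ => 1) (hsjf : q.SelfJoinFree)
    {x y : Fin q.numVars} (hxy : x ≠ y) (hno : ∀ i, x ∈ q.scope i → y ∉ q.scope i) :
    ∃ (P : Program) (T : ℕ → ℕ), IsSoftO T (fun n => (n : ℝ) ^ (2 - 1 / 2 : ℝ)) ∧ SolvesThreeSum P T := by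
  obtain ⟨pre, acc, h⟩ := h
  -- the exponent 4 bounds the weights, which are at most `n ^ 4`, and the `n ^ 2` positions
  obtain ⟨k, Tp, Ta, hTp, hTa, hD⟩ := h 4
  obtain ⟨α, β, hα, hsize⟩ := size_pairDatabase hsjf hxy
  obtain ⟨w, hw⟩ := exists_pairRelations_bound (x := x) (y := y)
  obtain ⟨R₁, hR₁⟩ := exists_register_bound pre
  obtain ⟨R₂, hR₂⟩ := exists_register_bound acc
  obtain ⟨R, hR1, hRpre, hRacc⟩ : ∃ R, 1 ≤ R ∧ R₁ ≤ R ∧ R₂ ≤ R :=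
    ⟨1 + R₁ + R₂, by omega, by omega, by omega⟩
  obtain ⟨am, ham⟩ : ∃ am, ∀ S, q.arity S ≤ am :=
    ⟨∑ S, q.arity S, fun S => Finset.single_le_sum (f := q.arity) (fun _ _ => Nat.zero_le _) (Finset.mem_univ S)⟩
  generalize hs : (pairRelations x y).length = s
  -- `m n` is the size of the database for `n` indices, `E n` bounds the length of its code, and `W n` bounds
  -- all numbers; the simulated programs contribute `(m + k) ^ k`, stretched by `3 * n + 1`
  let m : ℕ → ℕ := fun n => α * n + β
  let E : ℕ → ℕ := fun n => 1 + am * m n + q.numSyms * (1 + m n * am)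
  let W : ℕ → ℕ := fun n => E n * (3 * n + 1) + (m n + k) ^ k * (3 * n + 1) + 2 * (n * n) + 3 * n ^ 4 +
    (5 * n + 6)
  have hm : PolyBounded m := ((PolyBounded.const α).mul .id).add (.const β)
  have hE : PolyBounded E := ((PolyBounded.const 1).add ((PolyBounded.const am).mul hm)).add
    ((PolyBounded.const q.numSyms).mul ((PolyBounded.const 1).add (hm.mul (.const am))))
  have hlin : ∀ a b, PolyBounded fun n => a * n + b := fun a b => ((PolyBounded.const a).mul .id).add (.const b)
  have hW : PolyBounded W := ((((hE.mul (hlin 3 1)).add (((hm.add (.const k)).pow k).mul (hlin 3 1))).add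
    ((PolyBounded.const 2).mul (PolyBounded.id.mul .id))).add
    ((PolyBounded.const 3).mul (PolyBounded.id.pow 4))).add (hlin 5 6)
  obtain ⟨k', hk'⟩ := hW
  refine ⟨threeSumSolver (pairRelations x y) pre acc x y R 0, _,
    isSoftO_searchTime hTp hTa α β (21 + s * 10) (34 + s * (w * 7 + 4)) (R + 20) hα, k', ?_⟩
  intro n A B C hA hB hC
  change ∃ c', RunsTo _ _ _ (inputConfig (threeSumInput A B C)) c' ∧ _
  have hWn : W n = E n * (3 * n + 1) + (m n + k) ^ k * (3 * n + 1) + 2 * (n * n) + 3 * n ^ 4 + (5 * n + 6) := rfl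
  have hfitsB : (inputConfig (threeSumInput A B C)).Fits (n ^ 4) :=
    fits_inputConfig fun z hz => abs_le_of_mem_threeSumInput hA hB hC hz
  have hfits : (inputConfig (threeSumInput A B C)).Fits (W n) := by
    have : ((n ^ 4 : ℕ) : ℤ) ≤ W n := by exact_mod_cast (by omega : n ^ 4 ≤ W n)
    exact ⟨fun r => (hfitsB.1 r).trans this, fun a => (hfitsB.2 a).trans this⟩
  have h0 : (inputConfig (threeSumInput A B C)).mem 0 = n := rfl
  have hAB := threeSumInput_append A B C
  have hCk := threeSumInput_last A B C
  have hzero : ∀ a, 3 * n < a → (inputConfig (threeSumInput A B C)).mem a = 0 := fun a ha =>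
    List.getD_eq_default _ _ (by rw [length_threeSumInput]; omega)
  have hBμ := hfitsB.2
  generalize hμ : (inputConfig (threeSumInput A B C)).mem = μ at *
  have hstart : inputConfig (threeSumInput A B C) = ⟨0, fun _ => 0, μ⟩ := by rw [← hμ]; rfl
  rw [hstart] at hfits ⊢
  suffices hexec : Exec (W n) (3 + (((12 + 18 * n + s * (10 + n * (w * 7 + 4))) + (2 * Tp (m n) +
      (5 + n * (Nat.clog 2 (n * n + 1) * (R + 2 * Ta (m n) + 20) + 16)))) + 1))
      (threeSumSolver (pairRelations x y) pre acc x y R)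
      (fun ρ _ => ρ 0 = if ThreeSum A B C then 1 else 0) (fun _ => 0) μ by
    obtain ⟨c, hrun, hc⟩ := hexec.runsTo hfits
    refine ⟨c, hrun.mono (le_of_eq ?_) (hk' n), hc⟩
    change _ = 21 + s * 10 + (34 + s * (w * 7 + 4)) * n + 2 * Tp (m n) +
      n * (Nat.clog 2 (n * n + 1) * (R + 20 + 2 * Ta (m n)))
    ring
  refine Exec.ops_seq (l := [.load 1 0, .const 5 1, .sub 5 5 1]) ?_
  simp only [OpsPre, Function.update_apply, Nat.reduceEqDiff, if_true, if_false, Int.toNat_zero, h0]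
  refine ⟨by simp; omega, by rw [abs_le]; omega, Exec.skipIf (fun hpos => ?_) fun hneg => ?_⟩
  swap
  · -- the case `n = 0`, for which there is no database of this kind
    simp only [Function.update_apply, if_true] at hneg
    obtain rfl : n = 0 := by omega
    rw [if_neg]
    · simp
    · rintro ⟨i, -⟩
      exact i.elim0
  simp only [Function.update_apply, if_true] at hpos
  have hn : 0 < n := by omega
  have henc := encode_pairDatabase hsjf hxy hn hAB
  have hsz := hsize n hn
  obtain ⟨L, hL, Inv, ⟨c₀, hrun₀, hinv₀⟩, hacc⟩ := hD (pairDatabase hsjf hxy hn) (Fin.append A B) (by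
    intro e
    have hnm : n ^ 4 ≤ ((pairDatabase hsjf hxy hn).size + 4) ^ 4 :=
      Nat.pow_le_pow_left (by rw [hsz]; have := Nat.le_mul_of_pos_left n hα; omega) 4
    have hle : (n : ℤ) ^ 4 ≤ (((pairDatabase hsjf hxy hn).size + 4) ^ 4 : ℕ) := by exact_mod_cast hnm
    refine le_trans ?_ hle
    refine Fin.addCases (motive := fun e => |Fin.append A B e| ≤ (n : ℤ) ^ 4) (fun i => ?_) (fun i => ?_) e
    · rw [Fin.append_left]; exact hA i
    · rw [Fin.append_right]; exact hB i)
  have hlenE : (databaseCode n μ (pairRelations x y)).length ≤ E n := by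
    rw [← henc]
    refine (Database.length_encode _ _).le.trans ((Database.blockAddr_le _ ham _).trans (le_of_eq ?_))
    rw [hsz]
  obtain ⟨I, J, hIJ, hmono, hsurj⟩ := hL.pairSums hsjf hxy hno hn A B
  rw [hsz, henc] at hrun₀
  rw [hsz] at hacc
  have hrep : RepliesSums acc x y (Ta (m n)) ((m n + k) ^ k) n (n * n) Inv μ
      (fun p => A (I p) + B (J p)) := by
    intro M hM p hp
    have hnm : n ≤ m n + 4 := by
      have := Nat.le_mul_of_pos_left n hα
      change n ≤ α * n + β + 4
      omega
    have hp4 : p + 1 ≤ (m n + 4) ^ 4 :=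
      calc p + 1 ≤ n * n := hp
        _ = n ^ 2 := (sq n).symm
        _ ≤ (m n + 4) ^ 2 := Nat.pow_le_pow_left hnm 2
        _ ≤ (m n + 4) ^ 4 := Nat.pow_le_pow_right (by omega) (by norm_num)
    obtain ⟨c, hrun, hreply, hinv⟩ := hacc M hM (p + 1) (by omega) hp4
    have hLp : L[p + 1 - 1]? = some (pairAnswer x y hn (I p) (J p)) := hIJ p hp
    rw [hLp] at hreply
    refine ⟨c, hrun, hinv, I p, n + J p, (hreply.2 x).trans ?_, (hreply.2 y).trans ?_, by omega, by omega, ?_⟩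
    · rw [pairAnswer_left]; rfl
    · rw [pairAnswer_right hxy]; rfl
    · have h1 := hAB (Fin.castAdd n (I p))
      have h2 := hAB (Fin.natAdd n (J p))
      rw [Fin.append_left] at h1
      rw [Fin.append_right] at h2
      exact congrArg₂ (· + ·) h1 h2
  have hEK : (databaseCode n μ (pairRelations x y)).length * (3 * n + 1) ≤ E n * (3 * n + 1) :=
    Nat.mul_le_mul_right _ hlenE
  refine Exec.seq ((exec_emitDatabase hn (hw n hn) (by omega) (fun r h1 h5 => ?_) (by simp) hzero).mono
    (by rw [hs]) ?_)
  · simp [Function.update_of_ne h1, Function.update_of_ne h5]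
  intro ρ₁ μ₁ hE₁
  refine Exec.seq ((exec_simulate (K := 3 * n + 1) hrun₀ rfl (fun r => hE₁.blank _ (by omega)) hE₁.view
    hE₁.reg_K (by omega) (by change (m n + k) ^ k * _ ≤ _; omega)).mono le_rfl ?_)
  rintro ρ₂ μ₂ ⟨hreg, hown, hmem, hrest⟩
  refine (exec_searchAll (K := 3 * n + 1) (B := n ^ 4) hrep hR1
    (fun T W c c' hrun r hr => hR₂ T W c c' hrun r (by omega)) (by omega) hBμ (by omega) hmono hn
    ⟨?_, ?_, fun r hr => ?_, ?_, fun a ha => ?_⟩).mono le_rfl ?_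
  · rw [hown 1 (by norm_num) (by norm_num), hE₁.reg_n]
  · rw [hown 2 (by norm_num) (by norm_num), hE₁.reg_K]
  · obtain ⟨r, rfl⟩ := Nat.exists_eq_add_of_le' (by omega : 32 ≤ r)
    rw [hreg, hR₁ _ _ _ _ hrun₀ r (by omega)]
    rfl
  · rwa [funext hmem]
  · rw [hrest a ha, hE₁.rest a ha]
  · intro ρ μ' h
    rw [h]
    congr 1
    refine propext ⟨?_, ?_⟩
    · rintro ⟨j, hj, p, -, hp⟩
      exact ⟨I p, J p, ⟨j, hj⟩, hp.trans (hCk ⟨j, hj⟩)⟩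
    · rintro ⟨i, j, l, hl⟩
      obtain ⟨p, hp, rfl, rfl⟩ := hsurj i j
      exact ⟨l, l.2, p, hp, hl.trans (hCk l).symm⟩

end SumDirectAccess

theorem mainTheorem5 (h3sum : ThreeSumHypothesis) (q : JoinQuery)
    (hacyclic : q.Acyclic) (hsjf : q.SelfJoinFree) :
    AdmitsSumDirectAccess q (fun m => (m : ℝ)) (fun _ => 1) ↔
      ∃ i : Fin q.numAtoms, ∀ x : Fin q.numVars, x ∈ q.scope i := by
  refine ⟨fun h => ?_, fun ⟨i, hi⟩ => admitsSumDirectAccess_of_full_atom i hi⟩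
  by_contra hfull
  obtain ⟨x, y, hxy, hno⟩ := hacyclic.exists_pair hfull
  exact h3sum ⟨1 / 2, by norm_num, h.exists_solvesThreeSum hsjf hxy hno⟩
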